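/- Fix countably infinite supplies of standard names and of function symbols of every arity. A function term is $f(n_1,\dots,n_j)$ with a function symbol $f$ and standard names $n_i$; literals are $t=n$ and $\neg\,t=n$ with a function term $t$ and a standard name $n$; formulas are built from literals by $\neg$, $\lor$ and the belief operators $\mathbf{B}_k$ ($k\ge 0$), and a formula is objective if it contains no $\mathbf{B}_k$. ($\land$ and $\to$ are abbreviations: $\alpha\land\beta$ is $\neg(\neg\alpha\lor\neg\beta)$ and $\alpha\to\beta$ is $\neg\alpha\lor\beta$.) A clause is a finite set of literals, and a non-empty clause is identified with the disjunction of its literals. A clause $c_1$ subsumes a clause $c_2$ if for every $t=n$ in $c_1$ either $t=n$ is in $c_2$ or $t\neq n'$ is in $c_2$ for some $n'$ distinct from $n$, and every $t\neq n$ in $c_1$ is in $c_2$. Two literals are complementary if they are $t=n$ and $t\neq n$, or $t=n$ and $t=n'$ with $n,n'$ distinct; the unit propagation of a clause $c$ and a literal $\ell$ removes from $c$ all literals complementary to $\ell$. For a set $s$ of clauses, $\mathrm{UP}(s)$ is its closure under unit propagation (of members $c$ with literals $\ell$ such that the unit clause $\{\ell\}$ is a member) and subsumption. Truth $s\models\alpha$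 is defined by: $s\models c$ iff $c\in\mathrm{UP}(s)$ for a clause $c$; $s\models\alpha\lor\beta$ iff $s\models\alpha$ or $s\models\beta$, if $\alpha\lor\beta$ is not a clause; $s\models\neg(\alpha\lor\beta)$ iff $s\models\neg\alpha$ and $s\models\neg\beta$; $s\models\neg\neg\alpha$ iff $s\models\alpha$; $s\models\mathbf{B}_0\alpha$ iff $s\models\alpha$; $s\models\mathbf{B}_{k+1}\alpha$ iff for some function term $t$, for all standard names $n$, $s\cup\{t=n\}\models\mathbf{B}_k\alpha$; and $s\models\neg\mathbf{B}_k\alpha$ iff not $s\models\mathbf{B}_k\alpha$. A formula is valid if it is true for every set of clauses. The problem Limited Belief Reasoning is: given objective formulas $\mathrm{KB}$ (in conjunctive normal form) and $\alpha$, and a belief level $k\ge 0$ in binary, decide whether $\mathbf{B}_0\mathrm{KB}\to\mathbf{B}_k\alpha$ is valid. Let $F$ and $N$ be the sets of function terms and of standard names that are mentioned in $\mathrm{KB}$ and $\alpha$ (the arguments of function terms are included in $N$). A parameterized problem is in FPT if some multi-stack Turing machine solves every instance in at most $f(\kappa)\cdot p(n)$ steps, where $\kappa$ is the parameter, $n$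 is the length of the input, $f$ is a computable function and $p$ is a polynomial. Then: 1. Limited Belief Reasoning with parameters $|F|$ and $|N|$ is in FPT. 2. This also holds when $|N|$ is constant: for every constant $b$, Limited Belief Reasoning restricted to the inputs with $|N|\le b$ is in FPT with parameter $|F|$. 3. There are a polynomial $p$ and a constant $c$ such that some multi-stack Turing machine decides Limited Belief Reasoning within $$\bigl(|F|\cdot(|N|+|F|)\bigr)^{|F|}\cdot p(m)+c\cdot\lvert k\rvert$$ steps, where $m=|\mathrm{KB}|+|\alpha|$ is the total length of the two formulas (written over a finite alphabet) and $|k|$ is the number of binary digits of $k$ (the second summand accounts for reading $k$). 4. Belief stabilizes at level $|F|$: if $s$ is a set of clauses, $\alpha$ an objective formula and $F$ a finite set that contains all function terms in $s$ and $\alpha$, then for every $k\ge|F|$, $s\models\mathbf{B}_k\alpha$ iff $s\models\mathbf{B}_{|F|}\alpha$. -/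

import Mathlib

namespace LimitedBelief

/-! ### The language -/

/-- Standard names: a countably infinite supply of pairwise distinct individuals. -/
abbrev Name : Type := ℕ

/-- Function terms `f(n₁, …, nⱼ)`. There are infinitely many function symbols of every arity: a
symbol is given by its index `symb` together with its arity, the length of `args`. -/
structure FTerm where
  symb : ℕ
  args : List Name
deriving DecidableEq

/-- Literals `t = n` and `t ≠ n` with a function term `t` and a standard name `n`. -/
inductive Literal where
  | eq (t : FTerm) (n : Name)
  | ne (t : FTerm) (n : Name)
deriving DecidableEq

/-- The function term of a literal. -/
def Literal.term : Literal → FTerm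
  | .eq t _ => t
  | .ne t _ => t

/-- A clause is a (finite) set of literals. -/
abbrev Clause : Type := Finset Literal

/-- Formulas: `t = n`, `¬ α`, `(α ∨ β)` and `B k α`. -/
inductive Formula where
  | eq (t : FTerm) (n : Name)
  | neg (α : Formula)
  | or (α β : Formula)
  | bel (k : ℕ) (α : Formula)

namespace Formula

/-- `(α ∧ β)` abbreviates `¬ (¬ α ∨ ¬ β)`. -/
def and (α β : Formula) : Formula := neg (or (neg α) (neg β))

/-- `(α → β)` abbreviates `(¬ α ∨ β)`. -/
def imp (α β : Formula) : Formula := or (neg α) β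

/-- A formula is objective if it contains no belief operator. -/
def IsObjective : Formula → Prop
  | eq _ _ => True
  | neg α => α.IsObjective
  | or α β => α.IsObjective ∧ β.IsObjective
  | bel _ _ => False

/-- A disjunction of literals (in any bracketing) is identified with the clause of these literals;
every other formula is not a clause. -/
def toClause : Formula → Option Clause
  | eq t n => some {Literal.eq t n}
  | neg (eq t n) => some {Literal.ne t n}
  | or α β =>
    match α.toClause, β.toClause with
    | some c, some d => some (c ∪ d)
    | _, _ => none
  | _ => none

/-- Conjunctive normal form: a conjunction of disjunctions of literals (in any bracketing). -/
inductive IsCNF : Formula → Prop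
  | clause {α : Formula} : α.toClause.isSome → IsCNF α
  | and {α β : Formula} : IsCNF α → IsCNF β → IsCNF (α.and β)

/-- The function terms that occur in a formula. -/
def funcs : Formula → Finset FTerm
  | eq t _ => {t}
  | neg α => α.funcs
  | or α β => α.funcs ∪ β.funcs
  | bel _ α => α.funcs

/-- The standard names that occur in a formula, on the right-hand side of a literal or as an
argument of a function term. -/
def names : Formula → Finset Name
  | eq t n => insert n t.args.toFinset
  | neg α => α.names
  | or α β => α.names ∪ β.names
  | bel _ α => α.names

end Formula

/-! ### The semantics -/

/-- Two literals are complementary when they are of the form `t = n` and `t ≠ n`, or `t = n` and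
`t = n'` with distinct `n, n'` (in either order). -/
def Complementary : Literal → Literal → Prop
  | .eq t n, .ne t' n' => t = t' ∧ n = n'
  | .ne t n, .eq t' n' => t = t' ∧ n = n'
  | .eq t n, .eq t' n' => t = t' ∧ n ≠ n'
  | .ne _ _, .ne _ _ => False

instance : DecidableRel Complementary := fun a b => by
  cases a <;> cases b <;> unfold Complementary <;> infer_instance

/-- The clause `c` subsumes the clause `d`. -/
def Subsumes (c d : Clause) : Prop :=
  (∀ t n, Literal.eq t n ∈ c →
    Literal.eq t n ∈ d ∨ ∃ n', n ≠ n' ∧ Literal.ne t n' ∈ d) ∧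
  (∀ t n, Literal.ne t n ∈ c → Literal.ne t n ∈ d)

/-- The unit propagation of the clause `c` and the literal `l`. -/
def propagate (c : Clause) (l : Literal) : Clause :=
  c.filter fun l' => ¬ Complementary l' l

/-- Membership in the closure `UP s` of the set of clauses `s` under unit propagation and
subsumption. -/
inductive InUP (s : Set Clause) : Clause → Prop
  | base {c : Clause} : c ∈ s → InUP s c
  | unit {c : Clause} {l : Literal} : InUP s c → InUP s {l} → InUP s (propagate c l)
  | subsume {c d : Clause} : InUP s c → Subsumes c d → InUP s d

/-- The closure of a set of clauses under unit propagation and subsumption. -/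
def UP (s : Set Clause) : Set Clause := {c | InUP s c}

/-- The truth relation: `Truth α s` means that the set of clauses `s` satisfies `α`. -/
def Truth : Formula → Set Clause → Prop
  | .eq t n, s => {Literal.eq t n} ∈ UP s
  | .neg (.eq t n), s => {Literal.ne t n} ∈ UP s
  | .or α β, s =>
    match (Formula.or α β).toClause with
    | some c => c ∈ UP s
    | none => Truth α s ∨ Truth β s
  | .neg (.or α β), s => Truth (.neg α) s ∧ Truth (.neg β) s
  | .neg (.neg α), s => Truth α s
  | .bel 0 α, s => Truth α s
  | .bel (k + 1) α, s => ∃ t : FTerm, ∀ n : Name, Truth (.bel k α) (s ∪ {{Literal.eq t n}})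
  | .neg (.bel k α), s => ¬ Truth (.bel k α) s
termination_by α => sizeOf α

/-- A formula is valid if it is true for every set of clauses. -/
def Valid (α : Formula) : Prop := ∀ s : Set Clause, Truth α s

/-! ### Encoding over a finite alphabet -/

/-- The finite alphabet in which formulas and numbers are written. -/
inductive Token where
  | eq | neg | or | bel | zero | one | arg | close
deriving DecidableEq

instance : Fintype Token :=
  ⟨{.eq, .neg, .or, .bel, .zero, .one, .arg, .close}, fun x => by cases x <;> decide⟩

/-- The binary digits of a number, least significant digit first, and an end marker. -/
def encodeNat (n : ℕ) : List Token :=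
  n.bits.map (fun b => if b then Token.one else Token.zero) ++ [Token.close]

/-- The symbol, the marked arguments and an end marker. -/
def encodeFTerm (t : FTerm) : List Token :=
  encodeNat t.symb ++ t.args.flatMap (fun n => Token.arg :: encodeNat n) ++ [Token.close]

/-- Formulas in Polish notation. -/
def encodeFormula : Formula → List Token
  | .eq t n => Token.eq :: (encodeFTerm t ++ encodeNat n)
  | .neg α => Token.neg :: encodeFormula α
  | .or α β => Token.or :: (encodeFormula α ++ encodeFormula β)
  | .bel k α => Token.bel :: (encodeNat k ++ encodeFormula α)

/-- The size `|α|` of a formula: the length of its encoding. -/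
def Formula.size (α : Formula) : ℕ := (encodeFormula α).length

/-! ### Limited Belief Reasoning -/

/-- The inputs of Limited Belief Reasoning: objective formulas `kb` in CNF and `query`, and a
belief level. -/
structure Input where
  kb : Formula
  query : Formula
  level : ℕ
  kb_objective : kb.IsObjective
  query_objective : query.IsObjective
  kb_cnf : kb.IsCNF

namespace Input

/-- The question: is `B 0 KB → B k α` valid? -/
def Yes (x : Input) : Prop := Valid ((Formula.bel 0 x.kb).imp (Formula.bel x.level x.query))

/-- The number `|F|` of function terms mentioned in the input. -/
def numFuncs (x : Input) : ℕ := (x.kb.funcs ∪ x.query.funcs).card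

/-- The number `|N|` of standard names mentioned in the input. -/
def numNames (x : Input) : ℕ := (x.kb.names ∪ x.query.names).card

/-- The input as a word: knowledge base, query and belief level (in binary). -/
def encode (x : Input) : List Token :=
  encodeFormula x.kb ++ encodeFormula x.query ++ encodeNat x.level

end Input

/-! ### Decision problems and fixed-parameter tractability -/

open Classical in
/-- Some multi-stack Turing machine decides, for every instance `x : I` (written as the word
`enc x` over the alphabet `A`), whether `yes x` holds, and halts after at most `time x` steps. -/
def DecidableInTime {I A : Type} (enc : I → List A) (yes : I → Prop) (time : I → ℕ) : Prop :=
  ∃ M : Turing.TM2ComputableAux A Bool, ∀ x : I,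
    Nonempty (Turing.TM2OutputsInTime M.tm
      ((enc x).map M.inputAlphabet.symm)
      (some ([decide (yes x)].map M.outputAlphabet.symm))
      (time x))

/-- The problem `yes` with parameter `param` is in `FPT`: it is decidable in time
`f (param x) * p |x|` for some computable function `f` and some polynomial `p`, where `|x|` is the
input size. -/
def FPT {I A P : Type} [Primcodable P] (enc : I → List A) (yes : I → Prop) (param : I → P) :
    Prop :=
  ∃ (f : P → ℕ) (p : Polynomial ℕ), Computable f ∧
    DecidableInTime enc yes fun x => f (param x) * p.eval (enc x).length

end LimitedBelief

/-!
Belief stabilizes because a formula believed at any level is true under every choice of values for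
all function terms (`truth_of_bel`), and values for function terms outside of `F` contribute nothing
to clauses over `F` (`InUP.restrict`, `bel_of_restrict`). Hence the formula is true under every
choice of values for `F` alone, and splitting once on each element of `F` gives belief at level
`|F|` (`bel_card`). This is `bel_stabilizes`; the same restriction shows that only splits on
elements of `F` matter.

For the decision procedure, validity amounts to belief given the set of clauses of the knowledge
base, since belief is monotone (`Input.yes_iff`). By stabilization, at most `|F|` splits are needed.
The values to be tried are infinitely many, but belief is invariant under renaming the names that do
not occur in the formulas (`bel_rename`), so that an unused fresh name stands for all others. It
suffices to try the names of the input and `|F|` fresh ones (`search_iff`), which leaves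
`Q = |F| * (|N| + |F|)` choices per split and `Q ^ |F|` leaves.

At a leaf, truth is decided in polynomial time. Literals refuted by derivable clauses are removed
until this has no effect any more, and then a clause is derivable if and only if one of the
remaining clauses subsumes it (`derivable_saturate`). Formulas are evaluated as words in Polish
notation, which determines at the same time which subformulas are clauses (`truth_val`,
`foldr_evalItem`).

The machines are obtained by compiling structured stack programs (`Exec.outputs`). Data are binary
trees, written as words on a stack, and functions on them computable in polynomial time are closed
under composition, case distinction and loops with results of bounded growth (`PolyTime`). The
search itself is a loop around a step computable in polynomial time, and takes at most
`(2 * d + 1) * Q ^ d` steps at depth `d` (`searchStep_iterate`, `searchTime_le`). Of the level, the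
program keeps about as many digits as the formulas have symbols, which suffices to find its minimum
with `|F|`; this is why reading it costs only a linear additive term (`runs_load`, `exists_runs`).
The claims about fixed-parameter tractability follow from the explicit bound; since at least one
function term occurs in the input, its exponential factor is positive and absorbs the additive term.
-/

namespace LimitedBelief

/-! ### Structured programs on stacks -/

open Turing

/-- Structured programs over stacks `k : K` with symbols in `Γ k`. Both `switch` and `loop` pop a
symbol (`none` if the stack is empty) and dispatch on it. A `loop` stops when the popped symbol
satisfies the exit condition; otherwise it runs its body and starts again. -/
inductive Prog {K : Type} (Γ : K → Type) where
  | push (k : K) (a : Γ k)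
  | seq (p q : Prog Γ)
  | switch (k : K) (f : Option (Γ k) → Prog Γ)
  | loop (k : K) (e : Option (Γ k) → Bool) (f : Option (Γ k) → Prog Γ)
  | skip

namespace Prog

variable {K : Type} [DecidableEq K] {Γ : K → Type}

/-- `Exec p S n S'`: started with the stacks `S`, the program `p` ends with the stacks `S'` after
exactly `n` steps. -/
inductive Exec : Prog Γ → (∀ k, List (Γ k)) → ℕ → (∀ k, List (Γ k)) → Prop
  | push {k a S} : Exec (push k a) S 1 (Function.update S k (a :: S k))
  | seq {p q S n S' m S''} : Exec p S n S' → Exec q S' m S'' → Exec (seq p q) S (n + m) S''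
  | switch {k f S n S'} :
      Exec (f (S k).head?) (Function.update S k (S k).tail) n S' → Exec (switch k f) S (1 + n) S'
  | loop_exit {k e f S} : e (S k).head? = true →
      Exec (loop k e f) S 1 (Function.update S k (S k).tail)
  | loop_step {k e f S n S' m S''} : e (S k).head? = false →
      Exec (f (S k).head?) (Function.update S k (S k).tail) n S' →
      Exec (loop k e f) S' m S'' → Exec (loop k e f) S (1 + n + m) S''
  | skip {S} : Exec skip S 1 S

/-- The control points of a program. -/
def Pos : Prog Γ → Type
  | push _ _ => Unit
  | seq p q => p.Pos ⊕ q.Pos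
  | switch k f => Option (Σ o : Option (Γ k), (f o).Pos)
  | loop k _ f => Option (Σ o : Option (Γ k), (f o).Pos)
  | skip => Unit

instance Pos.finite [∀ k, Finite (Γ k)] : ∀ p : Prog Γ, Finite p.Pos
  | push _ _ => inferInstanceAs (Finite Unit)
  | seq p q =>
    have := Pos.finite p
    have := Pos.finite q
    inferInstanceAs (Finite (p.Pos ⊕ q.Pos))
  | switch k f =>
    have := fun o => Pos.finite (f o)
    inferInstanceAs (Finite (Option (Σ o : Option (Γ k), (f o).Pos)))
  | loop k _ f =>
    have := fun o => Pos.finite (f o)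
    inferInstanceAs (Finite (Option (Σ o : Option (Γ k), (f o).Pos)))
  | skip => inferInstanceAs (Finite Unit)

/-- The control point at which a program starts. -/
def entry : (p : Prog Γ) → p.Pos
  | push _ _ => ()
  | seq p _ => Sum.inl p.entry
  | switch _ _ => none
  | loop _ _ _ => none
  | skip => ()

/-- The statements of a machine that runs the program `p` and then goes to the label `next`; the
control points of `p` are turned into labels by `emb`. The internal state of the machine holds the
symbol that was popped last from each stack. -/
def stmts {Λ : Type} : (p : Prog Γ) → (emb : p.Pos → Λ) → (next : Λ) → p.Pos →
    TM2.Stmt Γ Λ (∀ k, Option (Γ k))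
  | push k a, _, next => fun _ => .push k (fun _ => a) (.goto fun _ => next)
  | seq p q, emb, next => Sum.elim
      (p.stmts (fun x => emb (Sum.inl x)) (emb (Sum.inr q.entry)))
      (q.stmts (fun x => emb (Sum.inr x)) next)
  | switch k f, emb, next => fun x =>
    match x with
    | none => .pop k (fun v o => Function.update v k o)
        (.goto fun v => emb (some ⟨v k, (f (v k)).entry⟩))
    | some ⟨o, x⟩ => (f o).stmts (fun y => emb (some ⟨o, y⟩)) next x
  | loop k e f, emb, next => fun x =>
    match x with
    | none => .pop k (fun v o => Function.update v k o)
        (.goto fun v => if e (v k) then next else emb (some ⟨v k, (f (v k)).entry⟩))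
    | some ⟨o, x⟩ => (f o).stmts (fun y => emb (some ⟨o, y⟩)) (emb none) x
  | skip, _, next => fun _ => .goto fun _ => next

theorem Exec.evals {Λ : Type} (M : Λ → TM2.Stmt Γ Λ (∀ k, Option (Γ k))) {p : Prog Γ}
    {S S' : ∀ k, List (Γ k)} {n : ℕ} (h : Exec p S n S') :
    ∀ (emb : p.Pos → Λ) (next : Λ), (∀ x, M (emb x) = p.stmts emb next x) →
      ∀ v, ∃ v', (flip bind (TM2.step M))^[n] (some ⟨some (emb p.entry), v, S⟩) =
        some ⟨some next, v', S'⟩ := by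
  have unroll : ∀ (l : Λ) (v) (S) (c), TM2.stepAux (M l) v S = c →
      flip bind (TM2.step M) (some ⟨some l, v, S⟩) = some c := by
    rintro l v S _ rfl
    rfl
  induction h with
  | @push k a S =>
    intro emb next hM v
    refine ⟨v, ?_⟩
    rw [Function.iterate_one]
    refine unroll _ _ _ _ ?_
    rw [hM]
    rfl
  | seq _ _ ih₁ ih₂ =>
    intro emb next hM v
    obtain ⟨v₁, h₁⟩ := ih₁ (fun x => emb (Sum.inl x)) (emb (Sum.inr (entry _)))
      (fun x => hM (Sum.inl x)) v
    obtain ⟨v₂, h₂⟩ := ih₂ (fun x => emb (Sum.inr x)) next (fun x => hM (Sum.inr x)) v₁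
    refine ⟨v₂, ?_⟩
    rw [add_comm, Function.iterate_add_apply, entry, h₁, h₂]
  | @switch k f S n S' _ ih =>
    intro emb next hM v
    obtain ⟨v', h'⟩ := ih (fun y => emb (some ⟨_, y⟩)) next
      (fun y => by rw [hM (some ⟨_, y⟩), stmts]) (Function.update v k (S k).head?)
    refine ⟨v', ?_⟩
    rw [← h', add_comm, Function.iterate_add_apply, Function.iterate_one]
    congr 1
    refine unroll _ _ _ _ ?_
    rw [hM, entry, stmts]
    simp only [TM2.stepAux]
    rw [Function.update_self]
  | @loop_exit k e f S he =>
    intro emb next hM v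
    refine ⟨Function.update v k (S k).head?, ?_⟩
    rw [Function.iterate_one]
    refine unroll _ _ _ _ ?_
    rw [hM, entry, stmts]
    simp [he]
  | @loop_step k e f S n S' m S'' he _ _ ih₁ ih₂ =>
    intro emb next hM v
    obtain ⟨v₁, h₁⟩ := ih₁ (fun y => emb (some ⟨_, y⟩)) (emb none)
      (fun y => by rw [hM (some ⟨_, y⟩), stmts]) (Function.update v k (S k).head?)
    obtain ⟨v₂, h₂⟩ := ih₂ emb next hM v₁
    refine ⟨v₂, ?_⟩
    rw [← h₂, add_comm, Function.iterate_add_apply]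
    congr 1
    refine Eq.trans ?_ h₁
    rw [add_comm 1 n, Function.iterate_add_apply, Function.iterate_one]
    congr 1
    refine unroll _ _ _ _ ?_
    rw [hM, entry, stmts]
    simp only [TM2.stepAux]
    rw [Function.update_self, if_neg (by simp [he])]
  | skip =>
    intro emb next hM v
    refine ⟨v, ?_⟩
    rw [Function.iterate_one]
    refine unroll _ _ _ _ ?_
    rw [hM]
    rfl

/-- The machine that runs the program `p`, with input on the stack `k₀` and output on `k₁`. -/
noncomputable def machine [Fintype K] [∀ k, Finite (Γ k)] (p : Prog Γ) (k₀ k₁ : K) : FinTM2 :=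
  have := Pos.finite p
  have := Fintype.ofFinite p.Pos
  have := Fintype.ofFinite (Γ k₀)
  have := Fintype.ofFinite (∀ k, Option (Γ k))
  { k₀ := k₀
    k₁ := k₁
    Γ := Γ
    Λ := Option p.Pos
    main := some p.entry
    σ := ∀ k, Option (Γ k)
    initialState := fun _ => none
    m := fun x =>
      match x with
      | none => .load (fun _ _ => none) .halt
      | some x => p.stmts some none x }

theorem Exec.outputs [Fintype K] [∀ k, Finite (Γ k)] {p : Prog Γ} {k₀ k₁ : K}
    {x : List (Γ k₀)} {y : List (Γ k₁)} {n : ℕ}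
    (h : Exec p (Function.update (fun _ => []) k₀ x) n (Function.update (fun _ => []) k₁ y)) :
    Nonempty (TM2OutputsInTime (p.machine k₀ k₁) x (some y) (n + 1)) := by
  have hinit : ∀ k : K, (initList (p.machine k₀ k₁) x).stk k =
      Function.update (fun _ => []) k₀ x k := by
    intro k
    by_cases hk : k = k₀
    · subst hk
      rw [Function.update_self]
      exact dif_pos rfl
    · rw [Function.update_of_ne hk]
      exact dif_neg hk
  have hhalt : ∀ k : K, (haltList (p.machine k₀ k₁) y).stk k =
      Function.update (fun _ => []) k₁ y k := by
    intro k
    by_cases hk : k = k₁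
    · subst hk
      rw [Function.update_self]
      exact dif_pos rfl
    · rw [Function.update_of_ne hk]
      exact dif_neg hk
  obtain ⟨v, hv⟩ := h.evals (p.machine k₀ k₁).m (fun x => some x) none (fun x => rfl)
    (fun _ => none)
  rw [← funext hinit, ← funext hhalt] at hv
  refine ⟨⟨⟨n + 1, ?_⟩, le_rfl⟩⟩
  rw [add_comm, Function.iterate_add_apply, Function.iterate_one]
  exact congrArg (flip bind (FinTM2.step (p.machine k₀ k₁))) hv

/-- Started with the stacks `S`, the program `p` ends with the stacks `S'` after at most `n`
steps. -/
def Runs (p : Prog Γ) (S : ∀ k, List (Γ k)) (n : ℕ) (S' : ∀ k, List (Γ k)) : Prop :=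
  ∃ m ≤ n, Exec p S m S'

theorem Runs.mono {p : Prog Γ} {S S' : ∀ k, List (Γ k)} {n m : ℕ} (h : Runs p S n S')
    (hnm : n ≤ m) : Runs p S m S' :=
  let ⟨a, ha, he⟩ := h
  ⟨a, ha.trans hnm, he⟩

theorem Runs.push {k : K} {a : Γ k} {S S' : ∀ k, List (Γ k)}
    (h : Function.update S k (a :: S k) = S') : Runs (push k a) S 1 S' :=
  ⟨1, le_rfl, h ▸ .push⟩

theorem Runs.seq {p q : Prog Γ} {S S' S'' : ∀ k, List (Γ k)} {n m : ℕ} (h₁ : Runs p S n S')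
    (h₂ : Runs q S' m S'') : Runs (seq p q) S (n + m) S'' :=
  let ⟨_, ha, he⟩ := h₁
  let ⟨_, hb, he'⟩ := h₂
  ⟨_, Nat.add_le_add ha hb, .seq he he'⟩

theorem Runs.switch {k : K} {f : Option (Γ k) → Prog Γ} {S S' S'' : ∀ k, List (Γ k)} {n : ℕ}
    (o : Option (Γ k)) (ho : (S k).head? = o) (hS : Function.update S k (S k).tail = S')
    (h : Runs (f o) S' n S'') : Runs (switch k f) S (1 + n) S'' := by
  subst ho hS
  obtain ⟨a, ha, he⟩ := h
  exact ⟨_, Nat.add_le_add_left ha 1, .switch he⟩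

theorem Runs.loop_exit {k : K} {e : Option (Γ k) → Bool} {f : Option (Γ k) → Prog Γ}
    {S S' : ∀ k, List (Γ k)} (he : e (S k).head? = true)
    (hS : Function.update S k (S k).tail = S') : Runs (loop k e f) S 1 S' :=
  ⟨1, le_rfl, hS ▸ .loop_exit he⟩

theorem Runs.loop_step {k : K} {e : Option (Γ k) → Bool} {f : Option (Γ k) → Prog Γ}
    {S S' S'' S₃ : ∀ k, List (Γ k)} {n m : ℕ} (o : Option (Γ k)) (ho : (S k).head? = o)
    (he : e o = false) (hS : Function.update S k (S k).tail = S') (h₁ : Runs (f o) S' n S'')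
    (h₂ : Runs (loop k e f) S'' m S₃) : Runs (loop k e f) S (1 + n + m) S₃ := by
  subst ho hS
  obtain ⟨a, ha, h₁⟩ := h₁
  obtain ⟨b, hb, h₂⟩ := h₂
  exact ⟨_, by gcongr, .loop_step he h₁ h₂⟩

theorem Runs.skip {S : ∀ k, List (Γ k)} : Runs (skip : Prog Γ) S 1 S :=
  ⟨1, le_rfl, .skip⟩

/-- A program writes at most one symbol per step. -/
theorem Runs.length_le {p : Prog Γ} {S S' : ∀ k, List (Γ k)} {n : ℕ} (h : Runs p S n S') (k : K) :
    (S' k).length ≤ (S k).length + n := by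
  obtain ⟨m, hm, h⟩ := h
  have update_tail : ∀ (S : ∀ k, List (Γ k)) (j : K),
      (Function.update S j (S j).tail k).length ≤ (S k).length := by
    intro S j
    by_cases hj : k = j
    · subst hj; simp
    · simp [hj]
  suffices (S' k).length ≤ (S k).length + m by omega
  clear hm
  induction h with
  | @push j a S =>
    by_cases hj : k = j
    · subst hj; simp
    · simp [hj]
  | seq _ _ ih₁ ih₂ => omega
  | @switch j f S n S' _ ih => have := update_tail S j; omega
  | @loop_exit j e f S he => have := update_tail S j; omega
  | @loop_step j e f S n S' m S'' he _ _ ih₁ ih₂ => have := update_tail S j; omega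
  | skip => omega

end Prog

end LimitedBelief

namespace LimitedBelief

open Prog

/-! ### Binary trees on a stack -/

/-- Binary trees without labels, the data on which the machine computes. -/
inductive Data where
  | nil
  | cons (x y : Data)

/-- Trees are written in Polish notation, so that a stack can hold a sequence of trees. -/
def Data.code : Data → List Bool
  | nil => [false]
  | cons x y => true :: (x.code ++ y.code)

/-- No code of a tree is a proper prefix of another one. -/
theorem Data.code_append_inj : ∀ {x y : Data} {l l' : List Bool},
    x.code ++ l = y.code ++ l' → x = y ∧ l = l'
  | nil, nil, _, _, h => by simpa [code] using h
  | nil, cons _ _, _, _, h => by simp [code] at h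
  | cons _ _, nil, _, _, h => by simp [code] at h
  | cons x x', cons y y', l, l', h => by
    simp only [code, List.cons_append, List.append_assoc, List.cons.injEq, true_and] at h
    obtain ⟨h₁, h⟩ := Data.code_append_inj h
    obtain ⟨h₂, h⟩ := Data.code_append_inj h
    exact ⟨by rw [h₁, h₂], h⟩

theorem Data.code_injective : Function.Injective Data.code := fun x y h =>
  (Data.code_append_inj (l := []) (l' := []) (by simpa using h)).1

/-- The stacks of the machine: the input, the input in reverse order, a main stack that holds a
sequence of trees, and three auxiliary stacks. -/
inductive Stack where
  | inp | rev | main | a | b | c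
deriving DecidableEq

instance : Fintype Stack :=
  ⟨{.inp, .rev, .main, .a, .b, .c}, fun x => by cases x <;> decide⟩

/-- The symbols on the stacks. -/
def Sym : Stack → Type
  | .inp => Token
  | .rev => Token
  | _ => Bool

instance : ∀ k, Finite (Sym k)
  | .inp => inferInstanceAs (Finite Token)
  | .rev => inferInstanceAs (Finite Token)
  | .main => inferInstanceAs (Finite Bool)
  | .a => inferInstanceAs (Finite Bool)
  | .b => inferInstanceAs (Finite Bool)
  | .c => inferInstanceAs (Finite Bool)

/-- The given contents of the stacks. -/
def store (i r : List Token) (m a b c : List Bool) : ∀ k, List (Sym k)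
  | .inp => i
  | .rev => r
  | .main => m
  | .a => a
  | .b => b
  | .c => c

section store

variable {i r : List Token} {m a b c : List Bool} {t : Token} {x : Bool}

theorem push_rev : Function.update (store i r m a b c) .rev (t :: store i r m a b c .rev) =
    store i (t :: r) m a b c := by funext k; cases k <;> rfl

theorem push_main : Function.update (store i r m a b c) .main (x :: store i r m a b c .main) =
    store i r (x :: m) a b c := by funext k; cases k <;> rfl

theorem push_a : Function.update (store i r m a b c) .a (x :: store i r m a b c .a) =
    store i r m (x :: a) b c := by funext k; cases k <;> rfl

theorem push_b : Function.update (store i r m a b c) .b (x :: store i r m a b c .b) =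
    store i r m a (x :: b) c := by funext k; cases k <;> rfl

theorem push_c : Function.update (store i r m a b c) .c (x :: store i r m a b c .c) =
    store i r m a b (x :: c) := by funext k; cases k <;> rfl

theorem pop_inp : Function.update (store i r m a b c) .inp (store i r m a b c .inp).tail =
    store i.tail r m a b c := by funext k; cases k <;> rfl

theorem pop_rev : Function.update (store i r m a b c) .rev (store i r m a b c .rev).tail =
    store i r.tail m a b c := by funext k; cases k <;> rfl

theorem pop_main : Function.update (store i r m a b c) .main (store i r m a b c .main).tail =
    store i r m.tail a b c := by funext k; cases k <;> rfl

theorem pop_a : Function.update (store i r m a b c) .a (store i r m a b c .a).tail =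
    store i r m a.tail b c := by funext k; cases k <;> rfl

theorem pop_b : Function.update (store i r m a b c) .b (store i r m a b c .b).tail =
    store i r m a b.tail c := by funext k; cases k <;> rfl

theorem pop_c : Function.update (store i r m a b c) .c (store i r m a b c .c).tail =
    store i r m a b c.tail := by funext k; cases k <;> rfl

end store

/-! ### Elementary stack programs -/

/-- The exit condition of a loop that runs until its stack is empty. -/
abbrev isNone {A : Type} : Option A → Bool := Option.isNone

/-- Moves a symbol from the main stack to the place given by `f`. The stack `c` holds one symbol
for each tree that is still to be read. -/
def takeSymbol (f : Bool → Prog Sym) : Prog Sym :=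
  switch .main fun o =>
    match (o : Option Bool) with
    | some true => seq (f true) (seq (push .c (true : Bool)) (push .c (true : Bool)))
    | some false => f false
    | none => skip

/-- Moves trees from the main stack, one for each symbol on the stack `c`. -/
def takeLoop (f : Bool → Prog Sym) : Prog Sym := loop .c isNone fun _ => takeSymbol f

/-- Moves a tree from the main stack to the stack `a`. -/
def takeA : Prog Sym := seq (push .c (true : Bool)) (takeLoop fun x => push .a x)

/-- Moves a tree from the main stack to the stack `b`. -/
def takeB : Prog Sym := seq (push .c (true : Bool)) (takeLoop fun x => push .b x)

theorem runs_takeLoop_a {i r : List Token} (x : Data) : ∀ {m a b c : List Bool} {n : ℕ} {S},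
    Runs (takeLoop fun x => push .a x) (store i r m (x.code.reverse ++ a) b c) n S →
    Runs (takeLoop fun x => push .a x) (store i r (x.code ++ m) a b (true :: c))
      (5 * x.code.length + n) S := by
  induction x with
  | nil =>
    intro m a b c n S h
    have step : Runs (takeSymbol fun x => push .a x) (store i r (false :: m) a b c) 2
        (store i r m (false :: a) b c) :=
      (Runs.switch (some false) rfl pop_main (Runs.push push_a)).mono le_rfl
    refine (Runs.loop_step (some true) rfl rfl pop_c step h).mono ?_
    simp [Data.code]
  | cons x y ihx ihy =>
    intro m a b c n S h
    have step : Runs (takeSymbol fun x => push .a x)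
        (store i r (true :: (x.code ++ (y.code ++ m))) a b c) 4
        (store i r (x.code ++ (y.code ++ m)) (true :: a) b (true :: true :: c)) :=
      (Runs.switch (some true) rfl pop_main
        ((Runs.push push_a).seq ((Runs.push push_c).seq (Runs.push push_c)))).mono le_rfl
    have rest := ihx (ihy (n := n) (S := S) (a := x.code.reverse ++ (true :: a))
      (by simpa [Data.code] using h))
    simp only [Data.code, List.cons_append, List.append_assoc]
    refine (Runs.loop_step (some true) rfl rfl pop_c step rest).mono ?_
    simp; omega

theorem runs_takeLoop_b {i r : List Token} (x : Data) : ∀ {m a b c : List Bool} {n : ℕ} {S},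
    Runs (takeLoop fun x => push .b x) (store i r m a (x.code.reverse ++ b) c) n S →
    Runs (takeLoop fun x => push .b x) (store i r (x.code ++ m) a b (true :: c))
      (5 * x.code.length + n) S := by
  induction x with
  | nil =>
    intro m a b c n S h
    have step : Runs (takeSymbol fun x => push .b x) (store i r (false :: m) a b c) 2
        (store i r m a (false :: b) c) :=
      (Runs.switch (some false) rfl pop_main (Runs.push push_b)).mono le_rfl
    refine (Runs.loop_step (some true) rfl rfl pop_c step h).mono ?_
    simp [Data.code]
  | cons x y ihx ihy =>
    intro m a b c n S h
    have step : Runs (takeSymbol fun x => push .b x)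
        (store i r (true :: (x.code ++ (y.code ++ m))) a b c) 4
        (store i r (x.code ++ (y.code ++ m)) a (true :: b) (true :: true :: c)) :=
      (Runs.switch (some true) rfl pop_main
        ((Runs.push push_b).seq ((Runs.push push_c).seq (Runs.push push_c)))).mono le_rfl
    have rest := ihx (ihy (n := n) (S := S) (b := x.code.reverse ++ (true :: b))
      (by simpa [Data.code] using h))
    simp only [Data.code, List.cons_append, List.append_assoc]
    refine (Runs.loop_step (some true) rfl rfl pop_c step rest).mono ?_
    simp; omega

theorem runs_takeA {i r : List Token} (x : Data) (m a b : List Bool) :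
    Runs takeA (store i r (x.code ++ m) a b []) (5 * x.code.length + 2)
      (store i r m (x.code.reverse ++ a) b []) :=
  ((Runs.push push_c).seq (runs_takeLoop_a x (Runs.loop_exit rfl pop_c))).mono (by omega)

theorem runs_takeB {i r : List Token} (x : Data) (m a b : List Bool) :
    Runs takeB (store i r (x.code ++ m) a b []) (5 * x.code.length + 2)
      (store i r m a (x.code.reverse ++ b) []) :=
  ((Runs.push push_c).seq (runs_takeLoop_b x (Runs.loop_exit rfl pop_c))).mono (by omega)

/-- Empties the stack `a`. -/
def dropA : Prog Sym := loop .a isNone fun _ => skip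

/-- Empties the stack `c`. -/
def dropC : Prog Sym := loop .c isNone fun _ => skip

/-- Pours the stack `a` onto the main stack. -/
def pourA : Prog Sym := loop .a isNone fun o =>
  match (o : Option Bool) with
  | some x => push .main x
  | none => skip

/-- Pours the stack `b` onto the main stack. -/
def pourB : Prog Sym := loop .b isNone fun o =>
  match (o : Option Bool) with
  | some x => push .main x
  | none => skip

/-- Pours the stack `b` onto the stack `a`. -/
def pourBA : Prog Sym := loop .b isNone fun o =>
  match (o : Option Bool) with
  | some x => push .a x
  | none => skip

/-- Pours the stack `a` onto the main stack and onto the stack `b`. -/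
def pourABoth : Prog Sym := loop .a isNone fun o =>
  match (o : Option Bool) with
  | some x => seq (push .main x) (push .b x)
  | none => skip

section

variable {i r : List Token} {b c : List Bool}

theorem runs_dropA (a : List Bool) : ∀ {m : List Bool},
    Runs dropA (store i r m a b c) (2 * a.length + 1) (store i r m [] b c) := by
  induction a with
  | nil => exact Runs.loop_exit rfl pop_a
  | cons x a ih =>
    intro m
    refine (Runs.loop_step (some x) rfl rfl pop_a Runs.skip ih).mono ?_
    simp; omega

theorem runs_dropC (c : List Bool) {m a : List Bool} :
    Runs dropC (store i r m a b c) (2 * c.length + 1) (store i r m a b []) := by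
  induction c with
  | nil => exact Runs.loop_exit rfl pop_c
  | cons x a ih =>
    refine (Runs.loop_step (some x) rfl rfl pop_c Runs.skip ih).mono ?_
    simp; omega

theorem runs_pourA (a : List Bool) : ∀ {m : List Bool},
    Runs pourA (store i r m a b c) (2 * a.length + 1) (store i r (a.reverse ++ m) [] b c) := by
  induction a with
  | nil => exact Runs.loop_exit rfl pop_a
  | cons x a ih =>
    intro m
    rw [List.reverse_cons, List.append_assoc]
    refine (Runs.loop_step (some x) rfl rfl pop_a (Runs.push push_main) ih).mono ?_
    simp; omega

theorem runs_pourB (b : List Bool) : ∀ {m a : List Bool},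
    Runs pourB (store i r m a b c) (2 * b.length + 1) (store i r (b.reverse ++ m) a [] c) := by
  induction b with
  | nil => exact Runs.loop_exit rfl pop_b
  | cons x b ih =>
    intro m a
    rw [List.reverse_cons, List.append_assoc]
    refine (Runs.loop_step (some x) rfl rfl pop_b (Runs.push push_main) ih).mono ?_
    simp; omega

theorem runs_pourBA (b : List Bool) : ∀ {m a : List Bool},
    Runs pourBA (store i r m a b c) (2 * b.length + 1) (store i r m (b.reverse ++ a) [] c) := by
  induction b with
  | nil => exact Runs.loop_exit rfl pop_b
  | cons x b ih =>
    intro m a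
    rw [List.reverse_cons, List.append_assoc]
    refine (Runs.loop_step (some x) rfl rfl pop_b (Runs.push push_a) ih).mono ?_
    simp; omega

theorem runs_pourABoth (a : List Bool) : ∀ {m b : List Bool},
    Runs pourABoth (store i r m a b c) (3 * a.length + 1)
      (store i r (a.reverse ++ m) [] (a.reverse ++ b) c) := by
  induction a with
  | nil => exact Runs.loop_exit rfl pop_a
  | cons x a ih =>
    intro m b
    rw [List.reverse_cons, List.append_assoc, List.append_assoc]
    refine (Runs.loop_step (some x) rfl rfl pop_a
      ((Runs.push push_main).seq (Runs.push push_b)) ih).mono ?_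
    simp; omega

end

/-- The stacks between two operations on trees: only the main stack is in use. -/
def work (m : List Bool) : ∀ k, List (Sym k) := store [] [] m [] [] []

theorem runs_push (x : Bool) (m : List Bool) :
    Runs (push .main (x : Bool)) (work m) 1 (work (x :: m)) :=
  Runs.push push_main

theorem runs_switch (x : Bool) {m : List Bool} {f : Option Bool → Prog Sym} {n : ℕ} {S}
    (h : Runs (f (some x)) (work m) n S) : Runs (switch .main f) (work (x :: m)) (1 + n) S :=
  Runs.switch (some x) rfl pop_main h

theorem runs_loop_exit (x : Bool) {m : List Bool} {e : Option Bool → Bool}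
    {f : Option Bool → Prog Sym} (he : e (some x) = true) :
    Runs (loop .main e f) (work (x :: m)) 1 (work m) :=
  Runs.loop_exit he pop_main

theorem runs_loop_step (x : Bool) {m : List Bool} {e : Option Bool → Bool}
    {f : Option Bool → Prog Sym} {n n' : ℕ} {S S'} (he : e (some x) = false)
    (h₁ : Runs (f (some x)) (work m) n S) (h₂ : Runs (loop .main e f) S n' S') :
    Runs (loop .main e f) (work (x :: m)) (1 + n + n') S' :=
  Runs.loop_step (some x) rfl he pop_main h₁ h₂

/-- Pushes a sequence of symbols. -/
def pushes : List Bool → Prog Sym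
  | [] => skip
  | x :: l => seq (pushes l) (push .main (x : Bool))

theorem runs_pushes {i r : List Token} (l : List Bool) {m a b c : List Bool} :
    Runs (pushes l) (store i r m a b c) (l.length + 1) (store i r (l ++ m) a b c) := by
  induction l with
  | nil => exact Runs.skip
  | cons x l ih => exact (ih.seq (Runs.push push_main)).mono (by simp)

/-- Removes the top tree. -/
def drop : Prog Sym := seq takeA dropA

/-- Duplicates the top tree. -/
def dup : Prog Sym := seq takeA (seq pourABoth (seq pourBA pourA))

/-- Exchanges the two top trees. -/
def swap : Prog Sym := seq takeA (seq takeB (seq pourA pourB))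

theorem runs_drop (x : Data) (m : List Bool) :
    Runs drop (work (x.code ++ m)) (7 * x.code.length + 3) (work m) := by
  refine ((runs_takeA x m [] []).seq (runs_dropA _)).mono ?_
  simp; omega

theorem runs_dup (x : Data) (m : List Bool) :
    Runs dup (work (x.code ++ m)) (12 * x.code.length + 5) (work (x.code ++ (x.code ++ m))) := by
  have h := (runs_takeA (i := []) (r := []) x m [] []).seq ((runs_pourABoth _).seq
    ((runs_pourBA _).seq (runs_pourA _)))
  simp only [List.append_nil, List.reverse_reverse] at h
  refine h.mono ?_
  simp; omega

theorem runs_swap (x y : Data) (m : List Bool) :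
    Runs swap (work (x.code ++ (y.code ++ m))) (7 * (x.code.length + y.code.length) + 6)
      (work (y.code ++ (x.code ++ m))) := by
  have h := (runs_takeA (i := []) (r := []) x (y.code ++ m) [] []).seq
    ((runs_takeB _ _ _ _).seq ((runs_pourA _).seq (runs_pourB _)))
  simp only [List.append_nil, List.reverse_reverse] at h
  refine h.mono ?_
  simp; omega

/-- Whether two popped symbols agree. -/
def sameSymbol (o o' : Option Bool) : Bool := o == o'

/-- Records on the stack `c` the positions at which the stacks `a` and `b` differ. -/
def compareAB : Prog Sym :=
  seq
    (loop .a isNone fun o => switch .b fun o' =>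
      if sameSymbol o o' then skip else push .c (true : Bool))
    (loop .b isNone fun _ => push .c (true : Bool))

theorem runs_compareAB (a b : List Bool) {i r : List Token} {m c : List Bool} :
    ∃ c' : List Bool, (c' = [] ↔ a = b) ∧ c'.length ≤ a.length + b.length ∧
      Runs compareAB (store i r m a b c) (3 * (a.length + b.length) + 2)
        (store i r m [] [] (c' ++ c)) := by
  have key : ∀ (b : List Bool) {c : List Bool}, Runs (loop .b isNone fun _ => push .c (true : Bool))
      (store i r m [] b c) (2 * b.length + 1)
      (store i r m [] [] (List.replicate b.length true ++ c)) := by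
    intro b
    induction b with
    | nil => exact Runs.loop_exit rfl pop_b
    | cons x b ih =>
      intro c
      rw [List.length_cons, List.replicate_succ', List.append_assoc]
      refine (Runs.loop_step (some x) rfl rfl pop_b (Runs.push push_c) ih).mono ?_
      omega
  suffices ∃ (c' : List Bool) (b' : List Bool), (c' ++ b' = [] ↔ a = b) ∧
      c'.length + b'.length ≤ a.length + b.length ∧
      Runs (loop .a isNone fun o => switch .b fun o' =>
          if sameSymbol o o' then skip else push .c (true : Bool))
        (store i r m a b c) (3 * a.length + 1) (store i r m [] b' (c' ++ c)) ∧
      b'.length ≤ b.length by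
    obtain ⟨c', b', h₁, h₂, h₃, h₄⟩ := this
    refine ⟨List.replicate b'.length true ++ c', ?_, ?_, ?_⟩
    · rw [← h₁]
      simp [and_comm]
    · simp; omega
    · rw [List.append_assoc]
      exact (h₃.seq (key b')).mono (by omega)
  clear key
  induction a generalizing b c with
  | nil =>
    exact ⟨[], b, by simp [eq_comm], by simp, Runs.loop_exit rfl pop_a, le_rfl⟩
  | cons x a ih =>
    by_cases hx : some x = b.head?
    · obtain ⟨c', b', h₁, h₂, h₃, h₄⟩ := ih b.tail (c := c)
      obtain ⟨y, b, rfl⟩ : ∃ y b₁, b = y :: b₁ := by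
        cases b with
        | nil => simp at hx
        | cons y b => exact ⟨y, b, rfl⟩
      simp only [List.head?_cons, Option.some.injEq] at hx
      subst hx
      refine ⟨c', b', by simpa using h₁, by simp at h₂ ⊢; omega, ?_, by simp at h₄ ⊢; omega⟩
      refine (Runs.loop_step (some x) rfl rfl pop_a (Runs.switch (some x) rfl pop_b
        (n := 1) ?_) h₃).mono ?_
      · exact if_pos (show sameSymbol (some x) (some x) = true by simp [sameSymbol]) ▸ Runs.skip
      · simp; omega
    · obtain ⟨c', b', h₁, h₂, h₃, h₄⟩ := ih b.tail (c := true :: c)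
      refine ⟨c' ++ [true], b', ?_, ?_, ?_, ?_⟩
      · simp only [List.append_eq_nil_iff, List.cons_ne_self, and_false, false_and, false_iff]
        rintro rfl
        simp at hx
      · simp at h₂ ⊢; omega
      · rw [List.append_assoc]
        refine (Runs.loop_step (some x) rfl rfl pop_a (Runs.switch b.head? rfl pop_b
          (n := 1) ?_) h₃).mono ?_
        · have : ¬ sameSymbol (some x) b.head? = true := by simpa [sameSymbol] using hx
          exact if_neg this ▸ Runs.push push_c
        · simp; omega
      · simp at h₄; omega

/-- Writes whether the stack `c` is empty as a tree, and empties this stack. -/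
def answer : Prog Sym :=
  switch .c fun o =>
    match (o : Option Bool) with
    | none =>
      seq (push .main (false : Bool)) (seq (push .main (false : Bool)) (push .main (true : Bool)))
    | some _ => seq (push .main (false : Bool)) dropC

/-- Replaces the two top trees by the truth value of their equality. -/
def eqTest : Prog Sym := seq takeA (seq takeB (seq compareAB answer))

theorem runs_eqTest (x y : Data) (m : List Bool) [Decidable (x = y)] :
    Runs eqTest (work (x.code ++ (y.code ++ m))) (10 * (x.code.length + y.code.length) + 20)
      (work ((if x = y then [true, false, false] else [false]) ++ m)) := by
  obtain ⟨c', h₁, h₂, h₃⟩ := runs_compareAB (x.code.reverse ++ []) (y.code.reverse ++ [])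
    (i := []) (r := []) (m := m) (c := [])
  rw [List.append_nil c'] at h₃
  have last : Runs answer (store [] [] m [] [] c') (2 * c'.length + 4)
      (work ((if x = y then [true, false, false] else [false]) ++ m)) := by
    cases c' with
    | nil =>
      rw [if_pos (Data.code_injective (by simpa using h₁))]
      exact (Runs.switch none rfl pop_c ((Runs.push push_main).seq ((Runs.push push_main).seq
        (Runs.push push_main)))).mono le_rfl
    | cons u c' =>
      have hxy : x ≠ y := by
        rintro rfl
        simp at h₁
      rw [if_neg hxy]
      refine (Runs.switch (some u) rfl pop_c ((Runs.push push_main).seq (runs_dropC _))).mono ?_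
      simp; omega
  refine ((runs_takeA (i := []) (r := []) x (y.code ++ m) [] []).seq
    ((runs_takeB _ _ _ _).seq (h₃.seq last))).mono ?_
  simp at h₂ ⊢; omega

/-! ### Functions computable in polynomial time -/

/-- A way to represent the elements of `α` as trees. -/
class TreeRep (α : Type) where
  rep : α → Data

open TreeRep (rep)

/-- The size of the code of `a`. -/
def sz {α : Type} [TreeRep α] (a : α) : ℕ := (rep a).code.length

section Instances

variable {α β : Type} [TreeRep α] [TreeRep β]

instance : TreeRep Data := ⟨id⟩
instance : TreeRep Unit := ⟨fun _ => .nil⟩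
instance : TreeRep Bool := ⟨fun b => if b then .cons .nil .nil else .nil⟩
instance : TreeRep (α × β) := ⟨fun p => .cons (rep p.1) (rep p.2)⟩
instance : TreeRep (Option α) := ⟨fun o => o.elim .nil fun a => .cons .nil (rep a)⟩

/-- Lists are nested pairs. -/
def listRep : List α → Data
  | [] => .nil
  | a :: l => .cons (rep a) (listRep l)

instance : TreeRep (List α) := ⟨listRep⟩

theorem rep_pair (a : α) (b : β) : rep (a, b) = .cons (rep a) (rep b) := rfl
theorem rep_cons (a : α) (l : List α) : rep (a :: l) = .cons (rep a) (rep l) := rfl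
theorem rep_some (a : α) : rep (some a) = .cons .nil (rep a) := rfl
theorem rep_true : rep true = .cons .nil .nil := rfl

theorem rep_false : rep false = .nil := rfl

theorem sz_eq (a : α) : (rep a).code.length = sz a := rfl

@[simp] theorem sz_pair (a : α) (b : β) : sz (a, b) = sz a + sz b + 1 := by
  simp [sz, rep_pair, Data.code]
@[simp] theorem sz_nil : sz ([] : List α) = 1 := rfl
@[simp] theorem sz_cons (a : α) (l : List α) : sz (a :: l) = sz a + sz l + 1 := by
  simp [sz, rep_cons, Data.code]
@[simp] theorem sz_none : sz (none : Option α) = 1 := rfl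
@[simp] theorem sz_some (a : α) : sz (some a) = sz a + 2 := by
  simp [sz, rep_some, Data.code]
@[simp] theorem sz_true : sz true = 3 := rfl
@[simp] theorem sz_false : sz false = 1 := rfl
@[simp] theorem sz_unit (u : Unit) : sz u = 1 := rfl

theorem sz_bool_le (b : Bool) : sz b ≤ 3 := by cases b <;> simp

theorem sz_pos (a : α) : 1 ≤ sz a := by
  unfold sz
  cases rep a <;> simp [Data.code]

theorem length_lt_sz (l : List α) : l.length < sz l := by
  induction l with
  | nil => simp
  | cons a l ih => simp; omega

theorem sz_append (l l' : List α) : sz (l ++ l') + 1 = sz l + sz l' := by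
  induction l with
  | nil => simp [add_comm]
  | cons a l ih => simp; omega

theorem sz_le_of_mem {a : α} {l : List α} (h : a ∈ l) : sz a < sz l := by
  induction h with
  | head => simp +arith
  | tail _ _ ih => simp; omega

end Instances

theorem eval_mono (q : Polynomial ℕ) {m n : ℕ} (h : m ≤ n) : q.eval m ≤ q.eval n := by
  induction q using Polynomial.induction_on' with
  | add p q hp hq => simpa using Nat.add_le_add hp hq
  | monomial k a => simpa using Nat.mul_le_mul_left a (Nat.pow_le_pow_left h k)

/-- The function `f` is computed in polynomial time by a program that replaces the representation
of `a` on the main stack by that of `f a`. What lies below stays untouched, which allows to compose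
programs. -/
def PolyTime {α β : Type} [TreeRep α] [TreeRep β] (f : α → β) : Prop :=
  ∃ (p : Prog Sym) (q : Polynomial ℕ), ∀ a m,
    Runs p (work ((rep a).code ++ m)) (q.eval (sz a)) (work ((rep (f a)).code ++ m))

namespace PolyTime

variable {α β γ δ : Type} [TreeRep α] [TreeRep β] [TreeRep γ] [TreeRep δ]

theorem of_rep_eq {β' : Type} [TreeRep β'] {f : α → β} {g : α → β'} (hf : PolyTime f)
    (h : ∀ a, rep (g a) = rep (f a)) : PolyTime g := by
  obtain ⟨p, q, hp⟩ := hf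
  exact ⟨p, q, fun a m => by rw [h]; exact hp a m⟩

theorem of_eq {f g : α → β} (hf : PolyTime f) (h : ∀ a, f a = g a) : PolyTime g :=
  (funext h : f = g) ▸ hf

theorem comap {α' : Type} [TreeRep α'] {f : α → β} (hf : PolyTime f) (e : α' → α)
    (h : ∀ a, rep (e a) = rep a) : PolyTime fun a => f (e a) := by
  obtain ⟨p, q, hp⟩ := hf
  refine ⟨p, q, fun a m => ?_⟩
  rw [sz, ← h]
  exact hp (e a) m

theorem sz_le {f : α → β} (hf : PolyTime f) :
    ∃ q : Polynomial ℕ, ∀ a, sz (f a) ≤ q.eval (sz a) := by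
  obtain ⟨p, q, hp⟩ := hf
  refine ⟨Polynomial.X + q, fun a => ?_⟩
  have h := (hp a []).length_le .main
  rw [List.append_nil, List.append_nil] at h
  rw [Polynomial.eval_add, Polynomial.eval_X]
  exact h

theorem id' : PolyTime fun a : α => a :=
  ⟨skip, 1, fun a m => by simpa using Runs.skip⟩

theorem comp {g : β → γ} {f : α → β} (hg : PolyTime g) (hf : PolyTime f) :
    PolyTime fun a => g (f a) := by
  obtain ⟨r, hr⟩ := hf.sz_le
  obtain ⟨p, q, hp⟩ := hf
  obtain ⟨p', q', hp'⟩ := hg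
  refine ⟨seq p p', q + q'.comp r, fun a m => ((hp a m).seq (hp' (f a) m)).mono ?_⟩
  simpa using eval_mono q' (hr a)

theorem pair {f : α → β} {g : α → γ} (hf : PolyTime f) (hg : PolyTime g) :
    PolyTime fun a => (f a, g a) := by
  obtain ⟨r, hr⟩ := hf.sz_le
  obtain ⟨r', hr'⟩ := hg.sz_le
  obtain ⟨p, q, hp⟩ := hf
  obtain ⟨p', q', hp'⟩ := hg
  refine ⟨seq dup (seq p (seq swap (seq p' (seq swap (push .main (true : Bool)))))),
    12 * .X + 5 + q + (7 * (r + .X) + 6) + q' + (7 * (r + r') + 6) + 1, fun a m =>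
    ((runs_dup _ _).seq ((hp a _).seq ((runs_swap _ _ _).seq ((hp' a _).seq ((runs_swap _ _ _).seq
      (Runs.push ?_)))))).mono ?_⟩
  · simp only [rep_pair, Data.code, List.cons_append, List.append_assoc]
    exact push_main
  · have h₁ := hr a
    have h₂ := hr' a
    simp only [sz_eq, Polynomial.eval_add, Polynomial.eval_mul, Polynomial.eval_X,
      Polynomial.eval_ofNat, Polynomial.eval_one]
    omega

theorem fst' : PolyTime fun p : α × β => p.1 := by
  refine ⟨switch .main fun _ => seq swap drop, 1 + (7 * .X + 6 + (7 * .X + 3)), fun a m => ?_⟩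
  have h := runs_switch true (f := fun _ => seq swap drop)
    ((runs_swap (rep a.1) (rep a.2) m).seq (runs_drop (rep a.2) _))
  simp only [rep, Data.code, List.cons_append, List.append_assoc] at h ⊢
  refine h.mono ?_
  have : sz a = sz a.1 + sz a.2 + 1 := sz_pair a.1 a.2
  simp only [sz_eq, Polynomial.eval_add, Polynomial.eval_mul, Polynomial.eval_X,
    Polynomial.eval_ofNat, Polynomial.eval_one]
  omega

theorem snd' : PolyTime fun p : α × β => p.2 := by
  refine ⟨switch .main fun _ => drop, 1 + (7 * .X + 3), fun a m => ?_⟩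
  have h := runs_switch true (f := fun _ => drop) (runs_drop (rep a.1) ((rep a.2).code ++ m))
  simp only [rep, Data.code, List.cons_append, List.append_assoc] at h ⊢
  refine h.mono ?_
  have : sz a = sz a.1 + sz a.2 + 1 := sz_pair a.1 a.2
  simp only [sz_eq, Polynomial.eval_add, Polynomial.eval_mul, Polynomial.eval_X,
    Polynomial.eval_ofNat, Polynomial.eval_one]
  omega

theorem fst {f : α → β × γ} (hf : PolyTime f) : PolyTime fun a => (f a).1 := fst'.comp hf

theorem snd {f : α → β × γ} (hf : PolyTime f) : PolyTime fun a => (f a).2 := snd'.comp hf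

theorem const (b : β) : PolyTime fun _ : α => b := by
  refine ⟨seq drop (pushes (rep b).code), 7 * .X + 3 + ((rep b).code.length + 1 : ℕ),
    fun a m => ((runs_drop _ _).seq (runs_pushes _)).mono ?_⟩
  simp only [sz_eq, Polynomial.eval_add, Polynomial.eval_mul, Polynomial.eval_X,
    Polynomial.eval_ofNat, Polynomial.eval_natCast]
  simp

/-- Equality of two trees can be decided in polynomial time. -/
theorem beq_rep {f : α → β} {g : α → γ} (hf : PolyTime f) (hg : PolyTime g) (h : α → Bool)
    (hh : ∀ a, h a = true ↔ rep (f a) = rep (g a)) : PolyTime h := by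
  classical
  suffices PolyTime fun p : β × γ => decide (rep p.1 = rep p.2) by
    refine (this.comp (hf.pair hg)).of_eq fun a => ?_
    rw [Bool.eq_iff_iff, hh, decide_eq_true_iff]
  refine ⟨switch .main fun _ => eqTest, 1 + (10 * .X + 20), fun a m => ?_⟩
  have h := runs_switch true (f := fun _ => eqTest) (runs_eqTest (rep a.1) (rep a.2) m)
  have ha : (rep a).code ++ m = true :: ((rep a.1).code ++ ((rep a.2).code ++ m)) := by
    simp [rep, Data.code]
  have hb : (rep (decide (rep a.1 = rep a.2))).code =
      if rep a.1 = rep a.2 then [true, false, false] else [false] := by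
    split_ifs with hab <;> simp [hab, rep_true, rep_false, Data.code]
  rw [ha, hb]
  refine h.mono ?_
  have : sz a = sz a.1 + sz a.2 + 1 := sz_pair a.1 a.2
  simp only [sz_eq, Polynomial.eval_add, Polynomial.eval_mul, Polynomial.eval_X,
    Polynomial.eval_ofNat, Polynomial.eval_one]
  omega

theorem cond {c : α → Bool} {f g : α → β} (hc : PolyTime c) (hf : PolyTime f) (hg : PolyTime g) :
    PolyTime fun a => bif c a then f a else g a := by
  obtain ⟨p, q, hp⟩ := hf
  obtain ⟨p', q', hp'⟩ := hg
  suffices PolyTime fun x : Bool × α => bif x.1 then f x.2 else g x.2 from this.comp (hc.pair id')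
  let branch : Option Bool → Prog Sym := fun o =>
    if o = some true then seq drop (seq drop p) else p'
  refine ⟨switch .main fun _ => switch .main branch, 30 + q + q', fun ⟨b, a⟩ m => ?_⟩
  have hq := eval_mono q (show sz a ≤ sz (b, a) by simp; omega)
  have hq' := eval_mono q' (show sz a ≤ sz (b, a) by simp; omega)
  cases b with
  | true =>
    refine (runs_switch true (f := fun _ => switch .main branch) (runs_switch true (f := branch)
      ((runs_drop .nil _).seq ((runs_drop .nil _).seq (hp a m))))).mono ?_
    simp [Data.code] at hq ⊢; omega
  | false =>
    refine (runs_switch true (f := fun _ => switch .main branch) (runs_switch false (f := branch)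
      (hp' a m))).mono ?_
    simp at hq' ⊢; omega

theorem ite {c : α → Prop} [DecidablePred c] {f g : α → β} (hc : PolyTime fun a => decide (c a))
    (hf : PolyTime f) (hg : PolyTime g) : PolyTime fun a => if c a then f a else g a :=
  (hc.cond hf hg).of_eq fun a => by by_cases h : c a <;> simp [h]

/-- Case distinction on a list. -/
def _root_.LimitedBelief.listElim {β γ : Type} (l : List β) (g : γ) (h : β → List β → γ) : γ :=
  match l with
  | [] => g
  | b :: l => h b l

theorem list_casesOn {l : α → List β} {g : α → γ} {h : α → β → List β → γ} (hl : PolyTime l)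
    (hg : PolyTime g) (hh : PolyTime fun x : α × β × List β => h x.1 x.2.1 x.2.2) :
    PolyTime fun a => listElim (l a) (g a) (h a) := by
  obtain ⟨p, q, hp⟩ := hg
  obtain ⟨p', q', hp'⟩ := hh
  suffices PolyTime fun x : List β × α => listElim x.1 (g x.2) (h x.2) from this.comp (hl.pair id')
  let branch : Option Bool → Prog Sym := fun o => if o = some true
    then seq (push .main (true : Bool)) (seq swap (seq (push .main (true : Bool)) p')) else p
  refine ⟨switch .main fun _ => switch .main branch, 10 + 7 * .X + q + q', fun ⟨l, a⟩ m => ?_⟩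
  cases l with
  | nil =>
    refine (runs_switch true (f := fun _ => switch .main branch) (runs_switch false (f := branch)
      (hp a m))).mono ?_
    have hq := eval_mono q (show sz a ≤ sz (([] : List β), a) by simp; omega)
    simp at hq ⊢; omega
  | cons b l =>
    have hm : (rep ((b :: l : List β), a)).code ++ m =
        true :: true :: ((rep b).code ++ ((rep l).code ++ ((rep a).code ++ m))) := by
      simp [rep_pair, rep_cons, Data.code]
    have h₂ : true :: ((rep b).code ++ ((rep l).code ++ ((rep a).code ++ m))) =
        (rep (b, l)).code ++ ((rep a).code ++ m) := by
      simp [rep_pair, Data.code]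
    have h₃ : true :: ((rep a).code ++ ((rep (b, l)).code ++ m)) = (rep (a, b, l)).code ++ m := by
      rw [rep_pair a]; simp [Data.code]
    have hq := eval_mono q' (show sz (a, b, l) ≤ sz ((b :: l : List β), a) by simp; omega)
    have hpush := runs_push true ((rep b).code ++ ((rep l).code ++ ((rep a).code ++ m)))
    rw [h₂] at hpush
    have hpush' := runs_push true ((rep a).code ++ ((rep (b, l)).code ++ m))
    rw [h₃] at hpush'
    rw [hm]
    refine (runs_switch true (f := fun _ => switch .main branch) (runs_switch true (f := branch)
      (hpush.seq ((runs_swap _ _ _).seq (hpush'.seq (hp' (a, b, l) m)))))).mono ?_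
    simp [sz_eq] at hq ⊢; omega

theorem option_casesOn {o : α → Option β} {g : α → γ} {h : α → β → γ} (ho : PolyTime o)
    (hg : PolyTime g) (hh : PolyTime fun x : α × β => h x.1 x.2) :
    PolyTime fun a => (o a).elim (g a) (h a) := by
  -- an optional `b` is represented like the list `[] :: b`, if `b` is a list
  obtain ⟨p, q, hp⟩ := hg
  obtain ⟨p', q', hp'⟩ := hh
  suffices PolyTime fun x : Option β × α => x.1.elim (g x.2) (h x.2) from this.comp (ho.pair id')
  let branch : Option Bool → Prog Sym := fun o => if o = some true
    then seq drop (seq swap (seq (push .main (true : Bool)) p')) else p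
  refine ⟨switch .main fun _ => switch .main branch, 30 + 7 * .X + q + q', fun ⟨o, a⟩ m => ?_⟩
  cases o with
  | none =>
    refine (runs_switch true (f := fun _ => switch .main branch) (runs_switch false (f := branch)
      (hp a m))).mono ?_
    have hq := eval_mono q (show sz a ≤ sz ((none : Option β), a) by simp; omega)
    simp at hq ⊢; omega
  | some b =>
    have hm : (rep (some b, a)).code ++ m =
        true :: true :: (Data.nil.code ++ ((rep b).code ++ ((rep a).code ++ m))) := by
      simp [rep_pair, rep_some, Data.code]
    have h₃ : true :: ((rep a).code ++ ((rep b).code ++ m)) = (rep (a, b)).code ++ m := by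
      simp [rep_pair, Data.code]
    have hq := eval_mono q' (show sz (a, b) ≤ sz (some b, a) by simp; omega)
    have hpush' := runs_push true ((rep a).code ++ ((rep b).code ++ m))
    rw [h₃] at hpush'
    rw [hm]
    refine (runs_switch true (f := fun _ => switch .main branch) (runs_switch true (f := branch)
      ((runs_drop .nil _).seq ((runs_swap _ _ _).seq (hpush'.seq (hp' (a, b) m)))))).mono ?_
    simp [sz_eq, Data.code] at hq ⊢; omega

theorem option_some {f : α → β} (hf : PolyTime f) : PolyTime fun a => some (f a) :=
  ((const (α := α) Data.nil).pair hf).of_rep_eq fun _ => rfl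

theorem cons {f : α → β} {g : α → List β} (hf : PolyTime f) (hg : PolyTime g) :
    PolyTime fun a => f a :: g a :=
  (hf.pair hg).of_rep_eq fun _ => rfl

theorem bool_and {f g : α → Bool} (hf : PolyTime f) (hg : PolyTime g) :
    PolyTime fun a => f a && g a :=
  (hf.cond hg (const false)).of_eq fun a => by cases f a <;> rfl

theorem bool_or {f g : α → Bool} (hf : PolyTime f) (hg : PolyTime g) :
    PolyTime fun a => f a || g a :=
  (hf.cond (const true) hg).of_eq fun a => by cases f a <;> rfl

theorem bool_not {f : α → Bool} (hf : PolyTime f) : PolyTime fun a => !f a :=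
  (hf.cond (const false) (const true)).of_eq fun a => by cases f a <;> rfl

theorem isEmpty {f : α → List β} (hf : PolyTime f) : PolyTime fun a => (f a).isEmpty :=
  (hf.list_casesOn (const true) (const false)).of_eq fun a => by cases f a <;> rfl

end PolyTime

/-! ### Loops in polynomial time -/

/-- Repeats the program `p` on a pair until the first component is the empty list, and returns the
second component. -/
def repeatProg (p : Prog Sym) : Prog Sym :=
  loop .main (fun o => match (o : Option Bool) with | some true => false | _ => true) fun _ =>
    seq (push .main (true : Bool)) (seq (push .main (true : Bool))
      (seq p (switch .main fun _ => skip)))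

theorem runs_repeatProg {β γ : Type} [TreeRep β] [TreeRep γ]
    {G : List β × γ → List β × γ} {p : Prog Sym} {q : Polynomial ℕ}
    (hp : ∀ z m, Runs p (work ((rep z).code ++ m)) (q.eval (sz z)) (work ((rep (G z)).code ++ m)))
    (B : ℕ) (m : List Bool) (n : ℕ) : ∀ z : List β × γ, (∀ i < n, (G^[i] z).1 ≠ []) →
    (G^[n] z).1 = [] → (∀ i < n, sz (G^[i] z) ≤ B) →
    Runs (repeatProg p) (work ((rep z.1).code ++ ((rep z.2).code ++ m))) (n * (q.eval B + 5) + 1)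
      (work ((rep (G^[n] z).2).code ++ m)) := by
  induction n with
  | zero =>
    rintro ⟨l, s⟩ - h -
    obtain rfl : l = [] := h
    exact (runs_loop_exit false rfl).mono (by omega)
  | succ n ih =>
    rintro ⟨l, s⟩ h₁ h₂ h₃
    have hl : l ≠ [] := h₁ 0 (by omega)
    obtain ⟨b, l, rfl⟩ := List.exists_cons_of_ne_nil hl
    have hB := eval_mono q (h₃ 0 (by omega))
    rw [Function.iterate_succ_apply] at h₂ ⊢
    have ih' := ih (G (b :: l, s)) (fun i hi => h₁ (i + 1) (by omega)) h₂
      (fun i hi => h₃ (i + 1) (by omega))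
    have hcode : ∀ x : List β × γ, (rep x).code ++ m =
        true :: ((rep x.1).code ++ ((rep x.2).code ++ m)) := by
      rintro ⟨x, y⟩
      simp [rep_pair, Data.code]
    have hstart := hp (b :: l, s) m
    rw [hcode, hcode (G _), rep_cons, Data.code, List.cons_append] at hstart
    refine (runs_loop_step true rfl ((runs_push true _).seq ((runs_push true _).seq
      (hstart.seq (runs_switch true (f := fun _ => skip) Runs.skip)))) ih').mono ?_
    simp only [Function.iterate_zero, id] at hB
    rw [add_mul]
    omega

namespace PolyTime

variable {α β γ : Type} [TreeRep α] [TreeRep β] [TreeRep γ]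

/-- A function that is computable in polynomial time can be iterated in polynomial time, if the
number of iterations and the sizes of the intermediate results are bounded by a polynomial. -/
theorem iterate {G : List β × γ → List β × γ} (hG : PolyTime G) {init : α → List β × γ}
    (hinit : PolyTime init) (n : α → ℕ) (h₁ : ∀ a, ∀ i < n a, (G^[i] (init a)).1 ≠ [])
    (h₂ : ∀ a, (G^[n a] (init a)).1 = []) (r : Polynomial ℕ) (hn : ∀ a, n a ≤ r.eval (sz a))
    (hr : ∀ a, ∀ i < n a, sz (G^[i] (init a)) ≤ r.eval (sz a)) :
    PolyTime fun a => (G^[n a] (init a)).2 := by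
  obtain ⟨p, q, hp⟩ := hG
  obtain ⟨p', q', hp'⟩ := hinit
  refine ⟨seq p' (seq (switch .main fun _ => skip) (repeatProg p)),
    q' + 2 + (r * (q.comp r + 5) + 1), fun a m => ?_⟩
  have h := runs_repeatProg hp (r.eval (sz a)) m (n a) (init a) (h₁ a) (h₂ a) (hr a)
  have hstart := hp' a m
  have hcode : (rep (init a)).code ++ m =
      true :: ((rep (init a).1).code ++ ((rep (init a).2).code ++ m)) := by
    simp [rep, Data.code]
  rw [hcode] at hstart
  refine (hstart.seq ((runs_switch true (f := fun _ => skip) Runs.skip).seq h)).mono ?_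
  have := Nat.mul_le_mul_right (q.eval (r.eval (sz a)) + 5) (hn a)
  simp only [Polynomial.eval_add, Polynomial.eval_mul, Polynomial.eval_ofNat, Polynomial.eval_comp,
    Polynomial.eval_one]
  omega

theorem foldl {L : α → List β} {I : α → γ} {F : α → γ → β → γ} (hL : PolyTime L) (hI : PolyTime I)
    (hF : PolyTime fun x : α × γ × β => F x.1 x.2.1 x.2.2) (r : Polynomial ℕ)
    (hr : ∀ a, ∀ i ≤ (L a).length, sz (((L a).take i).foldl (F a) (I a)) ≤ r.eval (sz a)) :
    PolyTime fun a => (L a).foldl (F a) (I a) := by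
  let G : List β × α × γ → List β × α × γ := fun x =>
    listElim x.1 x fun b l => (l, x.2.1, F x.2.1 x.2.2 b)
  have hG : PolyTime G := by
    refine list_casesOn fst' id' (pair (snd snd') (pair (fst (snd fst')) ?_))
    exact hF.comp (pair (fst (snd fst')) (pair (snd (snd fst')) (fst snd')))
  have hiter : ∀ (i : ℕ) (l : List β) (a : α) (s : γ), i ≤ l.length →
      G^[i] (l, a, s) = (l.drop i, a, (l.take i).foldl (F a) s) := by
    intro i
    induction i with
    | zero => simp
    | succ i ih =>
      intro l a s hi
      cases l with
      | nil => simp at hi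
      | cons b l =>
        rw [Function.iterate_succ_apply]
        exact ih l a _ (by simpa using hi)
  obtain ⟨rL, hrL⟩ := hL.sz_le
  have key := iterate hG (hL.pair (pair id' hI)) (fun a => (L a).length)
    (fun a i hi => by
      rw [hiter i _ _ _ hi.le]
      simpa using hi)
    (fun a => by rw [hiter _ _ _ _ le_rfl]; simp) (rL + .X + r + 2)
    (fun a => by
      have := length_lt_sz (L a)
      have := hrL a
      simp; omega)
    (fun a i hi => by
      rw [hiter i _ _ _ hi.le]
      have h₁ := hrL a
      have h₂ := hr a i hi.le
      have h₃ : sz ((L a).drop i) ≤ sz (L a) := by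
        have := sz_append ((L a).take i) ((L a).drop i)
        rw [List.take_append_drop] at this
        have := sz_pos ((L a).take i)
        omega
      simp; omega)
  refine (snd key).of_eq fun a => ?_
  rw [hiter _ _ _ _ le_rfl]
  simp

/-- A fold can be computed in polynomial time if each step adds at most polynomially many symbols,
where the polynomial does not depend on the accumulated value. -/
theorem foldl_of_growth {L : α → List β} {I : α → γ} {F : α → γ → β → γ} (hL : PolyTime L)
    (hI : PolyTime I) (hF : PolyTime fun x : α × γ × β => F x.1 x.2.1 x.2.2) (r : Polynomial ℕ)
    (hr : ∀ a, ∀ b ∈ L a, ∀ s, sz (F a s b) ≤ sz s + r.eval (sz a)) :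
    PolyTime fun a => (L a).foldl (F a) (I a) := by
  obtain ⟨rL, hrL⟩ := hL.sz_le
  obtain ⟨rI, hrI⟩ := hI.sz_le
  refine foldl hL hI hF (rI + rL * r) fun a i hi => ?_
  have key : ∀ (l : List β) (s : γ), (∀ b ∈ l, b ∈ L a) →
      sz (l.foldl (F a) s) ≤ sz s + l.length * r.eval (sz a) := by
    intro l
    induction l with
    | nil => simp
    | cons b l ih =>
      intro s hl
      have h₁ := ih (F a s b) fun b hb => hl b (by simp [hb])
      have h₂ := hr a b (hl b (by simp)) s
      simp only [List.foldl_cons, List.length_cons, add_mul]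
      omega
  have h₁ := key ((L a).take i) (I a) fun b hb => List.mem_of_mem_take hb
  have h₂ := length_lt_sz (L a)
  have h₃ := hrL a
  have h₄ := hrI a
  have h₅ : ((L a).take i).length * r.eval (sz a) ≤ rL.eval (sz a) * r.eval (sz a) :=
    Nat.mul_le_mul_right _ (by simp; omega)
  simp only [Polynomial.eval_add, Polynomial.eval_mul]
  omega

end PolyTime

/-! ### Representations of the syntax -/

/-- The representation of `α` is faithful, so that equality can be decided on it. -/
class FaithfulRep (α : Type) [TreeRep α] : Prop where
  rep_injective : Function.Injective (rep : α → Data)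

open FaithfulRep (rep_injective)

section

variable {α β : Type} [TreeRep α] [TreeRep β] [FaithfulRep α] [FaithfulRep β]

instance : FaithfulRep Unit := ⟨fun _ _ _ => rfl⟩

instance : FaithfulRep Bool := ⟨fun a b h => by cases a <;> cases b <;> first | rfl | cases h⟩

instance : FaithfulRep (α × β) := ⟨fun ⟨a, b⟩ ⟨a', b'⟩ h => by
  rw [rep_pair, rep_pair, Data.cons.injEq] at h
  rw [rep_injective h.1, rep_injective h.2]⟩

instance : FaithfulRep (List α) := ⟨fun l => by
  induction l with
  | nil =>
    rintro (_ | ⟨b, l'⟩) h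
    · rfl
    · cases h
  | cons a l ih =>
    rintro (_ | ⟨b, l'⟩) h
    · cases h
    · rw [rep_cons, rep_cons, Data.cons.injEq] at h
      rw [rep_injective h.1, ih h.2]⟩

end

/-- A number for each token. -/
def Token.index : Token → ℕ
  | .eq => 0
  | .neg => 1
  | .or => 2
  | .bel => 3
  | .zero => 4
  | .one => 5
  | .arg => 6
  | .close => 7

instance : TreeRep Token := ⟨fun t => rep (List.replicate t.index ())⟩

instance : FaithfulRep Token := ⟨fun s t h => by
  have := congrArg List.length (rep_injective (α := List Unit) h)
  revert this
  cases s <;> cases t <;> simp [Token.index]⟩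

/-- The representation of a name is that of its encoding. -/
instance : TreeRep ℕ := ⟨fun n => rep (encodeNat n)⟩

/-- The representation of a function term is that of its encoding. -/
instance : TreeRep FTerm := ⟨fun t => rep (encodeFTerm t)⟩

/-- A literal is represented by its sign, its function term, and its name. -/
instance : TreeRep Literal := ⟨fun l =>
  match l with
  | .eq t n => rep (true, t, n)
  | .ne t n => rep (false, t, n)⟩

theorem bits_append_close_inj : ∀ {l l' : List Bool} {r r' : List Token},
    l.map (fun b => if b then Token.one else Token.zero) ++ .close :: r =
      l'.map (fun b => if b then Token.one else Token.zero) ++ .close :: r' → l = l' ∧ r = r'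
  | [], [], _, _, h => by simpa using h
  | [], b :: _, _, _, h => by cases b <;> simp at h
  | b :: _, [], _, _, h => by cases b <;> simp at h
  | b :: l, b' :: l', r, r', h => by
    simp only [List.map_cons, List.cons_append, List.cons.injEq] at h
    obtain ⟨rfl, rfl⟩ := bits_append_close_inj h.2
    refine ⟨?_, rfl⟩
    have := h.1
    cases b <;> cases b' <;> simp_all

theorem encodeNat_append_inj {n n' : ℕ} {r r' : List Token}
    (h : encodeNat n ++ r = encodeNat n' ++ r') : n = n' ∧ r = r' := by
  simp only [encodeNat, List.append_assoc, List.singleton_append] at h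
  obtain ⟨hb, hr⟩ := bits_append_close_inj h
  refine ⟨Nat.eq_of_testBit_eq fun i => ?_, hr⟩
  rw [Nat.testBit_eq_inth, Nat.testBit_eq_inth, hb]

theorem encodeArgs_inj : ∀ {l l' : List Name},
    l.flatMap (fun n => Token.arg :: encodeNat n) ++ [Token.close] =
      l'.flatMap (fun n => Token.arg :: encodeNat n) ++ [Token.close] → l = l'
  | [], [], _ => rfl
  | [], _ :: _, h => by simp at h
  | _ :: _, [], h => by simp at h
  | n :: l, n' :: l', h => by
    simp only [List.flatMap_cons, List.cons_append, List.append_assoc, List.cons.injEq,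
      true_and] at h
    obtain ⟨h₁, h₂⟩ := encodeNat_append_inj h
    rw [h₁, encodeArgs_inj h₂]

theorem encodeFTerm_injective : Function.Injective encodeFTerm := by
  rintro ⟨f, l⟩ ⟨f', l'⟩ h
  simp only [encodeFTerm, List.append_assoc] at h
  obtain ⟨h₁, h₂⟩ := encodeNat_append_inj h
  rw [h₁, encodeArgs_inj h₂]

instance : FaithfulRep ℕ := ⟨fun n n' h =>
  (encodeNat_append_inj (r := []) (r' := []) (by rw [rep_injective (α := List Token) h])).1⟩

instance : FaithfulRep FTerm := ⟨fun _ _ h =>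
  encodeFTerm_injective (rep_injective (α := List Token) h)⟩

instance : FaithfulRep Literal := ⟨fun l l' h => by
  cases l <;> cases l' <;>
    simpa using rep_injective (α := Bool × FTerm × ℕ) h⟩

/-! ### Operations on lists in polynomial time -/

namespace PolyTime

variable {α β γ τ : Type} [TreeRep α] [TreeRep β] [TreeRep γ] [TreeRep τ]

theorem decide_eq [FaithfulRep β] [DecidableEq β] {f g : α → β} (hf : PolyTime f)
    (hg : PolyTime g) : PolyTime fun a => decide (f a = g a) :=
  beq_rep hf hg _ fun a => by rw [decide_eq_true_iff, rep_injective.eq_iff]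

theorem finite_casesOn [FaithfulRep τ] [Fintype τ] {F : τ → α → γ} (hF : ∀ t, PolyTime (F t))
    {f : α → τ} (hf : PolyTime f) : PolyTime fun a => F (f a) a := by
  classical
  by_cases hτ : IsEmpty τ
  · have : IsEmpty α := ⟨fun a => hτ.elim (f a)⟩
    exact ⟨skip, 0, fun a => this.elim a⟩
  obtain ⟨t₀⟩ := not_isEmpty_iff.mp hτ
  suffices ∀ l : List τ, PolyTime fun a => if f a ∈ l then F (f a) a else F t₀ a from
    (this Finset.univ.toList).of_eq fun a => by simp
  intro l
  induction l with
  | nil => exact (hF t₀).of_eq fun a => by simp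
  | cons t l ih =>
    refine (ite (decide_eq hf (const t)) (hF t) ih).of_eq fun a => ?_
    by_cases h : f a = t
    · simp [h]
    · simp [h]

theorem foldl_bool {L : α → List β} {I : α → Bool} {F : α → Bool → β → Bool} (hL : PolyTime L)
    (hI : PolyTime I) (hF : PolyTime fun x : α × Bool × β => F x.1 x.2.1 x.2.2) :
    PolyTime fun a => (L a).foldl (F a) (I a) :=
  foldl hL hI hF 3 fun a i _ => by simpa using sz_bool_le _

theorem any {L : α → List β} {f : α → β → Bool} (hL : PolyTime L)
    (hf : PolyTime fun x : α × β => f x.1 x.2) : PolyTime fun a => (L a).any (f a) := by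
  refine (foldl_bool hL (const false) (F := fun a s b => s || f a b)
    (bool_or (fst snd') (hf.comp (pair fst' (snd snd'))))).of_eq fun a => ?_
  suffices ∀ (l : List β) (s : Bool), l.foldl (fun s b => s || f a b) s = (s || l.any (f a)) by
    simpa using this (L a) false
  intro l
  induction l with
  | nil => simp
  | cons b l ih => intro s; simp [ih, Bool.or_assoc]

theorem all {L : α → List β} {f : α → β → Bool} (hL : PolyTime L)
    (hf : PolyTime fun x : α × β => f x.1 x.2) : PolyTime fun a => (L a).all (f a) :=
  (bool_not (any hL (f := fun a b => !f a b) (bool_not hf))).of_eq fun a => by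
    simp [List.not_all_eq_any_not]

theorem mem [FaithfulRep β] [DecidableEq β] {f : α → β} {L : α → List β} (hf : PolyTime f)
    (hL : PolyTime L) : PolyTime fun a => decide (f a ∈ L a) :=
  (any hL (f := fun a b => decide (f a = b)) (decide_eq (hf.comp fst') snd')).of_eq fun a => by
    rw [Bool.eq_iff_iff]
    simp

theorem reverse {L : α → List β} (hL : PolyTime L) : PolyTime fun a => (L a).reverse := by
  refine (foldl_of_growth hL (const []) (F := fun _ s b => b :: s)
    (cons (snd snd') (fst snd')) (hL.sz_le.choose + 1) ?_).of_eq fun a => ?_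
  · intro a b hb s
    have := hL.sz_le.choose_spec a
    have := sz_le_of_mem hb
    simp; omega
  · simp

theorem foldr_of_growth {L : α → List β} {I : α → γ} {F : α → β → γ → γ} (hL : PolyTime L)
    (hI : PolyTime I) (hF : PolyTime fun x : α × β × γ => F x.1 x.2.1 x.2.2) (r : Polynomial ℕ)
    (hr : ∀ a, ∀ b ∈ L a, ∀ s, sz (F a b s) ≤ sz s + r.eval (sz a)) :
    PolyTime fun a => (L a).foldr (F a) (I a) :=
  (foldl_of_growth (reverse hL) hI (F := fun a s b => F a b s)
    (hF.comp (pair fst' (pair (snd snd') (fst snd')))) r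
    fun a b hb s => hr a b (by simpa using hb) s).of_eq fun a => by simp

theorem map {L : α → List β} {f : α → β → γ} (hL : PolyTime L)
    (hf : PolyTime fun x : α × β => f x.1 x.2) : PolyTime fun a => (L a).map (f a) := by
  obtain ⟨q, hq⟩ := hL.sz_le
  obtain ⟨q', hq'⟩ := hf.sz_le
  refine (foldr_of_growth hL (const []) (F := fun a b s => f a b :: s)
    (cons (hf.comp (pair fst' (fst snd'))) (snd snd')) (q'.comp (.X + q + 1) + 1) ?_).of_eq
    fun a => ?_
  · intro a b hb s
    have h₁ := hq a
    have h₂ := sz_le_of_mem hb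
    have h₃ := (hq' (a, b)).trans (eval_mono q' (n := sz a + q.eval (sz a) + 1) (by simp; omega))
    simp at h₃ ⊢; omega
  · induction L a with
    | nil => rfl
    | cons b l ih => simp [ih]

theorem append {L L' : α → List β} (hL : PolyTime L) (hL' : PolyTime L') :
    PolyTime fun a => L a ++ L' a := by
  obtain ⟨q, hq⟩ := hL.sz_le
  refine (foldr_of_growth hL hL' (F := fun _ b s => b :: s) (cons (fst snd') (snd snd'))
    (q + 1) ?_).of_eq fun a => ?_
  · intro a b hb s
    have h₁ := hq a
    have h₂ := sz_le_of_mem hb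
    simp; omega
  · simp

theorem filter {L : α → List β} {f : α → β → Bool} (hL : PolyTime L)
    (hf : PolyTime fun x : α × β => f x.1 x.2) : PolyTime fun a => (L a).filter (f a) := by
  obtain ⟨q, hq⟩ := hL.sz_le
  refine (foldr_of_growth hL (const []) (F := fun a b s => bif f a b then b :: s else s)
    (cond (hf.comp (pair fst' (fst snd'))) (cons (fst snd') (snd snd')) (snd snd'))
    (q + 1) ?_).of_eq fun a => ?_
  · intro a b hb s
    have h₁ := hq a
    have h₂ := sz_le_of_mem hb
    cases f a b <;> simp; omega
  · induction L a with
    | nil => rfl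
    | cons b l ih => cases h : f a b <;> simp [ih, h]

theorem flatten {L : α → List (List β)} (hL : PolyTime L) : PolyTime fun a => (L a).flatten := by
  obtain ⟨q, hq⟩ := hL.sz_le
  refine (foldr_of_growth hL (const []) (F := fun _ b s => b ++ s) (append (fst snd') (snd snd'))
    q ?_).of_eq fun a => ?_
  · intro a b hb s
    have h₁ := hq a
    have h₂ := sz_le_of_mem hb
    have h₃ := sz_append b s
    omega
  · induction L a with
    | nil => rfl
    | cons b l ih => simp [ih]

end PolyTime

/-! ### Unit propagation and subsumption -/

/-- The function term and the name of a literal. -/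
def Literal.atom : Literal → FTerm × Name
  | .eq t n => (t, n)
  | .ne t n => (t, n)

theorem Literal.term_eq (l : Literal) : l.term = l.atom.1 := by cases l <;> rfl

/-- The function terms and names of the literals of a formula. -/
def Formula.atoms : Formula → List (FTerm × Name)
  | .eq t n => [(t, n)]
  | .neg α => α.atoms
  | .or α β => α.atoms ++ β.atoms
  | .bel _ α => α.atoms

theorem Formula.mem_funcs {α : Formula} {t : FTerm} : t ∈ α.funcs ↔ ∃ p ∈ α.atoms, p.1 = t := by
  induction α with
  | eq t' n => simp [funcs, atoms, eq_comm]
  | neg α ih => exact ih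
  | or α β ih₁ ih₂ => simp only [funcs, Finset.mem_union, ih₁, ih₂, atoms, List.mem_append,
      or_and_right, exists_or]
  | bel k α ih => exact ih

theorem Formula.mem_names {α : Formula} {p : FTerm × Name} (h : p ∈ α.atoms) : p.2 ∈ α.names := by
  induction α with
  | eq t' n => simp_all [names, atoms]
  | neg α ih => exact ih h
  | or α β ih₁ ih₂ =>
    rw [names, Finset.mem_union]
    rw [atoms, List.mem_append] at h
    exact h.imp ih₁ ih₂
  | bel k α ih => exact ih h

theorem Subsumes.trans {c d e : Clause} (h₁ : Subsumes c d) (h₂ : Subsumes d e) : Subsumes c e := by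
  refine ⟨fun t n h => ?_, fun t n h => h₂.2 t n (h₁.2 t n h)⟩
  rcases h₁.1 t n h with h | ⟨n', hn, h⟩
  · exact h₂.1 t n h
  · exact .inr ⟨n', hn, h₂.2 t n' h⟩

theorem subsumes_of_subset {c d : Clause} (h : c ⊆ d) : Subsumes c d :=
  ⟨fun _ _ hc => .inl (h hc), fun _ _ hc => h hc⟩

theorem InUP.of_empty {s : Set Clause} (h : InUP s ∅) (c : Clause) : InUP s c :=
  .subsume h (subsumes_of_subset (Finset.empty_subset c))

theorem InUP.trans {s s' : Set Clause} (hs : s ⊆ UP s') {c : Clause} (h : InUP s c) :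
    InUP s' c := by
  induction h with
  | base h => exact hs h
  | unit _ _ ih₁ ih₂ => exact .unit ih₁ ih₂
  | subsume _ h ih => exact .subsume ih h

theorem UP_mono {s s' : Set Clause} (h : s ⊆ s') : UP s ⊆ UP s' :=
  fun _ hc => InUP.trans (fun _ hd => .base (h hd)) hc

theorem subset_UP (s : Set Clause) : s ⊆ UP s := fun _ h => .base h

/-- The unit clauses `t = n` for the pairs `(t, n)` in `A`. -/
def units (A : Set (FTerm × Name)) : Set Clause :=
  {c | ∃ p ∈ A, c = {Literal.eq p.1 p.2}}

theorem units_insert (p : FTerm × Name) (A : Set (FTerm × Name)) :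
    units (insert p A) = units A ∪ {{Literal.eq p.1 p.2}} := by
  ext c
  simp only [units, Set.mem_insert_iff, Set.mem_ofPred_eq, Set.mem_union, Set.mem_singleton_iff]
  constructor
  · rintro ⟨q, rfl | hq, rfl⟩
    · exact .inr rfl
    · exact .inl ⟨q, hq, rfl⟩
  · rintro (⟨q, hq, rfl⟩ | rfl)
    · exact ⟨q, .inr hq, rfl⟩
    · exact ⟨p, .inl rfl, rfl⟩

/-- The literal is true if the values of function terms are given by `σ`. -/
def Literal.Holds (σ : FTerm → Name) : Literal → Prop
  | .eq t n => σ t = n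
  | .ne t n => σ t ≠ n

theorem Complementary.term_eq {l l' : Literal} (h : Complementary l l') : l.term = l'.term := by
  cases l <;> cases l' <;> first | exact h.1 | exact h.elim

theorem Complementary.not_holds {l l' : Literal} (h : Complementary l l') {σ : FTerm → Name}
    (hl : l.Holds σ) : ¬ l'.Holds σ := by
  cases l <;> cases l' <;>
    simp only [Complementary, Literal.Holds] at h hl ⊢ <;> aesop

/-- Values for function terms that do not occur in `s` have no effect on the clauses without these
function terms: either the part of a derived clause over `F` is derivable without them, or the
clause contains a literal that is true under the values. -/
theorem InUP.restrict {s : Set Clause} {F : Finset FTerm} (hs : ∀ c ∈ s, ∀ l ∈ c, l.term ∈ F)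
    (σ : FTerm → Name) {c : Clause} (h : InUP (s ∪ units {p | p.1 ∉ F ∧ σ p.1 = p.2}) c) :
    InUP s (c.filter fun l => l.term ∈ F) ∨ ∃ l ∈ c, l.term ∉ F ∧ l.Holds σ := by
  induction h with
  | @base c hc =>
    rcases hc with hc | ⟨p, ⟨hp, hσ⟩, rfl⟩
    · left
      rw [Finset.filter_true_of_mem (hs c hc)]
      exact .base hc
    · exact .inr ⟨_, Finset.mem_singleton_self _, hp, hσ⟩
  | @unit c l _ _ ih₁ ih₂ =>
    by_cases hl : l.term ∈ F
    · have hl' : InUP s {l} := by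
        rcases ih₂ with h | ⟨l', hl', h, _⟩
        · rwa [Finset.filter_true_of_mem (by simpa using hl)] at h
        · rw [Finset.mem_singleton] at hl'
          exact absurd hl (hl' ▸ h)
      rcases ih₁ with h | ⟨l', hl', h, h'⟩
      · left
        have := h.unit hl'
        rwa [propagate, Finset.filter_comm] at this
      · refine .inr ⟨l', Finset.mem_filter.mpr ⟨hl', fun hc => h ?_⟩, h, h'⟩
        rwa [hc.term_eq]
    · rcases ih₂ with h | ⟨l', hl', _, hσ⟩
      · rw [Finset.filter_false_of_mem (by simpa using hl)] at h
        exact .inl (h.of_empty _)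
      · rw [Finset.mem_singleton] at hl'
        subst hl'
        rcases ih₁ with h | ⟨l₀, hl₀, h, h'⟩
        · left
          rw [propagate, Finset.filter_comm, Finset.filter_true_of_mem]
          · exact h
          · intro l₀ hl₀ hc
            rw [Finset.mem_filter] at hl₀
            exact hl (hc.term_eq ▸ hl₀.2)
        · exact .inr ⟨l₀, Finset.mem_filter.mpr ⟨hl₀, fun hc => hc.not_holds h' hσ⟩, h, h'⟩
  | @subsume c d _ hcd ih =>
    rcases ih with h | ⟨l, hl, h, hσ⟩
    · refine .inl (h.subsume ⟨fun t n hc => ?_, fun t n hc => ?_⟩)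
      · simp only [Finset.mem_filter] at hc ⊢
        rcases hcd.1 t n hc.1 with h | ⟨n', hn, h⟩
        · exact .inl ⟨h, hc.2⟩
        · exact .inr ⟨n', hn, h, hc.2⟩
      · simp only [Finset.mem_filter] at hc ⊢
        exact ⟨hcd.2 t n hc.1, hc.2⟩
    · right
      cases l with
      | eq t n =>
        rcases hcd.1 t n hl with h' | ⟨n', hn, h'⟩
        · exact ⟨_, h', h, hσ⟩
        · exact ⟨_, h', h, fun h => hn (hσ.symm.trans h)⟩
      | ne t n => exact ⟨_, hcd.2 t n hl, h, hσ⟩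

theorem InUP.of_restrict {s : Set Clause} {F : Finset FTerm} (hs : ∀ c ∈ s, ∀ l ∈ c, l.term ∈ F)
    {σ : FTerm → Name} {c : Clause} (h : InUP (s ∪ units {p | p.1 ∉ F ∧ σ p.1 = p.2}) c)
    (hc : ∀ l ∈ c, l.term ∈ F) : InUP s c := by
  rcases h.restrict hs σ with h | ⟨l, hl, h, _⟩
  · rwa [Finset.filter_true_of_mem hc] at h
  · exact absurd (hc l hl) h

/-- Renames the name of a literal; the arguments of its function term are left alone. -/
def Literal.rename (π : Equiv.Perm Name) : Literal → Literal
  | .eq t n => .eq t (π n)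
  | .ne t n => .ne t (π n)

theorem complementary_rename {π : Equiv.Perm Name} {l l' : Literal} :
    Complementary (l.rename π) (l'.rename π) ↔ Complementary l l' := by
  cases l <;> cases l' <;> simp [Complementary, Literal.rename]

theorem InUP.rename (π : Equiv.Perm Name) {s : Set Clause} {c : Clause} (h : InUP s c) :
    InUP ((fun c => c.image (Literal.rename π)) '' s) (c.image (Literal.rename π)) := by
  induction h with
  | @base c h => exact .base ⟨c, h, rfl⟩
  | @unit c l _ _ ih₁ ih₂ =>
    rw [Finset.image_singleton] at ih₂
    have := ih₁.unit ih₂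
    rw [propagate, Finset.filter_image] at this
    simp only [complementary_rename] at this
    exact this
  | @subsume c d _ h ih =>
    refine ih.subsume ⟨fun t n hc => ?_, fun t n hc => ?_⟩
    · obtain ⟨l, hl, hl'⟩ := Finset.mem_image.mp hc
      cases l with
      | ne => cases hl'
      | eq _ m =>
        cases hl'
        rcases h.1 _ _ hl with h | ⟨n'', hn, h⟩
        · exact .inl (Finset.mem_image_of_mem _ h)
        · exact .inr ⟨π n'', fun h => hn (π.injective h), Finset.mem_image_of_mem _ h⟩
    · obtain ⟨l, hl, hl'⟩ := Finset.mem_image.mp hc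
      cases l with
      | eq => cases hl'
      | ne _ m =>
        cases hl'
        exact Finset.mem_image_of_mem (Literal.rename π) (h.2 _ _ hl)

/-! ### Truth of objective formulas -/

theorem truth_eq {t n s} : Truth (.eq t n) s ↔ InUP s {Literal.eq t n} := by rw [Truth]; rfl

theorem truth_ne {t n s} : Truth (.neg (.eq t n)) s ↔ InUP s {Literal.ne t n} := by rw [Truth]; rfl

theorem truth_or_clause {α β s c} (h : (Formula.or α β).toClause = some c) :
    Truth (.or α β) s ↔ InUP s c := by
  rw [Truth, h]; rfl

theorem truth_or {α β s} (h : (Formula.or α β).toClause = none) :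
    Truth (.or α β) s ↔ Truth α s ∨ Truth β s := by
  rw [Truth, h]

theorem truth_neg_or {α β s} : Truth (.neg (.or α β)) s ↔ Truth (.neg α) s ∧ Truth (.neg β) s := by
  rw [Truth]

theorem truth_neg_neg {α s} : Truth (.neg (.neg α)) s ↔ Truth α s := by rw [Truth]

theorem truth_bel_zero {α s} : Truth (.bel 0 α) s ↔ Truth α s := by rw [Truth]

theorem truth_bel_succ {k α s} : Truth (.bel (k + 1) α) s ↔
    ∃ t : FTerm, ∀ n : Name, Truth (.bel k α) (s ∪ {{Literal.eq t n}}) := by rw [Truth]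

theorem truth_neg_bel {k α s} : Truth (.neg (.bel k α)) s ↔ ¬ Truth (.bel k α) s := by rw [Truth]

theorem Formula.toClause_or {α β : Formula} {c : Clause} (h : (Formula.or α β).toClause = some c) :
    ∃ c₁ c₂, α.toClause = some c₁ ∧ β.toClause = some c₂ ∧ c = c₁ ∪ c₂ := by
  rw [toClause] at h
  split at h
  · rename_i c₁ c₂ h₁ h₂
    exact ⟨c₁, c₂, h₁, h₂, by simpa using h.symm⟩
  · cases h

theorem Formula.atom_mem_of_toClause : ∀ {α : Formula} {c : Clause}, α.toClause = some c →
    ∀ l ∈ c, l.atom ∈ α.atoms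
  | .eq t n, c, h => by
    simp only [toClause, Option.some.injEq] at h
    subst h
    simp [atoms, Literal.atom]
  | .neg (.eq t n), c, h => by
    simp only [toClause, Option.some.injEq] at h
    subst h
    simp [atoms, Literal.atom]
  | .neg (.neg _), _, h => by simp [toClause] at h
  | .neg (.or _ _), _, h => by simp [toClause] at h
  | .neg (.bel _ _), _, h => by simp [toClause] at h
  | .bel _ _, _, h => by simp [toClause] at h
  | .or α β, c, h => by
    obtain ⟨c₁, c₂, h₁, h₂, rfl⟩ := toClause_or h
    intro l hl
    rw [atoms, List.mem_append]
    exact (Finset.mem_union.mp hl).imp (atom_mem_of_toClause h₁ l) (atom_mem_of_toClause h₂ l)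

/-- The truth of an objective formula depends monotonically on the derivable clauses over the atoms
of the formula. -/
theorem truth_transfer {s s' : Set Clause} {α : Formula} (hα : α.IsObjective)
    (h : ∀ c : Clause, (∀ l ∈ c, l.atom ∈ α.atoms) → InUP s c → InUP s' c) :
    (Truth α s → Truth α s') ∧ (Truth (.neg α) s → Truth (.neg α) s') := by
  induction α with
  | eq t n =>
    rw [truth_eq, truth_eq, truth_ne, truth_ne]
    exact ⟨h _ (by simp [Literal.atom, Formula.atoms]), h _ (by simp [Literal.atom, Formula.atoms])⟩
  | neg α ih =>
    rw [truth_neg_neg, truth_neg_neg]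
    exact (ih hα h).symm
  | or α β ih₁ ih₂ =>
    have ih₁ := ih₁ hα.1 fun c hc => h c fun l hl => List.mem_append_left _ (hc l hl)
    have ih₂ := ih₂ hα.2 fun c hc => h c fun l hl => List.mem_append_right _ (hc l hl)
    rw [truth_neg_or, truth_neg_or]
    refine ⟨?_, And.imp ih₁.2 ih₂.2⟩
    cases hc : (Formula.or α β).toClause with
    | none =>
      rw [truth_or hc, truth_or hc]
      exact Or.imp ih₁.1 ih₂.1
    | some c =>
      rw [truth_or_clause hc, truth_or_clause hc]
      exact h c (Formula.atom_mem_of_toClause hc)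
  | bel => exact hα.elim

/-! ### Belief -/

theorem bel_mono {α : Formula} (hα : α.IsObjective) {k : ℕ} : ∀ {s s' : Set Clause}, s ⊆ UP s' →
    Truth (.bel k α) s → Truth (.bel k α) s' := by
  induction k with
  | zero =>
    intro s s' h
    rw [truth_bel_zero, truth_bel_zero]
    exact (truth_transfer hα fun c _ hc => hc.trans h).1
  | succ k ih =>
    intro s s' h
    rw [truth_bel_succ, truth_bel_succ]
    rintro ⟨t, ht⟩
    refine ⟨t, fun n => ih ?_ (ht n)⟩
    exact Set.union_subset (h.trans (UP_mono Set.subset_union_left))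
      (Set.subset_union_right.trans (subset_UP _))

theorem bel_mono_subset {α : Formula} (hα : α.IsObjective) {k : ℕ} {s s' : Set Clause}
    (h : s ⊆ s') : Truth (.bel k α) s → Truth (.bel k α) s' :=
  bel_mono hα (h.trans (subset_UP s'))

theorem bel_succ_of_bel {α : Formula} (hα : α.IsObjective) {k : ℕ} {s : Set Clause} (t : FTerm)
    (h : Truth (.bel k α) s) : ∀ n : Name, Truth (.bel k α) (s ∪ {{Literal.eq t n}}) :=
  fun _ => bel_mono_subset hα Set.subset_union_left h

theorem bel_of_le {α : Formula} (hα : α.IsObjective) {k k' : ℕ} (hk : k ≤ k') {s : Set Clause}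
    (h : Truth (.bel k α) s) : Truth (.bel k' α) s := by
  induction hk with
  | refl => exact h
  | step _ ih => exact truth_bel_succ.mpr ⟨⟨0, []⟩, bel_succ_of_bel hα _ ih⟩

/-- A literal with a function term in `F`, together with clauses over `F`, form clauses
over `F`. -/
theorem term_mem_insert {s : Set Clause} {F : Finset FTerm} (hs : ∀ c ∈ s, ∀ l ∈ c, l.term ∈ F)
    {t : FTerm} (ht : t ∈ F) (n : Name) :
    ∀ c ∈ s ∪ {{Literal.eq t n}}, ∀ l ∈ c, l.term ∈ F := by
  rintro c (hc | rfl) l hl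
  · exact hs c hc l hl
  · rw [Finset.mem_singleton] at hl
    exact hl ▸ ht

theorem atom_mem_funcs {α : Formula} {F : Finset FTerm} (hF : α.funcs ⊆ F) {l : Literal}
    (h : l.atom ∈ α.atoms) : l.term ∈ F :=
  hF (Formula.mem_funcs.mpr ⟨_, h, l.term_eq.symm⟩)

/-- Values for the function terms outside of `F` do not increase belief. -/
theorem bel_of_restrict {α : Formula} (hα : α.IsObjective) {F : Finset FTerm} (hF : α.funcs ⊆ F)
    (σ : FTerm → Name) {k : ℕ} : ∀ {s : Set Clause}, (∀ c ∈ s, ∀ l ∈ c, l.term ∈ F) →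
    Truth (.bel k α) (s ∪ units {p | p.1 ∉ F ∧ σ p.1 = p.2}) → Truth (.bel k α) s := by
  induction k with
  | zero =>
    intro s hs
    rw [truth_bel_zero, truth_bel_zero]
    exact (truth_transfer hα fun c hc h => h.of_restrict hs fun l hl =>
      atom_mem_funcs hF (hc l hl)).1
  | succ k ih =>
    intro s hs
    rw [truth_bel_succ, truth_bel_succ]
    rintro ⟨t, ht⟩
    refine ⟨t, ?_⟩
    by_cases htF : t ∈ F
    · refine fun n => ih (term_mem_insert hs htF n) ?_
      rw [Set.union_right_comm]
      exact ht n
    · refine bel_succ_of_bel hα _ (ih hs ?_)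
      refine bel_mono_subset hα ?_ (ht (σ t))
      refine Set.union_subset subset_rfl (Set.subset_union_of_subset_right ?_ _)
      rw [Set.singleton_subset_iff]
      exact ⟨(t, σ t), ⟨htF, rfl⟩, rfl⟩

/-- It suffices to split on the function terms in `F`. -/
theorem bel_succ_iff_of_mem {α : Formula} (hα : α.IsObjective) {F : Finset FTerm}
    (hF : α.funcs ⊆ F) (hne : F.Nonempty) {s : Set Clause} (hs : ∀ c ∈ s, ∀ l ∈ c, l.term ∈ F)
    {k : ℕ} : Truth (.bel (k + 1) α) s ↔
      ∃ t ∈ F, ∀ n : Name, Truth (.bel k α) (s ∪ {{Literal.eq t n}}) := by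
  rw [truth_bel_succ]
  refine ⟨?_, fun ⟨t, _, h⟩ => ⟨t, h⟩⟩
  rintro ⟨t, ht⟩
  by_cases htF : t ∈ F
  · exact ⟨t, htF, ht⟩
  · obtain ⟨t', ht'⟩ := hne
    refine ⟨t', ht', bel_succ_of_bel hα _ (bel_of_restrict hα hF (fun _ => 0) hs ?_)⟩
    refine bel_mono_subset hα ?_ (ht 0)
    refine Set.union_subset_union_right s ?_
    rw [Set.singleton_subset_iff]
    exact ⟨(t, 0), ⟨htF, rfl⟩, rfl⟩

/-- Splitting yields truth under every choice of values for all function terms. -/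
theorem truth_of_bel {α : Formula} (σ : FTerm → Name) {k : ℕ} :
    ∀ {s : Set Clause}, units {p | σ p.1 = p.2} ⊆ s → Truth (.bel k α) s → Truth α s := by
  induction k with
  | zero => exact fun _ => truth_bel_zero.mp
  | succ k ih =>
    intro s hs h
    obtain ⟨t, ht⟩ := truth_bel_succ.mp h
    have : s ∪ {{Literal.eq t (σ t)}} = s := by
      rw [Set.union_eq_left, Set.singleton_subset_iff]
      exact hs ⟨(t, σ t), rfl, rfl⟩
    exact ih hs (this ▸ ht (σ t))

/-- If `α` is true for all values of the function terms in `G`, it is believed after splitting on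
each element of `G` once. -/
theorem bel_card {α : Formula} {G : Finset FTerm} : ∀ {s : Set Clause},
    (∀ σ : FTerm → Name, Truth α (s ∪ units {p | p.1 ∈ G ∧ σ p.1 = p.2})) →
    Truth (.bel G.card α) s := by
  induction G using Finset.induction_on with
  | empty =>
    intro s h
    have : s ∪ units {p | p.1 ∈ (∅ : Finset FTerm) ∧ (0 : ℕ) = p.2} = s := by
      simp [units]
    exact truth_bel_zero.mpr (this ▸ h fun _ => 0)
  | insert t G ht ih =>
    intro s h
    rw [Finset.card_insert_of_notMem ht]
    refine truth_bel_succ.mpr ⟨t, fun n => ih fun σ => ?_⟩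
    have := h (Function.update σ t n)
    have e : {p : FTerm × Name | p.1 ∈ insert t G ∧ Function.update σ t n p.1 = p.2} =
        insert (t, n) {p | p.1 ∈ G ∧ σ p.1 = p.2} := by
      ext ⟨t', n'⟩
      by_cases htt : t' = t
      · subst htt
        simp [ht, eq_comm]
      · simp [htt]
    rwa [e, units_insert, ← Set.union_assoc, Set.union_right_comm] at this

/-- Under each choice `σ` of values for `F`, completed to all function terms, `α` is true by
`truth_of_bel`; the values outside of `F` are removed by `bel_of_restrict`, and `bel_card` splits
on the elements of `F`. -/
theorem bel_stabilizes {α : Formula} (hα : α.IsObjective) {s : Set Clause} {F : Finset FTerm}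
    (hs : ∀ c ∈ s, ∀ l ∈ c, l.term ∈ F) (hF : α.funcs ⊆ F) {k : ℕ} (hk : F.card ≤ k) :
    Truth (.bel k α) s ↔ Truth (.bel F.card α) s := by
  refine ⟨fun h => bel_card fun σ => ?_, bel_of_le hα hk⟩
  have key : Truth α (s ∪ units {p | p.1 ∈ F ∧ σ p.1 = p.2} ∪
      units {p | p.1 ∉ F ∧ σ p.1 = p.2}) := by
    refine truth_of_bel σ ?_ (bel_mono_subset hα ?_ h)
    · rintro c ⟨p, hp, rfl⟩
      by_cases hpF : p.1 ∈ F
      · exact .inl (.inr ⟨p, ⟨hpF, hp⟩, rfl⟩)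
      · exact .inr ⟨p, ⟨hpF, hp⟩, rfl⟩
    · exact Set.subset_union_left.trans Set.subset_union_left
  refine truth_bel_zero.mp (bel_of_restrict hα hF σ ?_ (truth_bel_zero.mpr key))
  rintro c (hc | ⟨p, hp, rfl⟩) l hl
  · exact hs c hc l hl
  · rw [Finset.mem_singleton] at hl
    exact hl ▸ hp.1

/-- Belief is invariant under permutations of the names that fix those of the formula. The
arguments of function terms are not renamed, so that the splits remain the same. -/
theorem bel_rename (π : Equiv.Perm Name) {α : Formula} (hα : α.IsObjective)
    (hπ : ∀ p ∈ α.atoms, π p.2 = p.2) {k : ℕ} : ∀ {s : Set Clause}, Truth (.bel k α) s →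
    Truth (.bel k α) ((fun c => c.image (Literal.rename π)) '' s) := by
  induction k with
  | zero =>
    intro s
    rw [truth_bel_zero, truth_bel_zero]
    refine (truth_transfer hα fun c hc h => ?_).1
    have h' := h.rename π
    suffices c.image (Literal.rename π) = c by rwa [this] at h'
    conv_rhs => rw [← c.image_id]
    refine Finset.image_congr fun l hl => ?_
    have := hπ _ (hc l hl)
    cases l <;> simp_all [Literal.rename, Literal.atom]
  | succ k ih =>
    intro s
    rw [truth_bel_succ, truth_bel_succ]
    rintro ⟨t, ht⟩
    refine ⟨t, fun n => ?_⟩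
    have := ih (ht (π.symm n))
    rw [Set.image_union, Set.image_singleton, Finset.image_singleton] at this
    simpa [Literal.rename] using this

/-! ### Bounded search -/

/-- Searches for a splitting strategy of the given depth, with function terms from `Fs` and names
from `Ns`. The condition on the chosen values is `leaf`. -/
def search (leaf : List (FTerm × Name) → Bool) (Fs : List FTerm) (Ns : List Name) :
    ℕ → List (FTerm × Name) → Bool
  | 0, A => leaf A
  | k + 1, A => Fs.any fun t => Ns.all fun n => search leaf Fs Ns k ((t, n) :: A)

/-- Bounded search decides belief, if there are as many fresh names as splits: a name that does not
occur in `Ns` can be replaced by a fresh name that has not been used so far. -/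
theorem search_iff {α : Formula} (hα : α.IsObjective) {s : Set Clause}
    {leaf : List (FTerm × Name) → Bool} {Fs : List FTerm} {Ns fresh : List Name}
    (hleaf : ∀ A, leaf A = true ↔ Truth α (s ∪ units {p | p ∈ A})) (hne : Fs ≠ [])
    (hsF : ∀ c ∈ s, ∀ l ∈ c, l.term ∈ Fs) (hαF : ∀ p ∈ α.atoms, p.1 ∈ Fs)
    (hsN : ∀ c ∈ s, ∀ l ∈ c, l.atom.2 ∈ Ns ∧ l.atom.2 ∉ fresh)
    (hαN : ∀ p ∈ α.atoms, p.2 ∈ Ns ∧ p.2 ∉ fresh) (hfresh : fresh.Nodup)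
    (hsub : fresh ⊆ Ns) (k : ℕ) : ∀ A : List (FTerm × Name),
      (∀ p ∈ A, p.1 ∈ Fs ∧ p.2 ∈ Ns) → A.length + k ≤ fresh.length →
      (search leaf Fs Ns k A = true ↔ Truth (.bel k α) (s ∪ units {p | p ∈ A})) := by
  induction k with
  | zero =>
    intro A _ _
    rw [search, hleaf, truth_bel_zero]
  | succ k ih =>
    intro A hA hlen
    have hF : α.funcs ⊆ Fs.toFinset := fun t ht => by
      obtain ⟨p, hp, rfl⟩ := Formula.mem_funcs.mp ht
      simpa using hαF p hp
    rw [bel_succ_iff_of_mem hα hF ⟨Fs.head hne, by simp⟩ (by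
      rintro c (hc | ⟨p, hp, rfl⟩) l hl
      · simpa using hsF c hc l hl
      · rw [Finset.mem_singleton] at hl
        subst hl
        exact List.mem_toFinset.mpr (hA p hp).1)]
    have hset : ∀ t n, s ∪ units {p | p ∈ A} ∪ {{Literal.eq t n}} =
        s ∪ units {p | p ∈ (t, n) :: A} := by
      intro t n
      have : {p | p ∈ (t, n) :: A} = insert (t, n) {p | p ∈ A} := by
        ext p; simp
      rw [this, units_insert, Set.union_assoc]
    have ih' : ∀ t ∈ Fs, ∀ n ∈ Ns, (search leaf Fs Ns k ((t, n) :: A) = true ↔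
        Truth (.bel k α) (s ∪ units {p | p ∈ A} ∪ {{Literal.eq t n}})) := by
      intro t ht n hn
      rw [hset]
      refine ih _ ?_ (by simp; omega)
      rintro p hp
      rcases List.mem_cons.mp hp with rfl | hp
      · exact ⟨ht, hn⟩
      · exact hA p hp
    simp only [search, List.any_eq_true, List.all_eq_true, List.mem_toFinset]
    refine exists_congr fun t => and_congr_right fun ht => ⟨fun h n => ?_, fun h n hn =>
      (ih' t ht n hn).mpr (h n)⟩
    by_cases hn : n ∈ Ns
    · exact (ih' t ht n hn).mp (h n hn)
    -- The name `n` is unused, so the values chosen after `f` also work for `n`, with `f` and `n`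
    -- exchanged.
    obtain ⟨f, hf, hfA⟩ : ∃ f ∈ fresh, f ∉ A.map Prod.snd := by
      by_contra! hcon
      have := (hfresh.subperm hcon).length_le
      simp at this
      omega
    have hfix : ∀ m, m ∈ Ns → m ≠ f → Equiv.swap f n m = m := fun m hm hmf =>
      Equiv.swap_apply_of_ne_of_ne hmf fun h => hn (h ▸ hm)
    have hfn := bel_rename (Equiv.swap f n) hα
      (fun p hp => hfix _ (hαN p hp).1 fun h => (hαN p hp).2 (h ▸ hf))
      ((ih' t ht f (hsub hf)).mp (h f (hsub hf)))
    refine bel_mono_subset hα ?_ hfn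
    rintro _ ⟨c, (hc | ⟨p, hp, rfl⟩) | rfl, rfl⟩
    · refine .inl (.inl ?_)
      suffices c.image (Literal.rename (Equiv.swap f n)) = c by
        simpa only [this] using hc
      conv_rhs => rw [← c.image_id]
      refine Finset.image_congr fun l hl => ?_
      have hl' := hsN c hc l hl
      have := hfix _ hl'.1 fun h => hl'.2 (h ▸ hf)
      cases l <;> simp_all [Literal.rename, Literal.atom]
    · refine .inl (.inr ⟨p, hp, ?_⟩)
      have := hfix p.2 (hA p hp).2 fun h => hfA (h ▸ List.mem_map_of_mem hp)
      simp [Literal.rename, this]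
    · right
      simp [Literal.rename]

/-! ### Deciding derivability of clauses -/

/-- Whether the literal `a` implies the literal `b`. -/
def implies (a b : Literal) : Bool :=
  decide (a = b) ||
    match a, b with
    | .eq t n, .ne t' n' => decide (t = t') && !decide (n = n')
    | _, _ => false

theorem subsumes_iff {c d : Clause} :
    Subsumes c d ↔ ∀ a ∈ c, ∃ b ∈ d, implies a b = true := by
  constructor
  · rintro h (⟨t, n⟩ | ⟨t, n⟩) ha
    · rcases h.1 t n ha with h | ⟨n', hn, h⟩
      · exact ⟨_, h, by simp [implies]⟩
      · exact ⟨_, h, by simp [implies, hn]⟩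
    · exact ⟨_, h.2 t n ha, by simp [implies]⟩
  · refine fun h => ⟨fun t n ha => ?_, fun t n ha => ?_⟩
    · obtain ⟨⟨t', n'⟩ | ⟨t', n'⟩, hb, hi⟩ := h _ ha
      · simp only [implies, Literal.eq.injEq, Bool.or_false, decide_eq_true_eq] at hi
        exact .inl (by rwa [hi.1, hi.2])
      · simp only [implies, reduceCtorEq, decide_false, Bool.false_or, Bool.and_eq_true,
          decide_eq_true_eq, Bool.not_eq_true', decide_eq_false_iff_not] at hi
        exact .inr ⟨n', hi.2, by rwa [hi.1]⟩
    · obtain ⟨⟨t', n'⟩ | ⟨t', n'⟩, hb, hi⟩ := h _ ha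
      · simp [implies] at hi
      · simp only [implies, Literal.ne.injEq, Bool.or_false, decide_eq_true_eq] at hi
        rwa [hi.1, hi.2]

theorem Complementary.of_implies {a b u l : Literal} (h : Complementary b l)
    (hab : implies a b = true) (hul : implies u l = true) : Complementary a u := by
  cases a <;> cases b <;> cases u <;> cases l <;>
    simp only [implies, Complementary, reduceCtorEq, decide_false, Bool.false_or, Bool.and_eq_true,
      decide_eq_true_eq, Bool.not_eq_true', decide_eq_false_iff_not, Bool.or_false,
      Literal.eq.injEq, Literal.ne.injEq, Bool.false_eq_true] at h hab hul ⊢ <;> grind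

/-- The complementary literal over the same atom. -/
def Literal.negate : Literal → Literal
  | .eq t n => .ne t n
  | .ne t n => .eq t n

/-- Each literal of the clause `d` is complementary to `l`. If `d` is derivable, it subsumes the
negation of `l`, so that `l` can be removed from any derivable clause. -/
def kills (d : List Literal) (l : Literal) : Bool := d.all fun u => decide (Complementary l u)

/-- Removes all literals that are refuted by a clause, simultaneously. -/
def propagateAll (S : List (List Literal)) : List (List Literal) :=
  S.map fun c => c.filter fun l => !(S.any fun d => kills d l)

/-- Iterates `propagateAll`, once for each literal. After so many rounds no literal is refuted any
more. -/
def saturate (S : List (List Literal)) : List (List Literal) :=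
  S.flatten.foldl (fun S' _ => propagateAll S') S

/-- Whether the clause `c` is subsumed by a clause in `S`. -/
def derivable (S : List (List Literal)) (c : List Literal) : Bool :=
  S.any fun d => d.all fun a => c.any fun b => implies a b

/-- The set of clauses given by a list of lists of literals. -/
def clauseSet (S : List (List Literal)) : Set Clause := {c | ∃ d ∈ S, d.toFinset = c}

theorem derivable_iff_subsumes {S : List (List Literal)} {c : List Literal} :
    derivable S c = true ↔ ∃ d ∈ S, Subsumes d.toFinset c.toFinset := by
  simp [derivable, subsumes_iff]

theorem kills_iff {d : List Literal} {l : Literal} :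
    kills d l = true ↔ ∀ u ∈ d, Complementary l u := by
  simp [kills]

theorem iterate_fixed {X : Type} {f : X → X} (μ : X → ℕ) (hf : ∀ x, f x = x ∨ μ (f x) < μ x)
    (n : ℕ) : ∀ x, μ x ≤ n → f (f^[n] x) = f^[n] x := by
  induction n with
  | zero => exact fun x hx => (hf x).resolve_right (by omega)
  | succ n ih =>
    intro x hx
    rw [Function.iterate_succ_apply]
    rcases hf x with h | h
    · have : ∀ n, f^[n] (f x) = x := fun n => by
        rw [h]
        exact (Function.IsFixedPt.iterate h n)
      rw [this, h]
    · exact ih (f x) (by omega)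

theorem foldl_const_iterate {X Y : Type} (f : X → X) (l : List Y) :
    ∀ x, l.foldl (fun x _ => f x) x = f^[l.length] x := by
  induction l with
  | nil => exact fun _ => rfl
  | cons _ l ih => exact fun x => ih (f x)

theorem map_filter_eq_or_lt (p : Literal → Bool) (S : List (List Literal)) :
    (S.map fun c => c.filter p) = S ∨
      (S.map fun c => c.filter p).flatten.length < S.flatten.length := by
  induction S with
  | nil => exact .inl rfl
  | cons c S ih =>
    have h := List.length_filter_le p c
    simp only [List.map_cons, List.flatten_cons, List.length_append]
    by_cases hc : c.filter p = c
    · rcases ih with ih | ih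
      · exact .inl (by rw [hc, ih])
      · right; omega
    · have : (c.filter p).length ≠ c.length := fun h' =>
        hc (List.filter_sublist.eq_of_length h')
      right
      rcases ih with ih | ih
      · rw [ih]; omega
      · omega

theorem propagateAll_saturate (S : List (List Literal)) :
    propagateAll (saturate S) = saturate S := by
  rw [saturate, foldl_const_iterate]
  exact iterate_fixed (fun S => S.flatten.length) (fun S => map_filter_eq_or_lt _ S) _ S le_rfl

theorem InUP.filter_negate {s : Set Clause} {c : Clause} (hc : InUP s c) (K : List Literal)
    (hK : ∀ l ∈ K, InUP s {l.negate}) :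
    InUP s (c.filter fun l' => ∀ l ∈ K, ¬ Complementary l' l.negate) := by
  induction K with
  | nil => simpa using hc
  | cons l K ih =>
    have := (ih fun l hl => hK l (List.mem_cons_of_mem _ hl)).unit (hK l List.mem_cons_self)
    rw [propagate, Finset.filter_filter] at this
    simpa [and_comm] using this

theorem inUP_propagateAll {s : Set Clause} {S : List (List Literal)}
    (h : ∀ c ∈ S, InUP s c.toFinset) : ∀ c ∈ propagateAll S, InUP s c.toFinset := by
  intro c hc
  obtain ⟨c, hcS, rfl⟩ := List.mem_map.mp hc
  have key := (h c hcS).filter_negate (c.filter fun l => S.any fun d => kills d l) (by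
    intro l hl
    obtain ⟨-, hl⟩ := List.mem_filter.mp hl
    obtain ⟨d, hd, hl⟩ := List.any_eq_true.mp hl
    refine (h d hd).subsume (subsumes_iff.mpr fun u hu => ⟨_, Finset.mem_singleton_self _, ?_⟩)
    have := kills_iff.mp hl u (by simpa using hu)
    revert this
    cases u <;> cases l <;> simp only [Complementary, implies, Literal.negate] <;> grind)
  convert key using 1
  ext l
  simp only [List.mem_toFinset, List.mem_filter, Bool.not_eq_true', Finset.mem_filter,
    and_congr_right_iff]
  intro hl
  constructor
  · rintro h' l' ⟨-, hl'⟩ hcomp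
    obtain ⟨d, hd, hl'⟩ := List.any_eq_true.mp hl'
    refine Bool.eq_false_iff.mp h' (List.any_eq_true.mpr ⟨d, hd, kills_iff.mpr fun u hu => ?_⟩)
    have := kills_iff.mp hl' u hu
    revert this hcomp
    cases u <;> cases l <;> cases l' <;> simp only [Complementary, Literal.negate] <;> grind
  · intro h'
    rw [Bool.eq_false_iff]
    intro hk
    exact h' l ⟨hl, hk⟩ (by cases l <;> simp [Complementary, Literal.negate])

theorem inUP_saturate {S : List (List Literal)} :
    ∀ c ∈ saturate S, InUP (clauseSet S) c.toFinset := by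
  rw [saturate, foldl_const_iterate]
  generalize S.flatten.length = n
  induction n with
  | zero => exact fun c hc => .base ⟨c, hc, rfl⟩
  | succ n ih =>
    rw [Function.iterate_succ_apply']
    exact inUP_propagateAll ih

theorem exists_subset_saturate {S : List (List Literal)} {c : List Literal} (hc : c ∈ S) :
    ∃ d ∈ saturate S, d ⊆ c := by
  rw [saturate, foldl_const_iterate]
  generalize S.flatten.length = n
  induction n with
  | zero => exact ⟨c, hc, fun _ h => h⟩
  | succ n ih =>
    obtain ⟨d, hd, hdc⟩ := ih
    rw [Function.iterate_succ_apply']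
    exact ⟨_, List.mem_map_of_mem hd, List.Subset.trans (List.filter_sublist.subset) hdc⟩

/-- The set of clauses subsumed by a clause of the saturated list is closed under unit propagation,
because the saturated clauses contain no literals that can be refuted. -/
theorem derivable_saturate {S : List (List Literal)} {c : List Literal} :
    derivable (saturate S) c = true ↔ InUP (clauseSet S) c.toFinset := by
  rw [derivable_iff_subsumes]
  constructor
  · rintro ⟨d, hd, h⟩
    exact (inUP_saturate d hd).subsume h
  · generalize c.toFinset = c
    intro h
    induction h with
    | base h =>
      obtain ⟨d, hd, rfl⟩ := h
      obtain ⟨e, he, h⟩ := exists_subset_saturate hd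
      exact ⟨e, he, subsumes_of_subset fun l hl => by simpa using h (by simpa using hl)⟩
    | @unit c l _ _ ih₁ ih₂ =>
      obtain ⟨d, hd, hdc⟩ := ih₁
      obtain ⟨e, he, hel⟩ := ih₂
      refine ⟨d, hd, subsumes_iff.mpr fun a ha => ?_⟩
      obtain ⟨b, hb, hab⟩ := subsumes_iff.mp hdc a ha
      refine ⟨b, Finset.mem_filter.mpr ⟨hb, fun hbl => ?_⟩, hab⟩
      -- otherwise `e` refutes `a`, although the saturated set contains no refuted literals
      have hkill : kills e a = true := kills_iff.mpr fun u hu => by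
        obtain ⟨l', hl', hul⟩ := subsumes_iff.mp hel u (by simpa using hu)
        rw [Finset.mem_singleton] at hl'
        subst hl'
        exact hbl.of_implies hab hul
      have hfix : ∀ S : List (List Literal), propagateAll S = S → ∀ d ∈ S, ∀ a ∈ d,
          (S.any fun d => kills d a) = false := by
        intro S hS d hd a ha
        have := List.map_inj_left.mp (hS.trans S.map_id.symm) d hd
        have := List.filter_eq_self.mp this a ha
        simpa using this
      have := hfix _ (propagateAll_saturate S) d hd a (by simpa using ha)
      rw [List.any_eq_false] at this
      exact this e he hkill
    | subsume _ h ih =>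
      obtain ⟨e, he, h'⟩ := ih
      exact ⟨e, he, h'.trans h⟩

/-! ### Evaluation of formulas in Polish notation -/

/-- The symbols of a formula without belief operators: `none` is a disjunction, `some none` a
negation, and `some (some (t, n))` the literal `t = n`. -/
abbrev Item : Type := Option (Option (FTerm × Name))

/-- An objective formula in Polish notation. -/
def Formula.items : Formula → List Item
  | .eq t n => [some (some (t, n))]
  | .neg α => some none :: α.items
  | .or α β => none :: (α.items ++ β.items)
  | .bel _ α => α.items

/-- The result of evaluating a formula: the literals of its clause, or `[]` if it is not a clause,
the value of the formula, and the value of its negation. -/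
abbrev Val (V : Type) : Type := List Literal × V × V

/-- The clause of a negation. -/
def negClause : List Literal → List Literal
  | [.eq t n] => [.ne t n]
  | _ => []

section Eval

variable {V : Type} (check : List Literal → V) (disj conj : V → V → V)

/-- The value of a literal `t = n`. -/
def litVal (t : FTerm) (n : Name) : Val V := ([.eq t n], check [.eq t n], check [.ne t n])

/-- The value of a negation. -/
def negVal (v : Val V) : Val V := (negClause v.1, v.2.2, v.2.1)

/-- The value of a disjunction. -/
def orVal (v w : Val V) : Val V :=
  if v.1 = [] ∨ w.1 = [] then ([], disj v.2.1 w.2.1, conj v.2.2 w.2.2)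
  else (v.1 ++ w.1, check (v.1 ++ w.1), conj v.2.2 w.2.2)

theorem orVal_neg (v w : Val V) : (orVal check disj conj v w).2.2 = conj v.2.2 w.2.2 := by
  unfold orVal
  split_ifs <;> rfl

/-- The value of a formula, where `check` gives the values of clauses, and `disj` and `conj` those
of disjunctions that are not clauses, and of conjunctions. -/
def Formula.val : Formula → Val V
  | .eq t n => litVal check t n
  | .neg α => negVal α.val
  | .or α β => orVal check disj conj α.val β.val
  | .bel _ α => α.val

/-- Processes a symbol with a stack of values. -/
def evalItem (i : Item) (st : List (Val V)) : List (Val V) :=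
  match i with
  | none => match st with
    | v :: w :: st => orVal check disj conj v w :: st
    | st => st
  | some none => match st with
    | v :: st => negVal v :: st
    | [] => []
  | some (some (t, n)) => litVal check t n :: st

theorem foldr_evalItem : ∀ {α : Formula}, α.IsObjective → ∀ st : List (Val V),
    α.items.foldr (evalItem check disj conj) st = α.val check disj conj :: st
  | .eq _ _, _, _ => rfl
  | .neg α, h, st => by
    rw [Formula.items, List.foldr_cons, foldr_evalItem (α := α) h]
    rfl
  | .or α β, h, st => by
    rw [Formula.items, List.foldr_cons, List.foldr_append, foldr_evalItem h.2, foldr_evalItem h.1]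
    rfl

theorem toClause_val : ∀ {α : Formula}, α.IsObjective → α.toClause =
    if (α.val check disj conj).1 = [] then none else some (α.val check disj conj).1.toFinset
  | .eq _ _, _ => rfl
  | .neg (.eq _ _), _ => rfl
  | .neg (.neg (.eq _ _)), _ => rfl
  | .neg (.neg (.neg α)), h => by
    have : ∀ c, negClause (negClause c) = [] := by
      intro c; unfold negClause; grind
    have h' : negClause [] = [] := rfl
    simp [Formula.val, Formula.toClause, negVal, this, h']
  | .neg (.neg (.or α β)), h => by
    have : ∀ c, negClause (negClause c) = [] := by
      intro c; unfold negClause; grind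
    simp [Formula.val, Formula.toClause, negVal, this]
  | .neg (.or α β), _ => by
    have : negClause (orVal check disj conj (α.val check disj conj)
        (β.val check disj conj)).1 = [] := by
      unfold orVal
      split_ifs with h
      · rfl
      · push Not at h
        obtain ⟨a, l, h₁⟩ := List.exists_cons_of_ne_nil h.1
        obtain ⟨b, l', h₂⟩ := List.exists_cons_of_ne_nil h.2
        rw [h₁, h₂]
        unfold negClause
        split
        · simp at *
        · rfl
    simp [Formula.val, Formula.toClause, negVal, this]
  | .or α β, h => by
    rw [Formula.toClause, toClause_val h.1, toClause_val h.2, Formula.val, orVal]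
    by_cases h₁ : (α.val check disj conj).1 = [] <;>
      by_cases h₂ : (β.val check disj conj).1 = [] <;>
      simp [h₁, h₂]

end Eval

/-- The atoms of the clause of a formula occur in the formula. -/
theorem atom_mem_val {V : Type} (check : List Literal → V) (disj conj : V → V → V) :
    ∀ {α : Formula}, α.IsObjective → ∀ l ∈ (α.val check disj conj).1, l.atom ∈ α.atoms := by
  intro α hα l hl
  have h := toClause_val check disj conj hα
  rw [if_neg (List.ne_nil_of_mem hl)] at h
  exact Formula.atom_mem_of_toClause h l (by simpa using hl)

theorem truth_val {s : Set Clause} {check : List Literal → Bool}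
    (hcheck : ∀ c, check c = true ↔ InUP s c.toFinset) {α : Formula} (hα : α.IsObjective) :
    ((α.val check (· || ·) (· && ·)).2.1 = true ↔ Truth α s) ∧
      ((α.val check (· || ·) (· && ·)).2.2 = true ↔ Truth (.neg α) s) := by
  induction α with
  | eq t n =>
    rw [truth_eq, truth_ne]
    simp [Formula.val, litVal, hcheck]
  | neg α ih =>
    rw [truth_neg_neg]
    exact (ih hα).symm
  | or α β ih₁ ih₂ =>
    have ih₁ := ih₁ hα.1
    have ih₂ := ih₂ hα.2
    rw [truth_neg_or, ← ih₁.2, ← ih₂.2]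
    have h := toClause_val check (· || ·) (· && ·) (α := .or α β) hα
    rw [Formula.val, orVal] at h ⊢
    split_ifs at h ⊢ with h₁ h₂
    · rw [truth_or h, ← ih₁.1, ← ih₂.1]
      simp
    · exact absurd rfl h₂
    · simp_all
    · rw [truth_or_clause h]
      simp [hcheck]
  | bel => exact hα.elim

/-- The clauses of a formula in conjunctive normal form. -/
def Formula.clauses (α : Formula) : List (List Literal) :=
  (α.val (fun c => [c]) (fun _ _ => []) (· ++ ·)).2.1

theorem truth_iff_clauses {s : Set Clause} {α : Formula} (hα : α.IsObjective) (h : α.IsCNF) :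
    Truth α s ↔ clauseSet α.clauses ⊆ UP s := by
  have clauseSet_singleton : ∀ c, clauseSet [c] ⊆ UP s ↔ InUP s c.toFinset := by
    intro c
    simp [clauseSet, UP, Set.subset_def]
  induction h with
  | @clause α h =>
    match α, h with
    | .eq t n, _ =>
      rw [truth_eq]
      change _ ↔ clauseSet [[Literal.eq t n]] ⊆ UP s
      simpa using (clauseSet_singleton [.eq t n]).symm
    | .neg (.eq t n), _ =>
      rw [truth_ne]
      change _ ↔ clauseSet [[Literal.ne t n]] ⊆ UP s
      simpa using (clauseSet_singleton [.ne t n]).symm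
    | .or α β, h =>
      have h' := toClause_val (fun c => [c]) (fun _ _ => []) (· ++ ·) hα
      rw [Formula.clauses]
      rw [Formula.val, orVal] at h' ⊢
      split_ifs at h' ⊢ with h₁ h₂
      · simp [h'] at h
      · simp at h₂
      · simp_all
      · rw [truth_or_clause h']
        exact (clauseSet_singleton _).symm
  | @and α β _ _ ih₁ ih₂ =>
    have : (α.and β).clauses = α.clauses ++ β.clauses := by
      simp only [Formula.clauses, Formula.and, Formula.val, negVal, orVal_neg]
    have h₂ : clauseSet (α.clauses ++ β.clauses) = clauseSet α.clauses ∪ clauseSet β.clauses := by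
      ext c
      simp [clauseSet, or_and_right, exists_or]
    rw [this, h₂, Set.union_subset_iff, Formula.and, truth_neg_or, truth_neg_neg, truth_neg_neg]
    exact and_congr (ih₁ hα.1) (ih₂ hα.2)

theorem atom_mem_clauses {α : Formula} (hα : α.IsObjective) :
    ∀ c ∈ α.clauses, ∀ l ∈ c, l.atom ∈ α.atoms := by
  suffices (∀ c ∈ (α.val (fun c => [c]) (fun _ _ => []) (· ++ ·)).2.1, ∀ l ∈ c, l.atom ∈ α.atoms) ∧
      ∀ c ∈ (α.val (fun c => [c]) (fun _ _ => []) (· ++ ·)).2.2, ∀ l ∈ c, l.atom ∈ α.atoms from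
    this.1
  induction α with
  | eq t n => simp [Formula.val, litVal, Literal.atom, Formula.atoms]
  | neg α ih => exact (ih hα).symm
  | or α β ih₁ ih₂ =>
    have ih₁ := ih₁ hα.1
    have ih₂ := ih₂ hα.2
    rw [Formula.val, orVal]
    have hconj : ∀ c ∈ (α.val (fun c => [c]) (fun _ _ => []) (· ++ ·)).2.2 ++
        (β.val (fun c => [c]) (fun _ _ => []) (· ++ ·)).2.2, ∀ l ∈ c,
          l.atom ∈ (Formula.or α β).atoms := by
      intro c hc l hl
      rw [Formula.atoms, List.mem_append]
      exact (List.mem_append.mp hc).imp (ih₁.2 c · l hl) (ih₂.2 c · l hl)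
    split_ifs with h
    · exact ⟨by simp, hconj⟩
    · refine ⟨fun c hc l hl => ?_, hconj⟩
      rw [List.mem_singleton] at hc
      subst hc
      rw [Formula.atoms, List.mem_append]
      exact (List.mem_append.mp hl).imp (atom_mem_val _ _ _ hα.1 l) (atom_mem_val _ _ _ hα.2 l)
  | bel => exact hα.elim

/-- The question of Limited Belief Reasoning is about belief given the clauses of the knowledge
base. -/
theorem Input.yes_iff (x : Input) :
    x.Yes ↔ Truth (.bel x.level x.query) (clauseSet x.kb.clauses) := by
  have h : ∀ s, Truth ((Formula.bel 0 x.kb).imp (.bel x.level x.query)) s ↔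
      (clauseSet x.kb.clauses ⊆ UP s → Truth (.bel x.level x.query) s) := by
    intro s
    rw [Formula.imp, truth_or (by simp [Formula.toClause]), truth_neg_bel, truth_bel_zero,
      truth_iff_clauses x.kb_objective x.kb_cnf, imp_iff_not_or]
  simp only [Input.Yes, Valid, h]
  exact ⟨fun h => h _ (subset_UP _), fun h s hs => bel_mono x.query_objective hs h⟩

/-! ### Evaluation of formulas in polynomial time -/

/-- Whether a literal is of the form `t = n`. -/
def Literal.sign : Literal → Bool
  | .eq _ _ => true
  | .ne _ _ => false

namespace PolyTime

variable {α β γ : Type} [TreeRep α] [TreeRep β] [TreeRep γ]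

theorem foldr {L : α → List β} {I : α → γ} {F : α → β → γ → γ} (hL : PolyTime L)
    (hI : PolyTime I) (hF : PolyTime fun x : α × β × γ => F x.1 x.2.1 x.2.2) (r : Polynomial ℕ)
    (hr : ∀ a l, l <:+ L a → sz (l.foldr (F a) (I a)) ≤ r.eval (sz a)) :
    PolyTime fun a => (L a).foldr (F a) (I a) := by
  refine (foldl (reverse hL) hI (F := fun a s b => F a b s)
    (hF.comp (pair fst' (pair (snd snd') (fst snd')))) r fun a i _ => ?_).of_eq fun a => by simp
  rw [List.take_reverse, List.foldl_reverse]
  exact hr a _ (List.drop_suffix _ _)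

theorem tail {L : α → List β} (hL : PolyTime L) : PolyTime fun a => (L a).tail :=
  (list_casesOn hL (const []) (snd snd')).of_eq fun a => by cases L a <;> rfl

theorem headD {L : α → List β} (hL : PolyTime L) (b : β) : PolyTime fun a => (L a).headD b :=
  (list_casesOn hL (const b) (fst snd')).of_eq fun a => by cases L a <;> rfl

theorem lit_eq {t : α → FTerm} {n : α → Name} (ht : PolyTime t) (hn : PolyTime n) :
    PolyTime fun a => Literal.eq (t a) (n a) :=
  ((const true).pair (ht.pair hn)).of_rep_eq fun _ => rfl

theorem lit_ne {t : α → FTerm} {n : α → Name} (ht : PolyTime t) (hn : PolyTime n) :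
    PolyTime fun a => Literal.ne (t a) (n a) :=
  ((const false).pair (ht.pair hn)).of_rep_eq fun _ => rfl

theorem sign_atom {l : α → Literal} (hl : PolyTime l) :
    PolyTime fun a => ((l a).sign, (l a).atom) :=
  hl.of_rep_eq fun a => by cases l a <;> rfl

theorem sign {l : α → Literal} (hl : PolyTime l) : PolyTime fun a => (l a).sign :=
  fst (sign_atom hl)

theorem atom {l : α → Literal} (hl : PolyTime l) : PolyTime fun a => (l a).atom :=
  snd (sign_atom hl)

theorem complementary {l l' : α → Literal} (hl : PolyTime l) (hl' : PolyTime l') :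
    PolyTime fun a => decide (Complementary (l a) (l' a)) := by
  have ht := decide_eq (fst (atom hl)) (fst (atom hl'))
  have hn := decide_eq (snd (atom hl)) (snd (atom hl'))
  refine (bool_and ht (cond (sign hl) (cond (sign hl') (bool_not hn) hn)
    (bool_and (sign hl') hn))).of_eq fun a => ?_
  rw [Bool.eq_iff_iff]
  cases l a <;> cases l' a <;> simp only [Literal.sign, cond_true, cond_false, Bool.and_eq_true,
    decide_eq_true_eq, Bool.not_eq_true', decide_eq_false_iff_not, Bool.false_and, and_false,
    Bool.false_eq_true] <;> simp [Complementary, Literal.atom]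

theorem implies {l l' : α → Literal} (hl : PolyTime l) (hl' : PolyTime l') :
    PolyTime fun a => implies (l a) (l' a) := by
  have ht := decide_eq (fst (atom hl)) (fst (atom hl'))
  have hn := decide_eq (snd (atom hl)) (snd (atom hl'))
  refine (bool_or (decide_eq hl hl') (bool_and (sign hl) (bool_and (bool_not (sign hl'))
    (bool_and ht (bool_not hn))))).of_eq fun a => ?_
  rw [Bool.eq_iff_iff]
  cases l a <;> cases l' a <;> simp only [Literal.sign, Bool.and_eq_true, Bool.or_eq_true,
    decide_eq_true_eq, Bool.not_eq_true', decide_eq_false_iff_not, Bool.false_and,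
    Bool.false_eq_true, LimitedBelief.implies] <;> simp [Literal.atom]

theorem propagateAll {S : α → List (List Literal)} (hS : PolyTime S) :
    PolyTime fun a => propagateAll (S a) := by
  refine map hS (f := fun a c => c.filter fun l => !((S a).any fun d => kills d l)) ?_
  refine filter snd' (f := fun (x : α × List Literal) l => !((S x.1).any fun d => kills d l)) ?_
  refine bool_not (any (hS.comp (fst fst')) (f := fun (x : (α × List Literal) × Literal) d =>
    kills d x.2) ?_)
  exact all snd' (f := fun (x : ((α × List Literal) × Literal) × List Literal) u =>
    decide (Complementary x.1.2 u)) (complementary (snd (fst fst')) snd')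

theorem _root_.LimitedBelief.sz_propagateAll_le (S : List (List Literal)) :
    sz (LimitedBelief.propagateAll S) ≤ sz S := by
  have h₁ : ∀ (p : Literal → Bool) (c : List Literal), sz (c.filter p) ≤ sz c := by
    intro p c
    induction c with
    | nil => simp
    | cons a c ih => cases h : p a <;> simp [h] <;> omega
  have h₂ : ∀ (p : Literal → Bool) (S : List (List Literal)),
      sz (S.map fun c => c.filter p) ≤ sz S := by
    intro p S
    induction S with
    | nil => simp
    | cons c S ih => have := h₁ p c; simp; omega
  exact h₂ _ S

theorem saturate {S : α → List (List Literal)} (hS : PolyTime S) :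
    PolyTime fun a => saturate (S a) :=
  foldl_of_growth (flatten hS) hS (F := fun _ S _ => LimitedBelief.propagateAll S)
    (propagateAll (fst snd')) 0 fun _ _ _ S => by simpa using sz_propagateAll_le S

theorem derivable {S : α → List (List Literal)} {c : α → List Literal} (hS : PolyTime S)
    (hc : PolyTime c) : PolyTime fun a => derivable (S a) (c a) := by
  refine any hS (f := fun a d => d.all fun u => (c a).any fun b => LimitedBelief.implies u b) ?_
  refine all snd' (f := fun (x : α × List Literal) u =>
    (c x.1).any fun b => LimitedBelief.implies u b) ?_
  exact any (hc.comp (fst fst')) (f := fun (x : (α × List Literal) × Literal) b =>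
    LimitedBelief.implies x.2 b) (implies (snd fst') snd')

theorem negClause {c : α → List Literal} (hc : PolyTime c) :
    PolyTime fun a => negClause (c a) := by
  have hh : PolyTime fun x : α × Literal × List Literal => bif x.2.2.isEmpty && x.2.1.sign then
      [Literal.ne x.2.1.atom.1 x.2.1.atom.2] else [] :=
    cond (bool_and (isEmpty (snd snd')) (sign (fst snd')))
      (cons (lit_ne (fst (atom (fst snd'))) (snd (atom (fst snd')))) (const [])) (const [])
  refine (list_casesOn hc (const []) (h := fun _ l c => bif c.isEmpty && l.sign then
    [Literal.ne l.atom.1 l.atom.2] else []) hh).of_eq fun a => ?_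
  rcases c a with _ | ⟨⟨t, n⟩ | ⟨t, n⟩, _ | ⟨l', c'⟩⟩ <;> rfl

section Eval

variable {V : Type} [TreeRep V] {check : α → List Literal → V} {disj conj : V → V → V}

theorem litVal (hcheck : PolyTime fun x : α × List Literal => check x.1 x.2) {t : α → FTerm}
    {n : α → Name} (ht : PolyTime t) (hn : PolyTime n) :
    PolyTime fun a => litVal (check a) (t a) (n a) := by
  have h₁ := cons (lit_eq ht hn) (const [])
  have h₂ := cons (lit_ne ht hn) (const [])
  exact pair h₁ (pair (hcheck.comp (pair id' h₁)) (hcheck.comp (pair id' h₂)))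

theorem orVal (hcheck : PolyTime fun x : α × List Literal => check x.1 x.2)
    (hdisj : PolyTime fun x : V × V => disj x.1 x.2)
    (hconj : PolyTime fun x : V × V => conj x.1 x.2) {v w : α → Val V} (hv : PolyTime v)
    (hw : PolyTime w) : PolyTime fun a => orVal (check a) disj conj (v a) (w a) := by
  have h₁ := append (fst hv) (fst hw)
  have h₂ := hconj.comp (pair (snd (snd hv)) (snd (snd hw)))
  refine (cond (bool_or (isEmpty (fst hv)) (isEmpty (fst hw)))
    (pair (const []) (pair (hdisj.comp (pair (fst (snd hv)) (fst (snd hw)))) h₂))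
    (pair h₁ (pair (hcheck.comp (pair id' h₁)) h₂))).of_eq fun a => ?_
  rw [LimitedBelief.orVal]
  rcases h : (v a).1 with _ | ⟨l, c⟩ <;> rcases h' : (w a).1 with _ | ⟨l', c'⟩ <;> simp

theorem evalItem (hcheck : PolyTime fun x : α × List Literal => check x.1 x.2)
    (hdisj : PolyTime fun x : V × V => disj x.1 x.2)
    (hconj : PolyTime fun x : V × V => conj x.1 x.2) {i : α → Item} {st : α → List (Val V)}
    (hi : PolyTime i) (hst : PolyTime st) :
    PolyTime fun a => evalItem (check a) disj conj (i a) (st a) := by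
  have hor : PolyTime fun a => listElim (st a) [] fun v st => listElim st [v] fun w st =>
      LimitedBelief.orVal (check a) disj conj v w :: st := by
    refine list_casesOn hst (const []) (h := fun a v st => listElim st [v] fun w st =>
      LimitedBelief.orVal (check a) disj conj v w :: st) ?_
    refine list_casesOn (snd snd') (cons (fst snd') (const []))
      (h := fun (x : α × Val V × List (Val V)) w st =>
        LimitedBelief.orVal (check x.1) disj conj x.2.1 w :: st) ?_
    refine cons ?_ (snd snd')
    have hcheck' : PolyTime fun x : ((α × Val V × List (Val V)) × Val V × List (Val V)) ×
        List Literal => check x.1.1.1 x.2 := hcheck.comp (pair (fst (fst fst')) snd')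
    exact orVal hcheck' hdisj hconj (fst (snd fst')) (fst snd')
  have hneg : PolyTime fun a => listElim (st a) [] fun v st => negVal v :: st :=
    list_casesOn hst (const []) (h := fun _ v st => negVal v :: st)
      (cons (pair (negClause (fst (fst snd'))) (pair (snd (snd (fst snd')))
        (fst (snd (fst snd'))))) (snd snd'))
  have hinner : PolyTime fun x : α × Option (FTerm × Name) => x.2.elim
      (listElim (st x.1) [] fun v st => negVal v :: st)
      fun p => LimitedBelief.litVal (check x.1) p.1 p.2 :: st x.1 := by
    refine option_casesOn snd' (hneg.comp fst')
      (h := fun (x : α × Option (FTerm × Name)) p =>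
        LimitedBelief.litVal (check x.1) p.1 p.2 :: st x.1) ?_
    refine cons ?_ (hst.comp (fst fst'))
    have hcheck' : PolyTime fun x : ((α × Option (FTerm × Name)) × FTerm × Name) ×
        List Literal => check x.1.1.1 x.2 := hcheck.comp (pair (fst (fst fst')) snd')
    exact litVal hcheck' (fst snd') (snd snd')
  refine (option_casesOn hi hor (h := fun a o => o.elim
    (listElim (st a) [] fun v st => negVal v :: st)
    fun p => LimitedBelief.litVal (check a) p.1 p.2 :: st a) hinner).of_eq fun a => ?_
  rcases i a with _ | _ | ⟨t, n⟩ <;> rcases st a with _ | ⟨v, _ | ⟨w, st⟩⟩ <;> rfl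

end Eval

end PolyTime

theorem sz_negClause_le (c : List Literal) : sz (negClause c) ≤ sz c := by
  unfold negClause
  split
  · rename_i t n
    have h₁ : sz (Literal.eq t n) = sz (true, t, n) := rfl
    have h₂ : sz (Literal.ne t n) = sz (false, t, n) := rfl
    simp [h₁, h₂]
  · have := sz_pos c
    simpa

section EvalSize

variable {V : Type} [TreeRep V] {check : List Literal → V} {disj conj : V → V → V}

/-- The sizes of the values grow at most quadratically: the total size of the clauses on the stack
grows by at most a constant for each symbol, and each symbol adds at most this size to the rest. -/
theorem sz_foldr_evalItem_le (hcheck : ∀ c, sz (check c) ≤ sz c + 3)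
    (hdisj : ∀ u v, sz (disj u v) ≤ sz u + sz v + 3)
    (hconj : ∀ u v, sz (conj u v) ≤ sz u + sz v + 3) {K N : ℕ} :
    ∀ items : List Item, (∀ i ∈ items, sz i ≤ K) → items.length ≤ N →
      sz (items.foldr (evalItem check disj conj) []) ≤
        N * (K + 10) + N * (N * (K + 10) + 2 * K + 26) + 3 * N + 1 := by
  let clauseSize : List (Val V) → ℕ := fun st => (st.map fun v => sz v.1).sum
  let valueSize : List (Val V) → ℕ := fun st => (st.map fun v => sz v.2.1 + sz v.2.2).sum
  have hsz : ∀ st : List (Val V), sz st = clauseSize st + valueSize st + 3 * st.length + 1 := by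
    intro st
    induction st with
    | nil => rfl
    | cons v st ih =>
      have : sz v = sz v.1 + (sz v.2.1 + sz v.2.2 + 1) + 1 := by
        rw [← sz_pair, ← sz_pair]
      simp only [clauseSize, valueSize, sz_cons, List.map_cons, List.sum_cons,
        List.length_cons] at ih ⊢
      omega
  suffices ∀ items : List Item, (∀ i ∈ items, sz i ≤ K) → items.length ≤ N →
      (items.foldr (evalItem check disj conj) []).length ≤ items.length ∧
      clauseSize (items.foldr (evalItem check disj conj) []) ≤ items.length * (K + 10) ∧
      valueSize (items.foldr (evalItem check disj conj) []) ≤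
        items.length * (N * (K + 10) + 2 * K + 26) by
    intro items h₁ h₂
    obtain ⟨ha, hb, hc⟩ := this items h₁ h₂
    rw [hsz]
    have h₃ := Nat.mul_le_mul_right (K + 10) h₂
    have h₄ := Nat.mul_le_mul_right (N * (K + 10) + 2 * K + 26) h₂
    omega
  intro items
  induction items with
  | nil => simp [clauseSize, valueSize]
  | cons i items ih =>
    intro h₁ h₂
    obtain ⟨ha, hb, hc⟩ := ih (fun j hj => h₁ j (List.mem_cons_of_mem _ hj))
      ((Nat.le_succ _).trans h₂)
    have hi := h₁ i List.mem_cons_self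
    have hN := Nat.mul_le_mul_right (K + 10) ((Nat.le_succ items.length).trans h₂)
    rw [List.foldr_cons]
    generalize items.foldr (evalItem check disj conj) [] = st at ha hb hc ⊢
    rw [List.length_cons, add_mul, add_mul]
    match i, st with
    | none, [] => simp [evalItem, clauseSize, valueSize]
    | none, [v] =>
      simp only [evalItem]
      omega
    | none, v :: w :: st =>
      have hc' := hcheck (v.1 ++ w.1)
      have happ := sz_append v.1 w.1
      have hd := hdisj v.2.1 w.2.1
      have hc'' := hconj v.2.2 w.2.2
      have hv := sz_pos v.1
      have hw := sz_pos w.1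
      have hor : sz (orVal check disj conj v w).1 ≤ sz v.1 + sz w.1 ∧
          sz (orVal check disj conj v w).2.1 ≤
            sz v.1 + sz w.1 + sz v.2.1 + sz w.2.1 + 3 ∧
          sz (orVal check disj conj v w).2.2 ≤ sz v.2.2 + sz w.2.2 + 3 := by
        unfold orVal
        split_ifs <;> simp <;> omega
      simp only [evalItem, clauseSize, valueSize, List.map_cons, List.sum_cons,
        List.length_cons] at ha hb hc ⊢
      omega
    | some none, [] => simp [evalItem, clauseSize, valueSize]
    | some none, v :: st =>
      have := sz_negClause_le v.1
      simp only [evalItem, clauseSize, valueSize, List.map_cons, List.sum_cons,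
        List.length_cons, negVal] at ha hb hc ⊢
      omega
    | some (some (t, n)), st =>
      have h₁ : sz (Literal.eq t n) = sz t + sz n + 5 := by
        change sz (true, t, n) = _
        simp; omega
      have h₂ : sz (Literal.ne t n) = sz t + sz n + 3 := by
        change sz (false, t, n) = _
        simp; omega
      have h₃ := hcheck [.eq t n]
      have h₄ := hcheck [.ne t n]
      simp only [sz_some, sz_pair, sz_cons, sz_nil, h₁, h₂] at hi h₃ h₄
      simp only [evalItem, clauseSize, valueSize, List.map_cons, List.sum_cons,
        List.length_cons, litVal, sz_cons, sz_nil, h₁] at ha hb hc ⊢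
      omega

end EvalSize

namespace PolyTime

variable {α : Type} [TreeRep α] {V : Type} [TreeRep V] {check : α → List Literal → V}
  {disj conj : V → V → V}

theorem foldr_evalItem {items : α → List Item} (hitems : PolyTime items)
    (hcheck : PolyTime fun x : α × List Literal => check x.1 x.2)
    (hdisj : PolyTime fun x : V × V => disj x.1 x.2)
    (hconj : PolyTime fun x : V × V => conj x.1 x.2)
    (hcheck' : ∀ a c, sz (check a c) ≤ sz c + 3)
    (hdisj' : ∀ u v, sz (disj u v) ≤ sz u + sz v + 3)
    (hconj' : ∀ u v, sz (conj u v) ≤ sz u + sz v + 3) :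
    PolyTime fun a => (items a).foldr (LimitedBelief.evalItem (check a) disj conj) [] := by
  obtain ⟨q, hq⟩ := hitems.sz_le
  have hcheck₂ : PolyTime fun x : (α × Item × List (Val V)) × List Literal => check x.1.1 x.2 :=
    hcheck.comp (pair (fst fst') snd')
  refine foldr hitems (const []) (F := fun a => LimitedBelief.evalItem (check a) disj conj)
    (evalItem hcheck₂ hdisj hconj (fst snd') (snd snd'))
    (q * (q + 10) + q * (q * (q + 10) + 2 * q + 26) + 3 * q + 1) fun a l hl => ?_
  have hlen := hl.length_le
  have := length_lt_sz (items a)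
  have := hq a
  refine (sz_foldr_evalItem_le (hcheck' a) hdisj' hconj' (K := q.eval (sz a)) (N := q.eval (sz a))
    l (fun i hi => ?_) (by omega)).trans ?_
  · have := sz_le_of_mem (hl.subset hi)
    omega
  · simp

end PolyTime

/-! ### Depth-first search -/

/-- The state of a search. The path holds, for each split that has been made, the function terms
and the names that are still to be tried, starting with the current ones. It is followed by one
unit for each split that is still to be made, and by the result, if the current branch has been
explored. -/
abbrev SearchState : Type := List (List FTerm × List Name) × List Unit × Option Bool

/-- The values chosen on a path. -/
def heads (path : List (List FTerm × List Name)) : List (FTerm × Name) :=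
  path.map fun e => (e.1.headD ⟨0, []⟩, e.2.headD 0)

/-- A step of the search. The next name is tried if the result is `true`, and the next function term
if it is `false`. -/
def searchStep (leaf : List (FTerm × Name) → Bool) (Fs : List FTerm) (Ns : List Name)
    (s : SearchState) : SearchState :=
  match s.2.2 with
  | none =>
    match s.2.1 with
    | [] => (s.1, [], some (leaf (heads s.1)))
    | _ :: ticks => ((Fs, Ns) :: s.1, ticks, none)
  | some true =>
    match s.1 with
    | [] => s
    | (ts, ns) :: path =>
      bif ns.tail.isEmpty then (path, () :: s.2.1, some true)
      else ((ts, ns.tail) :: path, s.2.1, none)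
  | some false =>
    match s.1 with
    | [] => s
    | (ts, _) :: path =>
      bif ts.tail.isEmpty then (path, () :: s.2.1, some false)
      else ((ts.tail, Ns) :: path, s.2.1, none)

/-- The number of steps that suffice for a search of depth `k` with `Q` choices per split. -/
def searchTime (Q : ℕ) : ℕ → ℕ
  | 0 => 1
  | k + 1 => 1 + Q * (searchTime Q k + 1)

theorem searchTime_le {Q : ℕ} (hQ : 1 ≤ Q) (k : ℕ) : searchTime Q k ≤ (2 * k + 1) * Q ^ k := by
  induction k with
  | zero => simp [searchTime]
  | succ k ih =>
    have h₁ := Nat.mul_le_mul_left Q ih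
    have h₂ : Q ≤ Q ^ (k + 1) := Nat.le_self_pow (by omega) Q
    rw [searchTime]
    calc 1 + Q * (searchTime Q k + 1) ≤ 1 + Q * ((2 * k + 1) * Q ^ k) + Q := by linarith
      _ = 1 + (2 * k + 1) * Q ^ (k + 1) + Q := by ring
      _ ≤ (2 * (k + 1) + 1) * Q ^ (k + 1) := by linarith

section Search

variable {leaf : List (FTerm × Name) → Bool} {Fs : List FTerm} {Ns : List Name}

theorem searchStep_iterate (hF : Fs ≠ []) (hN : Ns ≠ []) (k : ℕ) :
    ∀ (path) (ticks : List Unit), ticks.length = k →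
      ∃ n ≤ searchTime (Fs.length * Ns.length) k,
        (searchStep leaf Fs Ns)^[n] (path, ticks, none) =
          (path, ticks, some (search leaf Fs Ns k (heads path))) := by
  induction k with
  | zero =>
    intro path ticks h
    obtain rfl := List.length_eq_zero_iff.mp h
    exact ⟨1, le_rfl, rfl⟩
  | succ k ih =>
    rintro path (_ | ⟨u, ticks⟩) h
    · simp at h
    have hk : ticks.length = k := by simpa using h
    set T := searchTime (Fs.length * Ns.length) k
    let A := heads path
    have hnames : ∀ (t : FTerm) (ts : List FTerm) (ns : List Name), ns ≠ [] →
        ∃ n ≤ ns.length * (T + 1),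
          (searchStep leaf Fs Ns)^[n] ((t :: ts, ns) :: path, ticks, none) =
            bif ns.all fun n => search leaf Fs Ns k ((t, n) :: A)
            then (path, () :: ticks, some true)
            else bif ts.isEmpty then (path, () :: ticks, some false)
            else ((ts, Ns) :: path, ticks, none) := by
      intro t ts ns
      induction ns with
      | nil => simp
      | cons x ns ihn =>
        intro _
        obtain ⟨n, hn, hstep⟩ := ih ((t :: ts, x :: ns) :: path) ticks hk
        have hA : heads ((t :: ts, x :: ns) :: path) = (t, x) :: A := rfl
        rw [hA] at hstep
        rw [List.all_cons]
        cases hs : search leaf Fs Ns k ((t, x) :: A) with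
        | false =>
          refine ⟨1 + n, ?_, ?_⟩
          · rw [List.length_cons, add_mul]; omega
          · rw [Function.iterate_add_apply, hstep, hs]
            cases ts <;> rfl
        | true =>
          rcases ns with _ | ⟨y, ns⟩
          · refine ⟨1 + n, by simpa [add_comm] using hn, ?_⟩
            rw [Function.iterate_add_apply, hstep, hs]
            rfl
          · obtain ⟨n', hn', hstep'⟩ := ihn (by simp)
            refine ⟨n' + (1 + n), ?_, ?_⟩
            · rw [List.length_cons, add_mul]; omega
            · rw [Function.iterate_add_apply, Function.iterate_add_apply _ 1 n, hstep, hs,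
                Bool.true_and, ← hstep']
              rfl
    have hterms : ∀ ts : List FTerm, ts ≠ [] →
        ∃ n ≤ ts.length * (Ns.length * (T + 1)),
          (searchStep leaf Fs Ns)^[n] ((ts, Ns) :: path, ticks, none) =
            (path, () :: ticks, some
              (ts.any fun t => Ns.all fun n => search leaf Fs Ns k ((t, n) :: A))) := by
      intro ts
      induction ts with
      | nil => simp
      | cons t ts iht =>
        intro _
        obtain ⟨n, hn, hstep⟩ := hnames t ts Ns hN
        rw [List.any_cons]
        cases hs : Ns.all fun n => search leaf Fs Ns k ((t, n) :: A) with
        | true =>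
          refine ⟨n, ?_, ?_⟩
          · rw [List.length_cons, add_mul]; omega
          · rw [hstep, hs]
            rfl
        | false =>
          rw [hs] at hstep
          rcases ts with _ | ⟨t', ts⟩
          · exact ⟨n, by simpa using hn, hstep⟩
          · obtain ⟨n', hn', hstep'⟩ := iht (by simp)
            refine ⟨n' + n, ?_, ?_⟩
            · rw [List.length_cons, add_mul]; omega
            · rw [Function.iterate_add_apply, hstep]
              exact hstep'
    obtain ⟨n, hn, hstep⟩ := hterms Fs hF
    refine ⟨n + 1, ?_, ?_⟩
    · rw [searchTime, mul_assoc]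
      exact (Nat.add_comm n 1).trans_le (Nat.add_le_add_left hn 1)
    · exact hstep

/-- Whether the search is finished. -/
def finished (s : SearchState) : Bool := s.1.isEmpty && s.2.2.isSome

theorem searchStep_of_finished {s : SearchState} (h : finished s = true) :
    searchStep leaf Fs Ns s = s := by
  obtain ⟨_ | _, ticks, _ | b⟩ := s
  · simp [finished] at h
  · cases b <;> rfl
  · simp [finished] at h
  · simp [finished] at h

theorem exists_searchStep_iterate (hF : Fs ≠ []) (hN : Ns ≠ []) (ticks : List Unit) :
    ∃ n ≤ searchTime (Fs.length * Ns.length) ticks.length,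
      (∀ i < n, finished ((searchStep leaf Fs Ns)^[i] ([], ticks, none)) = false) ∧
      (searchStep leaf Fs Ns)^[n] ([], ticks, none) =
        ([], ticks, some (search leaf Fs Ns ticks.length [])) := by
  obtain ⟨N, hN, hstep⟩ := searchStep_iterate (leaf := leaf) hF hN ticks.length [] ticks rfl
  have hex : ∃ n, finished ((searchStep leaf Fs Ns)^[n] ([], ticks, none)) = true :=
    ⟨N, by rw [hstep]; rfl⟩
  have hle : Nat.find hex ≤ N := Nat.find_min' hex (by rw [hstep]; rfl)
  refine ⟨Nat.find hex, hle.trans hN, fun i hi => by simpa using Nat.find_min hex hi, ?_⟩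
  rw [← Nat.sub_add_cancel hle, Function.iterate_add_apply,
    Function.iterate_fixed (searchStep_of_finished (Nat.find_spec hex))] at hstep
  exact hstep

theorem sz_units (l : List Unit) : sz l = 2 * l.length + 1 := by
  induction l with
  | nil => rfl
  | cons u l ih => simp [ih]; omega

/-- The states of a search are small. -/
theorem sz_searchStep_iterate_le {ticks : List Unit} (i : ℕ) :
    sz ((searchStep leaf Fs Ns)^[i] ([], ticks, none)) ≤
      ticks.length * (sz Fs + sz Ns + 2) + 2 * ticks.length + 9 := by
  let Inv : SearchState → Prop := fun s => s.1.length + s.2.1.length = ticks.length ∧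
    ∀ e ∈ s.1, sz e.1 + sz e.2 ≤ sz Fs + sz Ns ∧ sz e.1 ≤ sz Fs
  have htail : ∀ {β : Type} [TreeRep β] (l : List β), sz l.tail ≤ sz l := by
    intro β _ l
    cases l <;> simp; omega
  have hInv : ∀ s, Inv s → Inv (searchStep leaf Fs Ns s) := by
    rintro ⟨path, ticks', o⟩ ⟨h₁, h₂⟩
    match path, ticks', o with
    | path, [], none => exact ⟨h₁, h₂⟩
    | path, u :: ticks', none =>
      refine ⟨by simp [searchStep] at h₁ ⊢; omega, fun e he => ?_⟩
      rcases List.mem_cons.mp he with rfl | he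
      · exact ⟨le_rfl, le_rfl⟩
      · exact h₂ e he
    | [], ticks', some true => exact ⟨h₁, h₂⟩
    | [], ticks', some false => exact ⟨h₁, h₂⟩
    | (ts, ns) :: path, ticks', some true =>
      have h₃ := htail ns
      have h₄ := h₂ (ts, ns) (by simp)
      simp only [List.length_cons] at h₁
      change Inv (bif ns.tail.isEmpty then (path, () :: ticks', some true)
        else ((ts, ns.tail) :: path, ticks', none))
      cases ns.tail.isEmpty
      · refine ⟨by simpa using h₁, fun e he => ?_⟩
        rcases List.mem_cons.mp he with rfl | he
        · simp only at h₄ ⊢; omega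
        · exact h₂ e (List.mem_cons_of_mem _ he)
      · exact ⟨by simp; omega, fun e he => h₂ e (List.mem_cons_of_mem _ he)⟩
    | (ts, ns) :: path, ticks', some false =>
      have h₃ := htail ts
      have h₄ := h₂ (ts, ns) (by simp)
      simp only [List.length_cons] at h₁
      change Inv (bif ts.tail.isEmpty then (path, () :: ticks', some false)
        else ((ts.tail, Ns) :: path, ticks', none))
      cases ts.tail.isEmpty
      · refine ⟨by simpa using h₁, fun e he => ?_⟩
        rcases List.mem_cons.mp he with rfl | he
        · simp only at h₄ ⊢; omega
        · exact h₂ e (List.mem_cons_of_mem _ he)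
      · exact ⟨by simp; omega, fun e he => h₂ e (List.mem_cons_of_mem _ he)⟩
  have hall : Inv ((searchStep leaf Fs Ns)^[i] ([], ticks, none)) := by
    induction i with
    | zero => exact ⟨by simp, by simp⟩
    | succ i ih =>
      rw [Function.iterate_succ_apply']
      exact hInv _ ih
  generalize (searchStep leaf Fs Ns)^[i] ([], ticks, none) = s at hall
  obtain ⟨path, ticks', o⟩ := s
  obtain ⟨h₁, h₂⟩ := hall
  have hpath : sz path ≤ path.length * (sz Fs + sz Ns + 2) + 1 := by
    clear h₁
    revert h₂
    induction path with
    | nil => simp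
    | cons e path ih =>
      intro h₂
      have h₃ := ih fun e he => h₂ e (List.mem_cons_of_mem _ he)
      have h₄ := (h₂ e (by simp)).1
      have : sz e = sz e.1 + sz e.2 + 1 := sz_pair _ _
      simp only [sz_cons, List.length_cons, add_mul]
      omega
  have hticks := sz_units ticks'
  have ho : sz o ≤ 5 := by rcases o with _ | _ | _ <;> simp
  have h₃ : path.length * (sz Fs + sz Ns + 2) ≤ ticks.length * (sz Fs + sz Ns + 2) :=
    Nat.mul_le_mul_right _ (by simp only at h₁; omega)
  simp only [sz_pair]
  simp only at h₁
  omega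

end Search

namespace PolyTime

variable {α β : Type} [TreeRep α] [TreeRep β]

theorem option_isSome {f : α → Option β} (hf : PolyTime f) : PolyTime fun a => (f a).isSome :=
  (option_casesOn hf (const false) (h := fun (_ : α) (_ : β) => true) (const true)).of_eq
    fun a => by cases f a <;> rfl

theorem heads {path : α → List (List FTerm × List Name)} (hpath : PolyTime path) :
    PolyTime fun a => heads (path a) := by
  have h₁ : PolyTime fun x : α × List FTerm × List Name => x.2.1.headD ⟨0, []⟩ :=
    headD (fst snd') _
  have h₂ : PolyTime fun x : α × List FTerm × List Name => x.2.2.headD 0 := headD (snd snd') _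
  exact map hpath (f := fun (_ : α) (e : List FTerm × List Name) =>
    (e.1.headD ⟨0, []⟩, e.2.headD 0)) (pair h₁ h₂)

theorem finished {s : α → SearchState} (hs : PolyTime s) : PolyTime fun a => finished (s a) :=
  bool_and (isEmpty (fst hs)) (option_isSome (snd (snd hs)))

theorem searchStep {leaf : α → List (FTerm × Name) → Bool} {Fs : α → List FTerm}
    {Ns : α → List Name} {s : α → SearchState}
    (hleaf : PolyTime fun x : α × List (FTerm × Name) => leaf x.1 x.2) (hFs : PolyTime Fs)
    (hNs : PolyTime Ns) (hs : PolyTime s) :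
    PolyTime fun a => searchStep (leaf a) (Fs a) (Ns a) (s a) := by
  have hpath := fst hs
  have hticks := fst (snd hs)
  have hnone : PolyTime fun a => (bif (s a).2.1.isEmpty
      then ((s a).1, [], some (leaf a (LimitedBelief.heads (s a).1)))
      else ((Fs a, Ns a) :: (s a).1, (s a).2.1.tail, none) : SearchState) :=
    cond (isEmpty hticks)
      (pair hpath (pair (const []) (option_some (hleaf.comp (pair id' (heads hpath))))))
      (pair (cons (pair hFs hNs) hpath) (pair (tail hticks) (const none)))
  have hts : PolyTime fun a => ((s a).1.headD ([], [])).1 := fst (headD hpath ([], []))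
  have hns : PolyTime fun a => ((s a).1.headD ([], [])).2 := snd (headD hpath ([], []))
  have hfin : ∀ b, PolyTime fun a => (((s a).1.tail, () :: (s a).2.1, some b) : SearchState) :=
    fun b => pair (tail hpath) (pair (cons (const ()) hticks) (const _))
  have htrue : PolyTime fun a => (bif (s a).1.isEmpty then s a else
      bif ((s a).1.headD ([], [])).2.tail.isEmpty then ((s a).1.tail, () :: (s a).2.1, some true)
      else ((((s a).1.headD ([], [])).1, ((s a).1.headD ([], [])).2.tail) :: (s a).1.tail,
        (s a).2.1, none) : SearchState) :=
    cond (isEmpty hpath) hs (cond (isEmpty (tail hns)) (hfin true)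
      (pair (cons (pair hts (tail hns)) (tail hpath)) (pair hticks (const none))))
  have hfalse : PolyTime fun a => (bif (s a).1.isEmpty then s a else
      bif ((s a).1.headD ([], [])).1.tail.isEmpty then ((s a).1.tail, () :: (s a).2.1, some false)
      else ((((s a).1.headD ([], [])).1.tail, Ns a) :: (s a).1.tail,
        (s a).2.1, none) : SearchState) :=
    cond (isEmpty hpath) hs (cond (isEmpty (tail hts)) (hfin false)
      (pair (cons (pair (tail hts) hNs) (tail hpath)) (pair hticks (const none))))
  have hresult : PolyTime fun a => (s a).2.2.elim false fun b => b :=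
    option_casesOn (snd (snd hs)) (const false) (h := fun (_ : α) (b : Bool) => b) snd'
  refine (cond (option_isSome (snd (snd hs))) (cond hresult htrue hfalse) hnone).of_eq fun a => ?_
  obtain ⟨_ | ⟨⟨ts, ns⟩, path⟩, _ | ⟨u, ticks⟩, _ | _ | _⟩ := s a <;> rfl

end PolyTime

/-! ### Parsing in polynomial time -/

/-- A symbol of a formula, where function terms and names are still words. -/
abbrev RawItem : Type := Option (Option (List Token × List Token))

/-- The words in place of the function terms and names. -/
def Item.raw (i : Item) : RawItem :=
  i.map fun o => o.map fun p => (encodeFTerm p.1, encodeNat p.2)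

/-- The state of a parser that reads a formula from right to left: the word of the name and that of
the function term that are being read, and the list of symbols found so far. -/
abbrev ParseState : Type := List Token × List Token × List RawItem

/-- Processes a token. The second end marker from the right ends the name and is the last token of
the function term. -/
def parseToken (tok : Token) (s : ParseState) : ParseState :=
  match tok with
  | .eq => ([], [], some (some (s.2.1, s.1)) :: s.2.2)
  | .neg => (s.1, s.2.1, some none :: s.2.2)
  | .or => (s.1, s.2.1, none :: s.2.2)
  | tok => bif s.2.1.isEmpty && !(decide (tok = .close) && !s.1.isEmpty)
      then (tok :: s.1, s.2.1, s.2.2) else (s.1, tok :: s.2.1, s.2.2)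

/-- The symbols of a word. -/
def parse (w : List Token) : List RawItem := (w.foldr parseToken ([], [], [])).2.2

theorem foldr_parseToken_name (n : Name) (out : List RawItem) :
    (encodeNat n).foldr parseToken ([], [], out) = (encodeNat n, [], out) := by
  rw [encodeNat, List.foldr_append]
  change List.foldr parseToken ([Token.close], [], out) _ = _
  induction n.bits with
  | nil => rfl
  | cons b l ih => cases b <;> rw [List.map_cons, List.foldr_cons, ih] <;> rfl

theorem foldr_parseToken_term (t : FTerm) {nm : List Token} (hnm : nm ≠ [])
    (out : List RawItem) :
    (encodeFTerm t).foldr parseToken (nm, [], out) = (nm, encodeFTerm t, out) := by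
  have hnm' : nm.isEmpty = false := by simpa using hnm
  have hclose : parseToken .close (nm, [], out) = (nm, [Token.close], out) := by
    simp [parseToken, hnm']
  have hdigits : ∀ l : List Token,
      (∀ tok ∈ l, tok = .zero ∨ tok = .one ∨ tok = .arg ∨ tok = .close) →
      ∀ tm ≠ [], l.foldr parseToken (nm, tm, out) = (nm, l ++ tm, out) := by
    intro l hl tm htm
    induction l with
    | nil => rfl
    | cons tok l ih =>
      rw [List.foldr_cons, ih fun x hx => hl x (List.mem_cons_of_mem _ hx)]
      have hempty : (l ++ tm).isEmpty = false := by simp [htm]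
      rcases hl tok (by simp) with rfl | rfl | rfl | rfl <;> simp only [parseToken, hempty] <;> rfl
  have hnat : ∀ n, ∀ tok ∈ encodeNat n, tok = .zero ∨ tok = .one ∨ tok = .arg ∨ tok = .close := by
    intro n tok h
    simp only [encodeNat, List.mem_append, List.mem_map, List.mem_singleton] at h
    rcases h with ⟨b, -, rfl⟩ | rfl
    · cases b <;> simp
    · simp
  rw [encodeFTerm, List.foldr_append]
  refine (congrArg (List.foldr parseToken · _) hclose).trans (hdigits _ ?_ _ (by simp))
  intro tok h
  rw [List.mem_append, List.mem_flatMap] at h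
  rcases h with h | ⟨n, -, h⟩
  · exact hnat _ _ h
  · rcases List.mem_cons.mp h with rfl | h
    · simp
    · exact hnat _ _ h

theorem foldr_parseToken_formula : ∀ {α : Formula}, α.IsObjective → ∀ out : List RawItem,
    (encodeFormula α).foldr parseToken ([], [], out) = ([], [], α.items.map Item.raw ++ out)
  | .eq t n, _, out => by
    rw [encodeFormula, List.foldr_cons, List.foldr_append, foldr_parseToken_name,
      foldr_parseToken_term t (by simp [encodeNat])]
    rfl
  | .neg α, h, out => by
    rw [encodeFormula, List.foldr_cons, foldr_parseToken_formula (α := α) h]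
    rfl
  | .or α β, h, out => by
    rw [encodeFormula, List.foldr_cons, List.foldr_append, foldr_parseToken_formula h.2,
      foldr_parseToken_formula h.1, Formula.items, List.map_cons, List.map_append,
      List.cons_append, List.append_assoc]
    rfl

theorem rep_items (l : List Item) : rep l = rep (l.map Item.raw) := by
  induction l with
  | nil => rfl
  | cons i l ih =>
    rw [List.map_cons, rep_cons, rep_cons, ih]
    rcases i with _ | _ | p <;> rfl

/-! ### The search problem of an input -/

/-- A number that agrees with `k` up to `2 ^ m`, in binary with at most `m + 1` digits. -/
def cappedDigits (m k : ℕ) : List Bool :=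
  if m < k.bits.length then k.bits.take m ++ [true] else k.bits

/-- The number with the given binary digits, least significant digit first. -/
def digitsValue (l : List Bool) : ℕ := l.foldr (fun b n => 2 * n + b.toNat) 0

theorem digitsValue_bits (n : ℕ) : digitsValue n.bits = n := by
  induction n using Nat.binaryRec' with
  | zero => simp [digitsValue]
  | bit b n h ih =>
    rw [Nat.bits_append_bit _ _ h, digitsValue, List.foldr_cons]
    rw [digitsValue] at ih
    rw [ih, Nat.bit_val]

theorem min_digitsValue_cappedDigits {m F : ℕ} (h : F ≤ 2 ^ m) (k : ℕ) :
    min (digitsValue (cappedDigits m k)) F = min k F := by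
  rw [cappedDigits]
  split_ifs with hk
  · have h₁ : 2 ^ m ≤ k := by
      rw [Nat.size_eq_bits_len] at hk
      exact not_lt.mp fun h' => hk.not_ge (Nat.size_le.mpr h')
    have h₂ : ∀ l : List Bool, 2 ^ l.length ≤ digitsValue (l ++ [true]) := by
      intro l
      induction l with
      | nil => simp [digitsValue]
      | cons b l ih =>
        have : digitsValue (b :: l ++ [true]) = 2 * digitsValue (l ++ [true]) + b.toNat := rfl
        rw [this, List.length_cons, pow_succ]
        omega
    have h₃ := h₂ (k.bits.take m)
    rw [List.length_take, min_eq_left hk.le] at h₃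
    omega
  · rw [digitsValue_bits]

/-- A list whose length is the minimum of the two lengths. -/
def capLength {β : Type} (L : List β) (l : List Unit) : List Unit :=
  (L.foldl (fun s _ => (s.1.tail, bif s.1.isEmpty then s.2 else () :: s.2)) (l, [])).2

theorem length_capLength {β : Type} (L : List β) (l : List Unit) :
    (capLength L l).length = min l.length L.length := by
  suffices ∀ (l m : List Unit), (L.foldl (fun s _ => (s.1.tail, bif s.1.isEmpty then s.2 else
      () :: s.2)) (l, m)).2.length = min l.length L.length + m.length by
    simpa [capLength] using this l []
  induction L with
  | nil => simp
  | cons b L ih =>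
    intro l m
    rw [List.foldl_cons, ih]
    cases l <;> simp; omega

/-- A unit for each split of a search with the depth given by the digits, but at most as many as
there are elements of `L`. -/
def ticks {β : Type} (L : List β) (digits : List Bool) : List Unit :=
  digits.foldr (fun b l => capLength L (l ++ (l ++ bif b then [()] else []))) []

theorem length_ticks {β : Type} (L : List β) (digits : List Bool) :
    (ticks L digits).length = min (digitsValue digits) L.length := by
  induction digits with
  | nil => simp [ticks, digitsValue]
  | cons b digits ih =>
    rw [ticks] at ih ⊢
    rw [List.foldr_cons, length_capLength, List.length_append, List.length_append, ih]
    have : digitsValue (b :: digits) = 2 * digitsValue digits + b.toNat := rfl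
    rw [this]
    cases b <;> simp <;> omega

/-- One name for each element of the list, all of them with more than `m` binary digits. -/
def freshNames {β : Type} (m : ℕ) (L : List β) : List Name :=
  L.foldr (fun _ s => 2 ^ (m + s.length) :: s) []

theorem length_freshNames {β : Type} (m : ℕ) (L : List β) : (freshNames m L).length = L.length := by
  induction L with
  | nil => rfl
  | cons b L ih => rw [freshNames] at ih; simp [freshNames, ih]

theorem mem_freshNames {β : Type} {m : ℕ} {L : List β} {n : ℕ} (h : n ∈ freshNames m L) :
    2 ^ m ≤ n ∧ n < 2 ^ (m + L.length) := by
  induction L with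
  | nil => simp [freshNames] at h
  | cons b L ih =>
    have heq : freshNames m (b :: L) = 2 ^ (m + L.length) :: freshNames m L := by
      conv_rhs => rw [← length_freshNames m L]
      rfl
    rw [heq, List.mem_cons] at h
    rw [List.length_cons, ← add_assoc, pow_succ]
    rcases h with rfl | h
    · have := Nat.pow_le_pow_right (n := 2) (by simp) (Nat.le_add_right m L.length)
      have h₁ := Nat.two_pow_pos (m + L.length)
      exact ⟨this, by linarith⟩
    · obtain ⟨h₁, h₂⟩ := ih h
      exact ⟨h₁, by linarith⟩

theorem nodup_freshNames {β : Type} (m : ℕ) (L : List β) : (freshNames m L).Nodup := by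
  induction L with
  | nil => simp [freshNames]
  | cons b L ih =>
    have heq : freshNames m (b :: L) = 2 ^ (m + L.length) :: freshNames m L := by
      conv_rhs => rw [← length_freshNames m L]
      rfl
    rw [heq, List.nodup_cons]
    exact ⟨fun h => (mem_freshNames h).2.ne rfl, ih⟩

/-- The function terms and names of the literals in a list of symbols. -/
def itemAtoms (l : List Item) : List (FTerm × Name) :=
  (l.map fun i => i.elim [] fun o => o.elim [] fun p => [p]).flatten

theorem itemAtoms_items {α : Formula} (h : α.IsObjective) : itemAtoms α.items = α.atoms := by
  induction α with
  | eq t n => rfl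
  | neg α ih => simpa [itemAtoms, Formula.items, Formula.atoms] using ih h
  | or α β ih₁ ih₂ =>
    simpa [itemAtoms, Formula.items, Formula.atoms] using
      congrArg₂ (· ++ ·) (ih₁ h.1) (ih₂ h.2)
  | bel => exact h.elim

/-- What a search needs to know: the clauses of the knowledge base, the symbols of both formulas,
the function terms, and the names that are to be tried. -/
abbrev Problem : Type := List (List Literal) × List Item × List FTerm × List Name

/-- Whether the second formula is true for the clauses together with the values `A`. -/
def leafTest (P : Problem) (A : List (FTerm × Name)) : Bool :=
  ((P.2.1.foldr (evalItem (fun c => derivable (saturate (A.map (fun p => [Literal.eq p.1 p.2]) ++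
    P.1)) c) (· || ·) (· && ·)) []).tail.headD ([], false, false)).2.1

namespace Input

/-- The formulas of the input as a word. -/
def word (x : Input) : List Token := encodeFormula x.kb ++ encodeFormula x.query

/-- The symbols of the formulas of the input. -/
def items (x : Input) : List Item := x.kb.items ++ x.query.items

/-- The function terms in the input. -/
def terms (x : Input) : List FTerm := ((itemAtoms x.items).map Prod.fst).dedup

/-- The names on the right-hand sides of literals in the input, and as many fresh names as there are
function terms. -/
def candidates (x : Input) : List Name :=
  ((itemAtoms x.items).map Prod.snd).dedup ++ freshNames x.word.length x.terms

/-- The search problem of the input. -/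
def problem (x : Input) : Problem :=
  (((x.items.foldr (evalItem (fun c => [c]) (fun _ _ => []) (· ++ ·)) []).headD ([], [], [])).2.1,
    x.items, x.terms, x.candidates)

/-- A unit for each split that has to be made. -/
def splits (x : Input) : List Unit := ticks x.terms (cappedDigits x.word.length x.level)

theorem atoms_eq (x : Input) : itemAtoms x.items = x.kb.atoms ++ x.query.atoms := by
  rw [← itemAtoms_items x.kb_objective, ← itemAtoms_items x.query_objective]
  simp [itemAtoms, items]

theorem foldr_items (x : Input) {V : Type} (check : List Literal → V) (disj conj : V → V → V) :
    x.items.foldr (evalItem check disj conj) [] =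
      [x.kb.val check disj conj, x.query.val check disj conj] := by
  rw [items, List.foldr_append, foldr_evalItem _ _ _ x.query_objective,
    foldr_evalItem _ _ _ x.kb_objective]

theorem clauses_eq (x : Input) : x.problem.1 = x.kb.clauses := by
  rw [problem, foldr_items]
  rfl

theorem leafTest_iff (x : Input) (A : List (FTerm × Name)) :
    leafTest x.problem A = true ↔
      Truth x.query (clauseSet x.kb.clauses ∪ units {p | p ∈ A}) := by
  have h : clauseSet (A.map (fun p => [Literal.eq p.1 p.2]) ++ x.kb.clauses) =
      clauseSet x.kb.clauses ∪ units {p | p ∈ A} := by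
    ext c
    simp [clauseSet, units, or_and_right, exists_or, or_comm, eq_comm (a := c)]
  rw [← h, ← (truth_val (fun c => derivable_saturate) x.query_objective).1, leafTest, clauses_eq]
  rw [show x.problem.2.1 = x.items from rfl, foldr_items]
  rfl

theorem toFinset_terms (x : Input) : x.terms.toFinset = x.kb.funcs ∪ x.query.funcs := by
  ext t
  simp only [terms, atoms_eq, List.mem_toFinset, List.mem_dedup, List.mem_map, List.mem_append,
    Finset.mem_union, Formula.mem_funcs, or_and_right, exists_or]

theorem length_terms (x : Input) : x.terms.length = x.numFuncs := by
  rw [numFuncs, ← toFinset_terms, List.card_toFinset, terms, List.dedup_idem]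

theorem atom_bounds {α : Formula} (h : α.IsObjective) :
    α.atoms.length ≤ (encodeFormula α).length ∧
      ∀ p ∈ α.atoms, p.2 < 2 ^ (encodeFormula α).length := by
  induction α with
  | eq t n =>
    refine ⟨by simp [Formula.atoms, encodeFormula], fun p hp => ?_⟩
    obtain rfl : p = (t, n) := by simpa [Formula.atoms] using hp
    refine (Nat.lt_size_self n).trans_le (Nat.pow_le_pow_right (by simp) ?_)
    rw [← Nat.size_eq_bits_len]
    simp [encodeFormula, encodeNat]
    omega
  | neg α ih =>
    obtain ⟨h₁, h₂⟩ := ih h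
    rw [encodeFormula, List.length_cons]
    exact ⟨h₁.trans (Nat.le_succ _),
      fun p hp => (h₂ p hp).trans_le (Nat.pow_le_pow_right (by simp) (Nat.le_succ _))⟩
  | or α β ih₁ ih₂ =>
    obtain ⟨h₁, h₂⟩ := ih₁ h.1
    obtain ⟨h₃, h₄⟩ := ih₂ h.2
    rw [encodeFormula, Formula.atoms, List.length_cons, List.length_append, List.length_append]
    refine ⟨by omega, fun p hp => ?_⟩
    rcases List.mem_append.mp hp with hp | hp
    · exact (h₂ p hp).trans_le (Nat.pow_le_pow_right (by simp) (by omega))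
    · exact (h₄ p hp).trans_le (Nat.pow_le_pow_right (by simp) (by omega))
  | bel => exact h.elim

theorem length_terms_le (x : Input) : x.terms.length ≤ x.word.length := by
  have h₁ := (atom_bounds x.kb_objective).1
  have h₂ := (atom_bounds x.query_objective).1
  have h₃ := (List.dedup_sublist ((itemAtoms x.items).map Prod.fst)).length_le
  rw [List.length_map, ← terms, atoms_eq, List.length_append] at h₃
  rw [word, List.length_append]
  omega

theorem length_candidates_le (x : Input) : x.candidates.length ≤ x.numNames + x.numFuncs := by
  rw [candidates, List.length_append, length_freshNames, length_terms]
  refine Nat.add_le_add_right ?_ _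
  rw [← List.card_toFinset, numNames]
  refine Finset.card_le_card fun n hn => ?_
  rw [atoms_eq, List.mem_toFinset, List.mem_map] at hn
  obtain ⟨p, hp, rfl⟩ := hn
  rw [Finset.mem_union]
  exact (List.mem_append.mp hp).imp Formula.mem_names Formula.mem_names

theorem length_splits (x : Input) : x.splits.length = min x.level x.terms.length := by
  rw [splits, length_ticks]
  exact min_digitsValue_cappedDigits (x.length_terms_le.trans Nat.lt_two_pow_self.le) _

theorem terms_ne_nil (x : Input) : x.terms ≠ [] := by
  have h : ∀ α : Formula, α.atoms ≠ [] := by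
    intro α
    induction α <;> simp_all [Formula.atoms]
  simp [terms, atoms_eq, h]

theorem numFuncs_pos (x : Input) : 1 ≤ x.numFuncs := by
  rw [← length_terms]
  exact List.length_pos_iff.mpr x.terms_ne_nil

theorem candidates_ne_nil (x : Input) : x.candidates ≠ [] := by
  have h := terms_ne_nil x
  rw [← List.length_pos_iff] at h ⊢
  rw [candidates, List.length_append, length_freshNames]
  omega

theorem search_problem_iff (x : Input) :
    search (leafTest x.problem) x.terms x.candidates x.splits.length [] = true ↔ x.Yes := by
  have hatom : ∀ p ∈ itemAtoms x.items, p.1 ∈ x.terms ∧ p.2 ∈ x.candidates ∧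
      p.2 ∉ freshNames x.word.length x.terms := by
    intro p hp
    have hp' := hp
    rw [atoms_eq, List.mem_append] at hp'
    refine ⟨List.mem_dedup.mpr (List.mem_map_of_mem hp), List.mem_append_left _
      (List.mem_dedup.mpr (List.mem_map_of_mem hp)), fun h => (mem_freshNames h).1.not_gt ?_⟩
    rcases hp' with hp' | hp'
    · exact ((atom_bounds x.kb_objective).2 p hp').trans_le
        (Nat.pow_le_pow_right (by simp) (by simp [word]))
    · exact ((atom_bounds x.query_objective).2 p hp').trans_le
        (Nat.pow_le_pow_right (by simp) (by simp [word]))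
  have hquery : ∀ p ∈ x.query.atoms, p ∈ itemAtoms x.items := fun p hp => by
    rw [atoms_eq]; exact List.mem_append_right _ hp
  have hkb : ∀ c ∈ clauseSet x.kb.clauses, ∀ l ∈ c, l.atom ∈ itemAtoms x.items := by
    rintro c ⟨d, hd, rfl⟩ l hl
    rw [atoms_eq]
    exact List.mem_append_left _ (atom_mem_clauses x.kb_objective d hd l (by simpa using hl))
  rw [search_iff x.query_objective (leafTest_iff x) x.terms_ne_nil
    (fun c hc l hl => l.term_eq ▸ (hatom _ (hkb c hc l hl)).1)
    (fun p hp => (hatom p (hquery p hp)).1) (fun c hc l hl => (hatom _ (hkb c hc l hl)).2)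
    (fun p hp => (hatom p (hquery p hp)).2) (nodup_freshNames _ _)
    (List.subset_append_right _ _) _ [] (by simp)
    (by rw [length_freshNames, length_splits]; simp), yes_iff, length_splits]
  have hempty : units {p | p ∈ ([] : List (FTerm × Name))} = ∅ := by simp [units]
  rw [hempty, Set.union_empty]
  rcases le_total x.level x.terms.length with h | h
  · rw [min_eq_left h]
  · rw [min_eq_right h]
    have hcard : x.terms.toFinset.card = x.terms.length := by
      rw [List.card_toFinset, terms, List.dedup_idem]
    rw [← hcard] at h ⊢
    refine (bel_stabilizes x.query_objective (fun c hc l hl => ?_) ?_ h).symm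
    · rw [List.mem_toFinset, l.term_eq]
      exact (hatom _ (hkb c hc l hl)).1
    · rw [toFinset_terms]
      exact Finset.subset_union_right

end Input

/-! ### Preparation and steps of the search in polynomial time -/

/-- An input is represented by finitely many digits of its level, and the word of its formulas. -/
instance : TreeRep Input := ⟨fun x => rep (cappedDigits x.word.length x.level, x.word)⟩

theorem sz_token_le (t : Token) : sz t ≤ 15 := by cases t <;> decide

namespace PolyTime

variable {α β : Type} [TreeRep α] [TreeRep β]

theorem parseToken {t : α → Token} {s : α → ParseState} (ht : PolyTime t) (hs : PolyTime s) :
    PolyTime fun a => parseToken (t a) (s a) := by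
  have hnm := fst hs
  have htm := fst (snd hs)
  have hout := snd (snd hs)
  have hdigit : ∀ tok, PolyTime fun a =>
      (bif (s a).2.1.isEmpty && !(decide (tok = .close) && !(s a).1.isEmpty)
        then (tok :: (s a).1, (s a).2.1, (s a).2.2)
        else ((s a).1, tok :: (s a).2.1, (s a).2.2) : ParseState) := fun tok =>
    cond (bool_and (isEmpty htm) (bool_not (bool_and (const _) (bool_not (isEmpty hnm)))))
      (pair (cons (const tok) hnm) (pair htm hout)) (pair hnm (pair (cons (const tok) htm) hout))
  refine finite_casesOn (F := fun tok a => LimitedBelief.parseToken tok (s a)) (fun tok => ?_) ht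
  cases tok with
  | eq => exact pair (const []) (pair (const []) (cons (option_some (option_some (pair htm hnm)))
      hout))
  | neg => exact pair hnm (pair htm (cons (const _) hout))
  | or => exact pair hnm (pair htm (cons (const _) hout))
  | bel => exact hdigit _
  | zero => exact hdigit _
  | one => exact hdigit _
  | arg => exact hdigit _
  | close => exact hdigit _

theorem parse {w : α → List Token} (hw : PolyTime w) : PolyTime fun a => parse (w a) := by
  refine snd (snd (foldr_of_growth hw (const ([], [], []))
    (F := fun (_ : α) (tok : Token) (s : ParseState) => LimitedBelief.parseToken tok s)
    (parseToken (fst snd') (snd snd')) 30 ?_))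
  rintro a tok - ⟨nm, tm, out⟩
  have h := sz_token_le tok
  have h₁ := sz_pos nm
  have h₂ := sz_pos tm
  have hdigit : sz (bif tm.isEmpty && !(decide (tok = .close) && !nm.isEmpty)
        then (tok :: nm, tm, out) else (nm, tok :: tm, out)) ≤ sz (nm, tm, out) + 30 := by
    cases tm.isEmpty && !(decide (tok = .close) && !nm.isEmpty) <;> simp <;> omega
  rw [Polynomial.eval_ofNat]
  cases tok with
  | eq => simp [LimitedBelief.parseToken]; omega
  | neg => simp [LimitedBelief.parseToken]; omega
  | or => simp [LimitedBelief.parseToken]; omega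
  | bel => exact hdigit
  | zero => exact hdigit
  | one => exact hdigit
  | arg => exact hdigit
  | close => exact hdigit

theorem dedup [FaithfulRep β] [DecidableEq β] {L : α → List β} (hL : PolyTime L) :
    PolyTime fun a => (L a).dedup := by
  obtain ⟨q, hq⟩ := hL.sz_le
  refine (foldr_of_growth hL (const []) 
    (F := fun (_ : α) (b : β) (s : List β) => bif decide (b ∈ s) then s else b :: s)
    (cond (mem (fst snd') (snd snd')) (snd snd') (cons (fst snd') (snd snd')))
    (q + 1) ?_).of_eq fun a => ?_
  · intro a b hb s
    have h₁ := hq a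
    have h₂ := sz_le_of_mem hb
    cases decide (b ∈ s) <;> simp; omega
  · induction L a with
    | nil => rfl
    | cons b l ih =>
      rw [List.foldr_cons, ih]
      by_cases h : b ∈ l
      · rw [List.dedup_cons_of_mem h]; simp [h]
      · rw [List.dedup_cons_of_notMem h]; simp [h]

theorem two_pow_length {L : α → List β} (hL : PolyTime L) :
    PolyTime fun a => 2 ^ (L a).length := by
  refine (append (map hL (f := fun _ _ => Token.zero) (const _))
    (const [Token.one, Token.close])).of_rep_eq fun a => ?_
  have : ∀ n, encodeNat (2 ^ n) = List.replicate n Token.zero ++ [Token.one, Token.close] := by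
    intro n
    induction n with
    | zero => simp [encodeNat]
    | succ n ih =>
      rw [encodeNat] at ih ⊢
      rw [pow_succ, mul_comm, Nat.bit0_bits _ (by positivity), List.replicate_succ,
        List.cons_append, ← ih]
      rfl
  rw [List.map_const', ← this]
  rfl

theorem freshNames {w : α → List Token} {L : α → List β} (hw : PolyTime w) (hL : PolyTime L) :
    PolyTime fun a => freshNames (w a).length (L a) := by
  obtain ⟨qw, hqw⟩ := hw.sz_le
  obtain ⟨qL, hqL⟩ := hL.sz_le
  have hF : PolyTime fun x : α × β × List Name =>
      2 ^ ((w x.1).length + x.2.2.length) :: x.2.2 := by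
    refine cons ((two_pow_length (append (map (hw.comp fst') (f := fun _ _ => ()) (const ()))
      (map (snd snd') (f := fun _ _ => ()) (const ())))).of_eq fun x => ?_) (snd snd')
    simp
  have hpow : PolyTime fun l : List Unit => 2 ^ l.length := two_pow_length id'
  obtain ⟨q, hq⟩ := hpow.sz_le
  refine foldr hL (const []) 
    (F := fun (a : α) (_ : β) (s : List Name) => 2 ^ ((w a).length + s.length) :: s) hF
    (qL * (q.comp (2 * (qw + qL) + 1) + 1) + 1) fun a l hl => ?_
  set n := (w a).length
  set B := q.eval (2 * (qw.eval (sz a) + qL.eval (sz a)) + 1)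
  suffices ∀ l, l <:+ L a → sz (LimitedBelief.freshNames n l) ≤ l.length * (B + 1) + 1 by
    have h₁ := this l hl
    have h₂ := hl.length_le
    have h₃ := length_lt_sz (L a)
    have h₄ := hqL a
    have h₅ : l.length * (B + 1) ≤ qL.eval (sz a) * (B + 1) := Nat.mul_le_mul_right _ (by omega)
    refine (h₁.trans (Nat.add_le_add_right h₅ 1)).trans_eq ?_
    simp [B]
  intro l
  induction l with
  | nil => simp [LimitedBelief.freshNames]
  | cons b l ih =>
    intro hl
    have h₁ := ih ((List.suffix_cons b l).trans hl)
    have h₂ := hl.length_le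
    have h₃ := length_lt_sz (L a)
    have h₄ := hqL a
    have h₅ := length_lt_sz (w a)
    have h₆ := hqw a
    have h₇ := hq (List.replicate (n + l.length) ())
    rw [List.length_replicate, sz_units, List.length_replicate] at h₇
    have h₈ := h₇.trans (eval_mono q (n := 2 * (qw.eval (sz a) + qL.eval (sz a)) + 1)
      (by rw [List.length_cons] at h₂; omega))
    have heq : LimitedBelief.freshNames n (b :: l) =
        2 ^ (n + l.length) :: LimitedBelief.freshNames n l := by
      conv_rhs => rw [← length_freshNames n l]
      rfl
    rw [heq, sz_cons, List.length_cons, add_mul]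
    omega

theorem capLength {L : α → List β} {l : α → List Unit} (hL : PolyTime L) (hl : PolyTime l) :
    PolyTime fun a => capLength (L a) (l a) := by
  refine snd (foldl_of_growth hL (pair hl (const []))
    (F := fun (_ : α) (s : List Unit × List Unit) (_ : β) =>
      (s.1.tail, bif s.1.isEmpty then s.2 else () :: s.2))
    (pair (tail (fst (fst snd'))) (cond (isEmpty (fst (fst snd'))) (snd (fst snd'))
      (cons (const ()) (snd (fst snd'))))) 2 ?_)
  rintro a b - ⟨_ | ⟨u, l⟩, m⟩ <;> simp; omega

theorem ticks {L : α → List β} {digits : α → List Bool} (hL : PolyTime L) (hd : PolyTime digits) :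
    PolyTime fun a => ticks (L a) (digits a) := by
  obtain ⟨q, hq⟩ := hL.sz_le
  have hF : PolyTime fun x : α × Bool × List Unit =>
      LimitedBelief.capLength (L x.1) (x.2.2 ++ (x.2.2 ++ bif x.2.1 then [()] else [])) :=
    capLength (hL.comp fst') (append (snd snd') (append (snd snd')
      (cond (fst snd') (const _) (const _))))
  refine foldr hd (const []) (F := fun (a : α) (b : Bool) (l : List Unit) =>
    LimitedBelief.capLength (L a) (l ++ (l ++ bif b then [()] else []))) hF (2 * q + 1)
    fun a l _ => ?_
  have h₁ := length_ticks (L a) l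
  have h₂ := length_lt_sz (L a)
  have h₃ := hq a
  change sz (LimitedBelief.ticks (L a) l) ≤ _
  rw [sz_units, h₁]
  simp
  omega

theorem itemAtoms {l : α → List Item} (hl : PolyTime l) : PolyTime fun a => itemAtoms (l a) := by
  have h : PolyTime fun x : α × Item => x.2.elim [] fun o => o.elim [] fun p => [p] := by
    have h' : PolyTime fun x : (α × Item) × Option (FTerm × Name) => x.2.elim [] fun p => [p] :=
      option_casesOn snd' (const []) (h := fun _ p => [p]) (cons snd' (const []))
    exact option_casesOn snd' (const []) (h := fun (_ : α × Item) (o : Option (FTerm × Name)) =>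
      o.elim [] fun p => [p]) h'
  have h' : PolyTime fun a => (l a).map fun i => i.elim [] fun o => o.elim [] fun p => [p] :=
    map hl (f := fun (_ : α) (i : Item) => i.elim [] fun o => o.elim [] fun p => [p]) h
  exact flatten h'

theorem leafTest {P : α → Problem} {A : α → List (FTerm × Name)} (hP : PolyTime P)
    (hA : PolyTime A) : PolyTime fun a => leafTest (P a) (A a) := by
  have hunits : PolyTime fun a => (A a).map fun p => [Literal.eq p.1 p.2] :=
    map hA (f := fun (_ : α) (p : FTerm × Name) => [Literal.eq p.1 p.2])
      (cons (lit_eq (fst snd') (snd snd')) (const []))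
  have hcheck : PolyTime fun x : α × List Literal => LimitedBelief.derivable
      (LimitedBelief.saturate ((A x.1).map (fun p => [Literal.eq p.1 p.2]) ++ (P x.1).1)) x.2 :=
    derivable (saturate (append (hunits.comp fst') (fst (hP.comp fst')))) snd'
  have hbool : ∀ b b' : Bool, sz b' ≤ sz b + 3 := fun b b' => by
    have := sz_bool_le b'; omega
  have hbool' : ∀ (c : List Literal) (b : Bool), sz b ≤ sz c + 3 := fun c b => by
    have := sz_bool_le b; omega
  have h : PolyTime fun a => (P a).2.1.foldr (LimitedBelief.evalItem (fun c =>
      LimitedBelief.derivable (LimitedBelief.saturate ((A a).map (fun p => [Literal.eq p.1 p.2]) ++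
        (P a).1)) c) (· || ·) (· && ·)) [] :=
    foldr_evalItem (fst (snd hP)) hcheck (bool_or fst' snd') (bool_and fst' snd')
      (fun a c => hbool' _ _) (fun u v => (hbool v _).trans (by omega))
      fun u v => (hbool v _).trans (by omega)
  have h' := headD (tail h) ([], false, false)
  exact fst (snd h')

end PolyTime

namespace Input

theorem polyTime_word : PolyTime fun x : Input => x.word :=
  (PolyTime.snd' (α := List Bool) (β := List Token)).comap
    (fun x : Input => (cappedDigits x.word.length x.level, x.word)) fun _ => rfl

theorem polyTime_items : PolyTime fun x : Input => x.items := by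
  refine (PolyTime.parse polyTime_word).of_rep_eq fun x => ?_
  rw [rep_items]
  congr 1
  rw [parse, word, List.foldr_append, foldr_parseToken_formula x.query_objective,
    foldr_parseToken_formula x.kb_objective]
  simp [items]

theorem polyTime_terms : PolyTime fun x : Input => x.terms := by
  have h : PolyTime fun x : Input => (itemAtoms x.items).map Prod.fst :=
    polyTime_items.itemAtoms.map (f := fun (_ : Input) (p : FTerm × Name) => p.1) (.fst .snd')
  exact h.dedup

theorem polyTime_candidates : PolyTime fun x : Input => x.candidates := by
  have h : PolyTime fun x : Input => (itemAtoms x.items).map Prod.snd :=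
    polyTime_items.itemAtoms.map (f := fun (_ : Input) (p : FTerm × Name) => p.2) (.snd .snd')
  exact h.dedup.append (polyTime_word.freshNames polyTime_terms)

theorem polyTime_problem : PolyTime fun x : Input => x.problem := by
  have h : PolyTime fun x : Input =>
      x.items.foldr (evalItem (fun c => [c]) (fun _ _ => []) (· ++ ·)) [] := by
    have hcheck : PolyTime fun x : Input × List Literal => [x.2] := .cons .snd' (.const [])
    have hconj : PolyTime fun x : List (List Literal) × List (List Literal) => x.1 ++ x.2 :=
      .append .fst' .snd'
    refine .foldr_evalItem polyTime_items (check := fun (_ : Input) (c : List Literal) => [c])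
      hcheck (.const []) hconj
      (fun a c => ?_) (fun u v => ?_) fun u v => ?_
    · simp
    · simp
    · have := sz_append u v
      omega
  exact .pair (.fst (.snd (h.headD ([], [], [])))) (polyTime_items.pair
    (polyTime_terms.pair polyTime_candidates))

theorem polyTime_splits : PolyTime fun x : Input => x.splits :=
  polyTime_terms.ticks ((PolyTime.fst' (α := List Bool) (β := List Token)).comap
    (fun x : Input => (cappedDigits x.word.length x.level, x.word)) fun _ => rfl)

end Input

/-- A step of the search for a problem. The list in front is empty if the search is finished. -/
def problemStep (z : List Unit × Problem × SearchState) : List Unit × Problem × SearchState :=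
  let s := searchStep (leafTest z.2.1) z.2.1.2.2.1 z.2.1.2.2.2 z.2.2
  (bif finished s then [] else [()], z.2.1, s)

theorem polyTime_problemStep : PolyTime problemStep := by
  have hP : PolyTime fun z : List Unit × Problem × SearchState => z.2.1 := .fst .snd'
  have hleaf : PolyTime fun x : (List Unit × Problem × SearchState) × List (FTerm × Name) =>
      leafTest x.1.2.1 x.2 := .leafTest (hP.comp .fst') .snd'
  have h : PolyTime fun z : List Unit × Problem × SearchState =>
      searchStep (leafTest z.2.1) z.2.1.2.2.1 z.2.1.2.2.2 z.2.2 :=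
    .searchStep (leaf := fun z : List Unit × Problem × SearchState => leafTest z.2.1) hleaf
      (.fst (.snd (.snd hP)))
      (.snd (.snd (.snd hP))) (.snd .snd')
  have hfin : PolyTime fun z : List Unit × Problem × SearchState =>
      bif finished (searchStep (leafTest z.2.1) z.2.1.2.2.1 z.2.1.2.2.2 z.2.2)
      then ([] : List Unit) else [()] := .cond h.finished (.const []) (.const [()])
  exact hfin.pair (hP.pair h)

theorem problemStep_iterate (P : Problem) (s : SearchState) (hs : finished s = false) (i : ℕ) :
    problemStep^[i] ([()], P, s) =
      (bif finished ((searchStep (leafTest P) P.2.2.1 P.2.2.2)^[i] s) then [] else [()], P,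
        (searchStep (leafTest P) P.2.2.1 P.2.2.2)^[i] s) := by
  induction i with
  | zero => simp [hs]
  | succ i ih => rw [Function.iterate_succ_apply', Function.iterate_succ_apply', ih]; rfl

/-! ### Reading the input -/

/-- Moves the input to the stack `rev`, which reverses it. -/
def reverseInput : Prog Sym := loop .inp isNone fun o =>
  match (o : Option Token) with
  | some t => push .rev (t : Token)
  | none => skip

/-- Moves the binary digits of the level to the stack `a`. They end at the end marker of the
query, which stays on its stack. -/
def readDigits : Prog Sym :=
  seq (switch .rev fun _ => skip) (seq
    (loop .rev (fun o => match (o : Option Token) with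
        | some .zero => false
        | some .one => false
        | _ => true)
      fun o => match (o : Option Token) with
        | some .one => push .a (true : Bool)
        | _ => push .a (false : Bool))
    (push .rev Token.close))

/-- Writes the list of the tokens on the stack `rev` to the main stack. For each token, a digit is
moved from the stack `a` to the stack `c`. -/
def writeWord : Prog Sym := loop .rev isNone fun o =>
  match (o : Option Token) with
  | some t => seq (pushes (rep (α := Token) t).code) (seq (push .main (true : Bool))
      (switch .a fun o => match (o : Option Bool) with
        | some x => push .c x
        | none => skip))
  | none => skip

/-- Writes the list of the digits on the stack `c` to the main stack, followed by `true` if there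
are digits left on the stack `a`. -/
def writeDigits : Prog Sym :=
  seq (push .main (false : Bool)) (seq
    (switch .a fun o => match (o : Option Bool) with
      | some _ => seq (pushes (true :: (rep true).code)) dropA
      | none => skip)
    (loop .c isNone fun o => match (o : Option Bool) with
      | some x => pushes (true :: (rep (α := Bool) x).code)
      | none => skip))

/-- Turns an input into its representation. -/
def load : Prog Sym :=
  seq reverseInput (seq readDigits (seq (push .main (false : Bool)) (seq writeWord
    (seq writeDigits (push .main (true : Bool))))))

theorem runs_reverseInput (i : List Token) : ∀ {r : List Token},
    Runs reverseInput (store i r [] [] [] []) (2 * i.length + 1)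
      (store [] (i.reverse ++ r) [] [] [] []) := by
  induction i with
  | nil => exact Runs.loop_exit rfl pop_inp
  | cons t i ih =>
    intro r
    have h := ih (r := t :: r)
    rw [List.reverse_cons, List.append_assoc]
    refine (Runs.loop_step (some t) rfl rfl pop_inp (Runs.push push_rev) h).mono ?_
    simp; omega

theorem runs_readDigits (l : List Bool) (r : List Token) :
    Runs readDigits (store [] (Token.close :: ((l.map fun b => if b then Token.one else .zero) ++
        Token.close :: r)) [] [] [] []) (2 * l.length + 4)
      (store [] (Token.close :: r) [] l.reverse [] []) := by
  have h : ∀ (l a : List Bool), Runs (loop .rev (fun o => match (o : Option Token) with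
        | some .zero => false
        | some .one => false
        | _ => true)
      fun o => match (o : Option Token) with
        | some .one => push .a (true : Bool)
        | _ => push .a (false : Bool))
      (store [] ((l.map fun b => if b then Token.one else .zero) ++ Token.close :: r) [] a [] [])
      (2 * l.length + 1) (store [] r [] (l.reverse ++ a) [] []) := by
    intro l
    induction l with
    | nil => exact fun a => Runs.loop_exit rfl pop_rev
    | cons b l ih =>
      intro a
      have h := ih (b :: a)
      rw [List.reverse_cons, List.append_assoc]
      cases b
      · refine (Runs.loop_step (some Token.zero) rfl rfl pop_rev (Runs.push push_a) h).mono ?_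
        simp; omega
      · refine (Runs.loop_step (some Token.one) rfl rfl pop_rev (Runs.push push_a) h).mono ?_
        simp; omega
  have h' := h l []
  rw [List.append_nil] at h'
  exact (((Runs.switch (some Token.close) rfl pop_rev Runs.skip).mono le_rfl).seq
    (h'.seq (Runs.push push_rev))).mono (by omega)

theorem runs_writeWord (r : List Token) : ∀ {w : List Token} {a c : List Bool},
    Runs writeWord (store [] r (rep w).code a [] c) (20 * r.length + 1)
      (store [] [] (rep (r.reverse ++ w)).code (a.drop r.length) []
        ((a.take r.length).reverse ++ c)) := by
  induction r with
  | nil => exact Runs.loop_exit rfl pop_rev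
  | cons t r ih =>
    intro w a c
    have hsz : (rep t).code.length ≤ 15 := sz_token_le t
    have hw : true :: ((rep t).code ++ (rep w).code) = (rep (t :: w)).code := rfl
    have hstep : Runs (seq (pushes (rep t).code) (seq (push .main (true : Bool))
        (switch .a fun o => match (o : Option Bool) with
          | some x => push .c x
          | none => skip))) (store [] r (rep w).code a [] c) 19
        (store [] r (rep (t :: w)).code a.tail [] ((a.take 1).reverse ++ c)) := by
      refine ((runs_pushes _).seq ((Runs.push push_main).seq
        (n := 1) (m := 2) ?_)).mono (by omega)
      rw [hw]
      cases a with
      | nil => exact (Runs.switch none rfl pop_a Runs.skip).mono le_rfl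
      | cons x a => exact (Runs.switch (some x) rfl pop_a (Runs.push push_c)).mono le_rfl
    have h := ih (w := t :: w) (a := a.tail) (c := (a.take 1).reverse ++ c)
    have hrev : (t :: r).reverse ++ w = r.reverse ++ t :: w := by simp
    have hdrop : a.drop (t :: r).length = a.tail.drop r.length := by cases a <;> simp
    have htake : (a.take (t :: r).length).reverse ++ c =
        (a.tail.take r.length).reverse ++ ((a.take 1).reverse ++ c) := by cases a <;> simp
    rw [hrev, hdrop, htake]
    refine (Runs.loop_step (some t) rfl rfl pop_rev hstep h).mono ?_
    simp; omega

theorem runs_writeDigits (c : List Bool) {a m : List Bool} :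
    Runs writeDigits (store [] [] m a [] c) (6 * c.length + 2 * a.length + 9)
      (work ((rep (c.reverse ++ if a = [] then [] else [true])).code ++ m)) := by
  have h : ∀ (c l : List Bool), Runs (loop .c isNone fun o => match (o : Option Bool) with
      | some x => pushes (true :: (rep (α := Bool) x).code)
      | none => skip) (store [] [] ((rep l).code ++ m) [] [] c) (6 * c.length + 1)
        (work ((rep (c.reverse ++ l)).code ++ m)) := by
    intro c
    induction c with
    | nil => exact fun l => Runs.loop_exit rfl pop_c
    | cons x c ih =>
      intro l
      have hsz : (rep x).code.length ≤ 3 := sz_bool_le x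
      have hl : true :: (rep x).code ++ ((rep l).code ++ m) = (rep (x :: l)).code ++ m := by
        rw [rep_cons, Data.code, List.cons_append, List.cons_append, List.append_assoc]
      have h := ih (x :: l)
      rw [← hl] at h
      rw [List.reverse_cons, List.append_assoc]
      refine (Runs.loop_step (some x) rfl rfl pop_c (runs_pushes _) h).mono ?_
      simp; omega
  have h' := h c (if a = [] then [] else [true])
  refine ((Runs.push push_main).seq (Runs.seq (n := 2 * a.length + 7)
    (S' := store [] [] ((rep (if a = [] then [] else [true])).code ++ m) [] [] c) ?_ h')).mono
    (by omega)
  cases a with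
  | nil => exact (Runs.switch none rfl pop_a Runs.skip).mono (by simp)
  | cons x a =>
    refine (Runs.switch (some x) rfl pop_a ((runs_pushes _).seq (runs_dropA _))).mono ?_
    simp [rep_true, Data.code]; omega

theorem runs_load (x : Input) :
    Runs load (store x.encode [] [] [] [] [])
      (32 * x.word.length + 20 * x.level.bits.length + 30) (work (rep x).code) := by
  obtain ⟨w, hw⟩ : ∃ w, x.word.reverse = Token.close :: w := by
    have : ∀ α : Formula, ∃ w, (encodeFormula α).reverse = Token.close :: w := by
      intro α
      induction α with
      | eq t n => exact ⟨_, by rw [encodeFormula, encodeNat]; simp; rfl⟩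
      | neg α ih => obtain ⟨w, hw⟩ := ih; exact ⟨_, by rw [encodeFormula]; simp [hw]; rfl⟩
      | or α β _ ih => obtain ⟨w, hw⟩ := ih; exact ⟨_, by rw [encodeFormula]; simp [hw]; rfl⟩
      | bel k α ih => obtain ⟨w, hw⟩ := ih; exact ⟨_, by rw [encodeFormula]; simp [hw]; rfl⟩
    obtain ⟨w, hw⟩ := this x.query
    exact ⟨_, by rw [Input.word, List.reverse_append, hw]; rfl⟩
  set bits := x.level.bits
  set n := x.word.length
  have hlen : x.encode.length = n + bits.length + 1 := by
    simp [Input.encode, n, Input.word, encodeNat, bits]; omega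
  have h₁ := runs_reverseInput x.encode (r := [])
  have hrev : x.encode.reverse ++ [] = Token.close ::
      ((bits.reverse.map fun b => if b then Token.one else .zero) ++ Token.close :: w) := by
    rw [← hw]
    simp [Input.encode, Input.word, encodeNat, bits]
  rw [hrev] at h₁
  have h₂ := runs_readDigits bits.reverse w
  rw [List.reverse_reverse, List.length_reverse] at h₂
  have h₃ := runs_writeWord x.word.reverse (w := []) (a := bits) (c := [])
  rw [List.length_reverse, List.reverse_reverse, List.append_nil, List.append_nil, hw] at h₃
  have h₄ := runs_writeDigits (bits.take n).reverse (a := bits.drop n) (m := (rep x.word).code)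
  have hdigits : (bits.take n).reverse.reverse ++ (if bits.drop n = [] then [] else [true]) =
      cappedDigits n x.level := by
    rw [List.reverse_reverse, cappedDigits]
    by_cases h : bits.length ≤ n
    · rw [if_pos (List.drop_eq_nil_of_le h), if_neg h.not_gt, List.take_of_length_le h,
        List.append_nil]
    · rw [if_neg (by simpa using h), if_pos (not_le.mp h)]
  rw [hdigits] at h₄
  refine (h₁.seq (h₂.seq ((Runs.push push_main).seq (h₃.seq (h₄.seq
    (Runs.push push_main)))))).mono ?_
  simp
  omega

/-! ### The decision procedure -/

/-- Moves a truth value from the main stack to the stack `a`. -/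
def output : Prog Sym :=
  switch .main fun o => match (o : Option Bool) with
    | some true => seq (switch .main fun _ => skip) (seq (switch .main fun _ => skip)
        (push .a (true : Bool)))
    | _ => push .a (false : Bool)

theorem runs_output (b : Bool) :
    Runs output (work (rep b).code) 6 (store [] [] [] [b] [] []) := by
  cases b
  · exact (runs_switch false (Runs.push push_a)).mono (by omega)
  · exact (runs_switch true ((runs_switch false (f := fun _ => skip) Runs.skip).seq
      ((runs_switch false (f := fun _ => skip) Runs.skip).seq (Runs.push push_a)))).mono (by omega)

/-- The state in which the search for an input starts. -/
def Input.start (x : Input) : List Unit × Problem × SearchState :=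
  ([()], x.problem, [], x.splits, none)

theorem Input.polyTime_start : PolyTime Input.start :=
  .pair (.const _) (.pair polyTime_problem (.pair (.const _) (.pair polyTime_splits (.const _))))

theorem Input.sz_le (x : Input) : sz x ≤ 20 * x.word.length + 10 := by
  have h₁ : sz x = sz (cappedDigits x.word.length x.level) + sz x.word + 1 := sz_pair _ _
  have h₂ : ∀ l : List Bool, sz l ≤ 4 * l.length + 1 := by
    intro l
    induction l with
    | nil => simp
    | cons b l ih => have := sz_bool_le b; simp; omega
  have h₃ : ∀ l : List Token, sz l ≤ 16 * l.length + 1 := by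
    intro l
    induction l with
    | nil => simp
    | cons t l ih => have := sz_token_le t; simp; omega
  have h₄ : (cappedDigits x.word.length x.level).length ≤ x.word.length + 1 := by
    unfold cappedDigits
    split_ifs
    · simp
    · omega
  have h₅ := h₂ (cappedDigits x.word.length x.level)
  have h₆ := h₃ x.word
  omega

open Classical in
/-- The running time is dominated by the number of branches of the search, at most
`(|F| * (|N| + |F|)) ^ |F|`, where the inner summand `|F|` accounts for the fresh names. -/
theorem exists_runs : ∃ (p : Prog Sym) (q : Polynomial ℕ) (c : ℕ), ∀ x : Input,
    Runs p (store x.encode [] [] [] [] [])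
      ((x.numFuncs * (x.numNames + x.numFuncs)) ^ x.numFuncs * q.eval x.word.length +
        c * x.level.bits.length)
      (store [] [] [] [decide x.Yes] [] []) := by
  obtain ⟨r, hr⟩ := Input.polyTime_problem.sz_le
  obtain ⟨p₁, q₁, hp₁⟩ := Input.polyTime_start
  obtain ⟨p₂, q₂, hp₂⟩ := polyTime_problemStep
  have hresult : PolyTime fun z : Problem × SearchState => z.2.2.2.elim false fun b => b :=
    .option_casesOn (.snd (.snd .snd')) (.const false)
      (h := fun (_ : Problem × SearchState) (b : Bool) => b) .snd'
  obtain ⟨p₃, q₃, hp₃⟩ := hresult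
  let S : Polynomial ℕ := 20 * .X + 10
  let B : Polynomial ℕ := .X * (r.comp S + 2) + 2 * .X + 9 + r.comp S + 10
  refine ⟨seq load (seq p₁ (seq (switch .main fun _ => skip) (seq (repeatProg p₂)
    (seq p₃ output)))), 32 * .X + 30 + q₁.comp S + (2 * .X + 1) * (q₂.comp B + 5) + q₃.comp B + 10,
    20, fun x => ?_⟩
  set m := x.word.length
  set F := x.numFuncs
  set W := (F * (x.numNames + F)) ^ F
  have hS : sz x ≤ S.eval m := by simpa [S] using x.sz_le
  have hsplits : x.splits.length ≤ F := by
    rw [Input.length_splits, Input.length_terms]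
    exact min_le_right _ _
  have hFm : F ≤ m := x.length_terms.symm.trans_le x.length_terms_le
  have hF : 1 ≤ F := x.numFuncs_pos
  have hW : 1 ≤ W := Nat.one_le_pow _ _ (by positivity)
  obtain ⟨n, hn, hnot, hend⟩ := exists_searchStep_iterate (leaf := leafTest x.problem)
    x.terms_ne_nil x.candidates_ne_nil x.splits
  have hnW : n ≤ (2 * m + 1) * W := by
    have hQ : x.terms.length * x.candidates.length ≤ F * (x.numNames + F) := by
      rw [Input.length_terms]
      exact Nat.mul_le_mul_left _ x.length_candidates_le
    have hQ' : 1 ≤ x.terms.length * x.candidates.length :=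
      Nat.mul_pos (List.length_pos_iff.mpr x.terms_ne_nil)
        (List.length_pos_iff.mpr x.candidates_ne_nil)
    calc n ≤ _ := hn.trans (searchTime_le hQ' _)
      _ ≤ (2 * m + 1) * (F * (x.numNames + F)) ^ x.splits.length :=
        Nat.mul_le_mul (by omega) (Nat.pow_le_pow_left hQ _)
      _ ≤ (2 * m + 1) * W := Nat.mul_le_mul_left _ (Nat.pow_le_pow_right (hQ'.trans hQ) hsplits)
  have hiter : ∀ i, problemStep^[i] x.start =
      (bif finished ((searchStep (leafTest x.problem) x.terms x.candidates)^[i]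
          ([], x.splits, none)) then [] else [()], x.problem,
        (searchStep (leafTest x.problem) x.terms x.candidates)^[i] ([], x.splits, none)) :=
    problemStep_iterate x.problem ([], x.splits, none) rfl
  have hB : ∀ i, sz (problemStep^[i] x.start) ≤ B.eval m := by
    intro i
    have h₁ := sz_searchStep_iterate_le (leaf := leafTest x.problem) (Fs := x.terms)
      (Ns := x.candidates) (ticks := x.splits) i
    have h₂ := (hr x).trans (eval_mono r hS)
    have h₃ : sz x.problem = sz x.problem.1 + (sz x.items + (sz x.terms + sz x.candidates + 1) + 1)
        + 1 := by
      rw [← sz_pair x.terms, ← sz_pair, ← sz_pair]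
      rfl
    have h₄ : x.splits.length * (sz x.terms + sz x.candidates + 2) ≤ m * (r.eval (S.eval m) + 2) :=
      Nat.mul_le_mul (by omega) (by omega)
    rw [hiter]
    have h₅ : sz (bif finished ((searchStep (leafTest x.problem) x.terms x.candidates)^[i]
        ([], x.splits, none)) then [] else [()]) ≤ 3 := by
      cases finished ((searchStep (leafTest x.problem) x.terms x.candidates)^[i]
        ([], x.splits, none)) <;> simp
    simp only [sz_pair _ (x.problem, _), sz_pair x.problem, B, Polynomial.eval_add,
      Polynomial.eval_mul, Polynomial.eval_X, Polynomial.eval_comp, Polynomial.eval_ofNat]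
    omega
  have hz : problemStep^[n] x.start =
      ([], x.problem, [], x.splits, some (decide x.Yes)) := by
    have hsearch : search (leafTest x.problem) x.terms x.candidates x.splits.length [] =
        decide x.Yes := by
      rw [Bool.eq_iff_iff, x.search_problem_iff, decide_eq_true_iff]
    rw [hiter, hend, hsearch]
    rfl
  have hloop := runs_repeatProg hp₂ (B.eval m) [] n x.start
    (fun i hi => by rw [hiter, hnot i hi]; simp) (by rw [hz]) fun i _ => hB i
  rw [hz] at hloop
  have hload := runs_load x
  have hinit := hp₁ x []
  have hfinal := hp₃ (x.problem, [], x.splits, some (decide x.Yes)) []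
  rw [List.append_nil (rep (Option.elim _ _ _)).code] at hfinal
  rw [List.append_nil] at hinit
  have hstart : (rep x.start).code ++ [] =
      true :: ((rep x.start.1).code ++ ((rep x.start.2).code ++ [])) := by
    have : rep x.start = .cons (rep x.start.1) (rep x.start.2) := rfl
    rw [this, Data.code, List.append_nil, List.append_nil]
  rw [hstart] at hinit
  refine (hload.seq (hinit.seq ((runs_switch true (f := fun _ => skip) Runs.skip).seq
    (hloop.seq (hfinal.seq (runs_output _)))))).mono ?_
  have h₁ := eval_mono q₁ hS
  have h₂ :
      q₃.eval (sz (x.problem, (([], x.splits, some (decide x.Yes)) : SearchState))) ≤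
        q₃.eval (B.eval m) := by
    have := hB n
    rw [hz, sz_pair] at this
    exact eval_mono q₃ (le_of_add_le_of_nonneg_right (by omega) (Nat.zero_le 0))
  have h₃ : n * (q₂.eval (B.eval m) + 5) ≤ W * ((2 * m + 1) * (q₂.eval (B.eval m) + 5)) := by
    calc _ ≤ (2 * m + 1) * W * (q₂.eval (B.eval m) + 5) := Nat.mul_le_mul_right _ hnW
      _ = _ := by ring
  simp only [Polynomial.eval_add, Polynomial.eval_mul, Polynomial.eval_X, Polynomial.eval_comp,
    Polynomial.eval_ofNat, Polynomial.eval_one]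
  have h₄ : 32 * m + 30 + q₁.eval (S.eval m) + q₃.eval (B.eval m) + 10 ≤
      W * (32 * m + 30 + q₁.eval (S.eval m) + q₃.eval (B.eval m) + 10) :=
    Nat.le_mul_of_pos_left _ hW
  calc _ ≤ (32 * m + 30 + q₁.eval (S.eval m) + q₃.eval (B.eval m) + 10) +
        n * (q₂.eval (B.eval m) + 5) + 20 * x.level.bits.length := by omega
    _ ≤ W * (32 * m + 30 + q₁.eval (S.eval m) + q₃.eval (B.eval m) + 10) +
        W * ((2 * m + 1) * (q₂.eval (B.eval m) + 5)) + 20 * x.level.bits.length := by omega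
    _ = _ := by ring

/-! ### Time bounds -/

theorem DecidableInTime.mono {I A : Type} {enc : I → List A} {yes : I → Prop} {time time' : I → ℕ}
    (h : DecidableInTime enc yes time) (hle : ∀ x, time x ≤ time' x) :
    DecidableInTime enc yes time' := by
  obtain ⟨M, hM⟩ := h
  exact ⟨M, fun x => (hM x).map fun e => ⟨e.toEvalsTo, e.steps_le_m.trans (hle x)⟩⟩

theorem DecidableInTime.comp {I J A : Type} {enc : I → List A} {yes : I → Prop} {time : I → ℕ}
    (h : DecidableInTime enc yes time) (e : J → I) :
    DecidableInTime (fun y => enc (e y)) (fun y => yes (e y)) fun y => time (e y) := by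
  obtain ⟨M, hM⟩ := h
  exact ⟨M, fun y => hM (e y)⟩

theorem exists_decidableInTime : ∃ (p : Polynomial ℕ) (c : ℕ),
    DecidableInTime Input.encode Input.Yes fun x =>
      (x.numFuncs * (x.numNames + x.numFuncs)) ^ x.numFuncs *
        p.eval (x.kb.size + x.query.size) + c * Nat.size x.level := by
  obtain ⟨p, q, c, h⟩ := exists_runs
  refine ⟨q + 1, c, ⟨p.machine .inp .a, Equiv.refl Token, Equiv.refl Bool⟩, fun x => ?_⟩
  obtain ⟨n, hn, hexec⟩ := h x
  have hinp : store x.encode [] [] [] [] [] =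
      (Function.update (fun _ => []) Stack.inp (x.encode.map (Equiv.refl Token).symm :) :
        ∀ k, List (Sym k)) := by
    have : x.encode.map (Equiv.refl Token).symm = x.encode := List.map_id _
    rw [this]
    funext k
    cases k <;> rfl
  have hout : ∀ b : Bool, store [] [] [] [b] [] [] =
      (Function.update (fun _ => []) Stack.a ([b].map (Equiv.refl Bool).symm :) :
        ∀ k, List (Sym k)) := by
    intro b
    funext k
    cases k <;> rfl
  rw [hinp, hout] at hexec
  obtain ⟨e⟩ := hexec.outputs
  refine ⟨⟨e.toEvalsTo, e.steps_le_m.trans ?_⟩⟩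
  have hW : 1 ≤ (x.numFuncs * (x.numNames + x.numFuncs)) ^ x.numFuncs := by
    have := x.numFuncs_pos
    exact Nat.one_le_pow _ _ (by positivity)
  have hm : x.word.length = x.kb.size + x.query.size := List.length_append
  rw [hm, Nat.size_eq_bits_len] at hn
  beta_reduce
  rw [Polynomial.eval_add, Polynomial.eval_one, mul_add]
  omega

/-- At least one function term occurs in the input, so that the time for reading the digits of the
level can be absorbed by the polynomial. -/
theorem exists_decidableInTime_length : ∃ p : Polynomial ℕ,
    DecidableInTime Input.encode Input.Yes fun x =>
      (x.numFuncs * (x.numNames + x.numFuncs)) ^ x.numFuncs * p.eval x.encode.length := by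
  obtain ⟨p, c, h⟩ := exists_decidableInTime
  refine ⟨p + Polynomial.C c * .X, h.mono fun x => ?_⟩
  have hF := x.numFuncs_pos
  have hW : 1 ≤ (x.numFuncs * (x.numNames + x.numFuncs)) ^ x.numFuncs :=
    Nat.one_le_pow _ _ (by positivity)
  have hlen : x.encode.length = x.kb.size + x.query.size + (Nat.size x.level + 1) := by
    simp [Input.encode, Formula.size, encodeNat, Nat.size_eq_bits_len, add_assoc]
  have hp := eval_mono p (m := x.kb.size + x.query.size) (n := x.encode.length) (by omega)
  have hc : c * Nat.size x.level ≤ c * x.encode.length := Nat.mul_le_mul_left _ (by omega)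
  rw [Polynomial.eval_add, Polynomial.eval_mul, Polynomial.eval_C, Polynomial.eval_X]
  exact (Nat.add_le_add (Nat.mul_le_mul_left _ hp)
    (hc.trans (Nat.le_mul_of_pos_left _ hW))).trans_eq (mul_add _ _ _).symm

theorem primrec_bound : Primrec fun z : ℕ × ℕ => (z.1 * (z.2 + z.1)) ^ z.1 := by
  have hpow : Primrec₂ ((· ^ ·) : ℕ → ℕ → ℕ) := Primrec₂.unpaired'.1 Nat.Primrec.pow
  exact hpow.comp (Primrec.nat_mul.comp .fst (Primrec.nat_add.comp .snd .fst)) .fst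

theorem fpt_numFuncs_numNames :
    FPT Input.encode Input.Yes fun x => (x.numFuncs, x.numNames) := by
  obtain ⟨p, h⟩ := exists_decidableInTime_length
  exact ⟨fun z => (z.1 * (z.2 + z.1)) ^ z.1, p, primrec_bound.to_comp, h⟩

theorem fpt_numFuncs (b : ℕ) : FPT (fun x : {x : Input // x.numNames ≤ b} => x.1.encode)
    (fun x => x.1.Yes) fun x => x.1.numFuncs := by
  obtain ⟨p, h⟩ := exists_decidableInTime_length
  refine ⟨fun F => (F * (b + F)) ^ F, p, (primrec_bound.comp (.pair .id (.const b))).to_comp,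
    (h.comp Subtype.val).mono fun x => ?_⟩
  exact Nat.mul_le_mul_right _ (Nat.pow_le_pow_left
    (Nat.mul_le_mul_left _ (Nat.add_le_add_right x.2 _)) _)

end LimitedBelief

theorem proposition2 :
    -- with parameters `|F|` and `|N|`, the problem is in FPT
    LimitedBelief.FPT LimitedBelief.Input.encode LimitedBelief.Input.Yes
      (fun x => (x.numFuncs, x.numNames)) ∧
    -- for constant `|N|`, the problem with parameter `|F|` is in FPT
    (∀ b : ℕ,
      LimitedBelief.FPT
        (fun x : {x : LimitedBelief.Input // x.numNames ≤ b} => x.1.encode)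
        (fun x => x.1.Yes) (fun x => x.1.numFuncs)) ∧
    -- the explicit running time; the additive term is for reading the binary digits of the level
    (∃ (p : Polynomial ℕ) (c : ℕ),
      LimitedBelief.DecidableInTime LimitedBelief.Input.encode LimitedBelief.Input.Yes
        (fun x => (x.numFuncs * (x.numNames + x.numFuncs)) ^ x.numFuncs *
          p.eval (x.kb.size + x.query.size) + c * Nat.size x.level)) ∧
    -- belief stabilizes at level `|F|`
    (∀ (s : Set LimitedBelief.Clause) (α : LimitedBelief.Formula)
      (F : Finset LimitedBelief.FTerm), α.IsObjective →
      (∀ c ∈ s, ∀ l ∈ c, l.term ∈ F) → α.funcs ⊆ F →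
      ∀ k : ℕ, F.card ≤ k →
        (LimitedBelief.Truth (.bel k α) s ↔ LimitedBelief.Truth (.bel F.card α) s)) := by
  exact ⟨LimitedBelief.fpt_numFuncs_numNames, LimitedBelief.fpt_numFuncs,
    LimitedBelief.exists_decidableInTime, fun s α F hα hs hF k hk =>
    LimitedBelief.bel_stabilizes hα hs hF hk⟩
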